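/- For $\tau$ in the upper half-plane $\mathbb{H}$ and $q=e^{2\pi i\tau}$, $q^{x}=e^{2\pi i x\tau}$, let \[ \mathcal{C}(\tau)=2\prod_{n=1}^{\infty}\frac{1-q^{2n-1}}{1-q^{2n}}\sum_{n\in\mathbb{Z}}\frac{q^{\frac12 n(n+1)}}{1+q^{n}}=\sum_{n=0}^{\infty}a_{\mathcal{C}}(n)q^{n} \] (in particular the $q$-series with Taylor coefficients $a_{\mathcal C}(n)$ converges to $\mathcal C(\tau)$ for all $\tau\in\mathbb H$). Consider the expansion $q^{-1/8}\,\mathcal{C}(\tau)=\sum_{k\ge 0}a_{\mathcal C}(k)\,q^{(8k-1)/8}$ in powers of $q^{1/8}$, and for a set $R$ of residues modulo $m$ sieve out the terms $q^{N/8}$ with $N \bmod m\in R$: \[ \mathcal{C}_{7(24)}(\tau)=\sum_{\substack{k\ge 0\\ 8k-1\equiv 7\ (24)}}a_{\mathcal C}(k)\,q^{\frac{8k-1}{8}},\qquad \mathcal{C}_{15,23,39(56)}(\tau)=\sum_{\substack{k\ge 0\\ 8k-1\equiv 15,23,39\ (56)}}a_{\mathcal C}(k)\,q^{\frac{8k-1}{8}}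 . \] Let $\nu_\eta\begin{pmatrix}a&b\\c&d\end{pmatrix}=\frac{1}{\sqrt{c\tau+d}}\,\frac{\eta\left(\frac{a\tau+b}{c\tau+d}\right)}{\eta(\tau)}$ (independent of $\tau$; principal branch) be the multiplier of the Dedekind $\eta$-function on $\mathrm{SL}_2(\mathbb{Z})$. For an integer $k$, a function $f:\mathbb{H}\to\mathbb{C}$ is a weakly holomorphic modular form of weight $\frac k2$ on a congruence subgroup $\Gamma\le\mathrm{SL}_2(\mathbb{Z})$ with multiplier $\nu$ if it is holomorphic on $\mathbb{H}$, if $f\left(\frac{a\tau+b}{c\tau+d}\right)=\nu(\gamma)(c\tau+d)^{k/2}f(\tau)$ for all $\gamma=\begin{pmatrix}a&b\\c&d\end{pmatrix}\in\Gamma$ and all $\tau\in\mathbb{H}$, and if it has at most linear exponential growth at the cusps, i.e. for every $\gamma\in\mathrm{SL}_2(\mathbb{Z})$ there is $A\in\mathbb{R}$ with $(c\tau+d)^{-k/2}f(\gamma\tau)=O(e^{A\,\mathrm{Im}\,\tau})$ as $\mathrm{Im}\,\tau\to\infty$, uniformly in $\mathrm{Re}\,\tau$. Then: 1. $\mathcal{C}_{7(24)}$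 is a weakly holomorphic modular form of weight $\frac12$ with multiplier $\nu_\eta^{-3}$ on some subgroup $\Gamma$ of $\mathrm{SL}_2(\mathbb{Z})$ which contains $\Gamma_1(1152)$ and has index $9216$ in $\mathrm{SL}_2(\mathbb{Z})$. 2. $\mathcal{C}_{15,23,39(56)}$ is a weakly holomorphic modular form of weight $\frac12$ with multiplier $\nu_\eta^{-3}$ on some subgroup $\Gamma'$ of $\mathrm{SL}_2(\mathbb{Z})$ which contains $\Gamma_1(6272)$ and has index $129024$ in $\mathrm{SL}_2(\mathbb{Z})$. -/

import Mathlib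

open Complex Filter Asymptotics Manifold
open scoped Real Topology MatrixGroups
open UpperHalfPlane hiding I

noncomputable section

/-- The quotient `η((aτ+b)/(cτ+d)) / (√(cτ+d) η(τ))`, with the principal branch of the root. -/
def etaQuotient (γ : SL(2, ℤ)) (τ : ℍ) : ℂ :=
  1 / (denom γ τ) ^ (1 / 2 : ℂ) * (ModularForm.eta (γ • τ : ℍ) / ModularForm.eta τ)

/-- The `η`-multiplier `ν_η(γ) = η(γτ) / (√(cτ+d) η(τ))`. The right-hand side does not depend on
`τ` (see `etaMultiplier_eq`), so it is evaluated at `τ = i`. -/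
def etaMultiplier (γ : SL(2, ℤ)) : ℂ := etaQuotient γ UpperHalfPlane.I

theorem etaQuotient_pow (γ : SL(2, ℤ)) (τ : ℍ) : etaQuotient γ τ ^ 24 = 1 := by
  have hd : denom γ τ ≠ 0 := denom_ne_zero γ τ
  have he : ModularForm.eta τ ≠ 0 := ModularForm.eta_ne_zero τ.2
  have h : ModularForm.eta (γ • τ : ℍ) ^ 24 = denom γ τ ^ (12 : ℤ) * ModularForm.eta τ ^ 24 :=
    SlashInvariantForm.slash_action_eqn'' CuspForm.discriminant
      (γ := (γ : GL (Fin 2) ℝ)) (MonoidHom.mem_range.2 ⟨γ, rfl⟩) τ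
  have hs : ((denom γ τ) ^ (1 / 2 : ℂ)) ^ 24 = denom γ τ ^ (12 : ℤ) := by
    rw [← cpow_nat_mul, ← cpow_intCast]
    norm_num
  rw [etaQuotient, mul_pow, div_pow, div_pow, hs, h]
  field_simp

theorem continuous_etaQuotient (γ : SL(2, ℤ)) : Continuous (etaQuotient γ) := by
  have heta : Continuous fun τ : ℍ => ModularForm.eta τ := continuous_iff_continuousAt.2 fun τ =>
    (ModularForm.differentiableAt_eta_of_mem_upperHalfPlaneSet τ.2).continuousAt.comp
      continuous_coe.continuousAt
  have hsm : Continuous fun τ : ℍ => γ • τ := 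
    continuous_const_smul (γ : GL (Fin 2) ℝ)
  have hden : ∀ τ : ℍ, denom γ τ = (γ 1 0 : ℂ) * τ + γ 1 1 := fun τ => by simp [denom]
  have hroot : Continuous fun τ : ℍ => (denom γ τ) ^ (1 / 2 : ℂ) := by
    simp_rw [hden]
    by_cases hc : γ 1 0 = 0
    · simp only [hc, Int.cast_zero, zero_mul, zero_add]
      exact continuous_const
    · refine Continuous.cpow (by fun_prop) continuous_const fun τ => Or.inr ?_
      simpa [hc] using τ.im_ne_zero
  exact (continuous_const.div hroot fun τ => by simp [cpow_eq_zero_iff, denom_ne_zero]).mul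
    ((heta.comp hsm).div heta fun τ => ModularForm.eta_ne_zero τ.2)

/-- The `η`-multiplier is well defined: the defining quotient is independent of `τ`. -/
theorem etaMultiplier_eq (γ : SL(2, ℤ)) (τ : ℍ) : etaMultiplier γ = etaQuotient γ τ := by
  have hfin : {z : ℂ | z ^ 24 = 1}.Finite := by
    refine (Polynomial.nthRootsFinset 24 (1 : ℂ)).finite_toSet.subset fun z hz => ?_
    simpa [Polynomial.mem_nthRootsFinset] using hz
  exact isPreconnected_univ.constant_of_mapsTo hfin.isDiscrete
    (continuous_etaQuotient γ).continuousOn (fun τ _ => etaQuotient_pow γ τ)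
    (Set.mem_univ _) (Set.mem_univ _)

/-- `f` is a weakly holomorphic modular form of weight `k / 2` with respect to the congruence
subgroup `Γ` and the multiplier system `ν`. -/
structure IsWeaklyHolomorphicModularForm (k : ℤ) (Γ : Subgroup SL(2, ℤ)) (ν : SL(2, ℤ) → ℂ)
    (f : ℍ → ℂ) : Prop where
  congruence : CongruenceSubgroup.IsCongruenceSubgroup Γ
  transform : ∀ γ ∈ Γ, ∀ τ : ℍ, f (γ • τ) = ν γ * (denom γ τ) ^ ((k : ℂ) / 2) * f τ
  holomorphic : MDifferentiable 𝓘(ℂ) 𝓘(ℂ) f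
  /-- At most linear exponential growth at every cusp `γ∞`. -/
  growth : ∀ γ : SL(2, ℤ), ∃ A : ℝ,
    (fun τ : ℍ => (denom γ τ) ^ (-((k : ℂ) / 2)) * f (γ • τ)) =O[atImInfty]
      fun τ : ℍ => Real.exp (A * τ.im)

/-- The function
`𝒞(τ) = 2 ∏_{n ≥ 1} (1 - q^(2n-1)) / (1 - q^(2n)) * ∑_{n ∈ ℤ} q^(n(n+1)/2) / (1 + q^n)`,
where `q = e^(2πiτ)`. -/
def cesaro (τ : ℍ) : ℂ :=
  let q : ℂ := cexp (2 * π * I * τ)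
  2 * (∏' n : ℕ, (1 - q ^ (2 * n + 1)) / (1 - q ^ (2 * n + 2))) *
    ∑' n : ℤ, q ^ (n * (n + 1) / 2) / (1 + q ^ n)

/-- The coefficient `a_𝒞(n)` of `q^n` in the `q`-expansion of `𝒞`. -/
def cesaroCoeff (n : ℕ) : ℂ := (qExpansion 1 cesaro).coeff n

/-- Sieving of `q^(-1/8) 𝒞(τ) = ∑_k a_𝒞(k) q^((8k-1)/8)`: only those terms `q^(N/8)`,
`N = 8k - 1`, are kept for which `N` is congruent modulo `m` to an element of `R`. -/
def sievedCesaro (m : ℤ) (R : Finset ℤ) (τ : ℍ) : ℂ :=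
  ∑' k : ℕ, if ∃ r ∈ R, 8 * (k : ℤ) - 1 ≡ r [ZMOD m] then
    cesaroCoeff k * cexp (2 * π * I * τ * ((8 * (k : ℂ) - 1) / 8)) else 0

end

/-!
The function `q^(-1/8) 𝒞(τ)` is `4 N(1/2) / θ(1/2)`, where `N` is an Appell–Lerch sum (`appell`) and
`θ` the odd Jacobi theta function (`oddTheta`); the infinite product in `𝒞` is turned into `θ(1/2)`
by Gauss' identity `gaussProduct_mul_triangleSeries`. The quotient `N/θ` is a mock modular object:
it is the sum of a function `completion`, which transforms like a modular form of weight `1/2`, and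
of a non-holomorphic function `nonholPart` of `τ` alone. The point of the theorem is that the sieves
in question annihilate the second part.

*The completion.* `N` and `θ` have the same quasi-periods `1` and `τ`, and entire functions with
these quasi-periods are multiples of `θ`. Comparing poles gives `N = (c℘ + M) θ` with
`c = -1 / (2πi θ'(0))` and an unknown constant `M` (`exists_appell_eq`). Averaging `N/θ` over the
period torus against the elliptic weight `W(u) = |θ(u)|² e^(-2π (Im u)² / Im τ)` eliminates `M`: the
quotient `N/θ` is `c` times the difference of `℘` and its weighted average, plus the weighted
average of `N/θ` (`appell_eq_mul_oddTheta`). Since `℘` and its average have weight `2`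
(`averagedWeierstrassP_smul`) and `θ'(0)` is a multiple of `η³` (`exists_thetaNull_eq_mul_eta_pow`,
as `θ'(0)⁸` is a cusp form of weight `12`), the completion has weight `1/2` and multiplier `ν_η⁻³`;
at the half period `u = 1/2` this holds on `Γ₀(2)` (`completion_half_smul`).

*Removal of the non-holomorphic part.* On a horizontal line `N` times the conjugate of `θ` is a
double series, and the integrals of its terms over a period depend on `Re τ` through the characters
`e^(-πi(k+1/2)² Re τ)` only (`pairTerm_shift`). So the non-holomorphic part has exponents
`-(2k+1)²/8`, and sieving with respect to a residue `ρ` modulo `p` annihilates it as soon as `-ρ` is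
not a square modulo `p` (`sum_nonholPart_eq_zero`). This is the case for `p = 3`, `ρ = 1` and for
`p = 7`, `ρ = 1, 2, 4`. The sieved function is then a linear combination of translates of the
completion by `8j/p`.

*Transformation.* If `p² ∣ c` and `a ≡ d` modulo `p`, conjugation by these translations carries a
matrix with integral entries to such a matrix with the same `c` (`exists_translate_conj`). The cube
of the `η`-multiplier is not affected (`etaMultiplier_pow_eq`): as `η³` is a series in
`q^((2n+1)²/8)`, sieving it with respect to a non-square gives zero, and transforming this relation
by `γ` shows that the cubes of the multipliers of the conjugates have no Fourier coefficient at a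
nonzero frequency. The groups are `Γ₀(1152) ∩ Γ₁(8)` and the subgroup of `Γ₀(6272) ∩ Γ₁(8)` with
`d² ≡ 1` modulo `7`; their indices are computed in towers, each step by an explicit invariant of the
cosets (`relIndex_Gamma0_mul`, `relIndex_Gamma0_mul_prime`, `relIndex_Gamma0_inf_Gamma1_eight`,
`relIndex_inf_gammaSq_seven`).

*Growth at the cusps.* A translate `8j/p + γτ` is moved to the fundamental domain, where the
completion is bounded at the three half periods by an exponential of the height
(`exists_norm_completion_le`); the height of the reduced point is at most `p² Im τ`
(`exists_norm_completion_vadd_smul_le`).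
-/

noncomputable section

/-! ### The odd Jacobi theta function -/

/-- The odd theta function `θ(z; τ) = ∑_{n ∈ ℤ} (-1)^n q^((n+1/2)²/2) e^(2πi(n+1/2)z)`, written in
terms of Mathlib's two-variable Jacobi theta function. -/
def oddTheta (z τ : ℂ) : ℂ :=
  cexp (π * I * τ / 4 + π * I * z) * jacobiTheta₂ (z + 1 / 2 + τ / 2) τ

/-- The terms of `oddTheta`, the sign `(-1)^n` being written as `e^(πin)`. -/
def oddThetaTerm (z τ : ℂ) (n : ℤ) : ℂ :=
  cexp (π * I * (n + 1 / 2) ^ 2 * τ + 2 * π * I * (n + 1 / 2) * z + π * I * n)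

theorem exp_mul_jacobiTheta₂_term (z τ : ℂ) (n : ℤ) :
    cexp (π * I * τ / 4 + π * I * z) * jacobiTheta₂_term n (z + 1 / 2 + τ / 2) τ =
      oddThetaTerm z τ n := by
  rw [jacobiTheta₂_term, oddThetaTerm, ← Complex.exp_add]
  ring_nf

/-- A `HasSum` statement may be rewritten term by term and in its value. -/
theorem HasSum.of_eq {ι : Type*} {f g : ι → ℂ} {a b : ℂ} (h : HasSum f a) (hf : ∀ n, f n = g n)
    (ha : a = b) : HasSum g b := by
  rw [← ha, ← funext hf]
  exact h

theorem hasSum_oddTheta (z : ℂ) {τ : ℂ} (hτ : 0 < τ.im) :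
    HasSum (oddThetaTerm z τ) (oddTheta z τ) := by
  have h := (hasSum_jacobiTheta₂_term (z + 1 / 2 + τ / 2) hτ).mul_left
    (cexp (π * I * τ / 4 + π * I * z))
  exact HasSum.of_eq h (exp_mul_jacobiTheta₂_term z τ) rfl

theorem oddTheta_neg (z τ : ℂ) : oddTheta (-z) τ = -oddTheta z τ := by
  have h1 : -z + 1 / 2 + τ / 2 = -(z + 1 / 2 + τ / 2) + 1 + τ := by ring
  rw [oddTheta, oddTheta, h1, jacobiTheta₂_add_left', jacobiTheta₂_add_left, jacobiTheta₂_neg_left,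
    ← mul_assoc, ← neg_mul]
  congr 1
  rw [← mul_neg_one (cexp _), ← Complex.exp_pi_mul_I, ← Complex.exp_add, ← Complex.exp_add,
    Complex.exp_eq_exp_iff_exists_int]
  exact ⟨-1, by push_cast; ring⟩

@[simp] theorem oddTheta_zero (τ : ℂ) : oddTheta 0 τ = 0 := by
  have h := oddTheta_neg 0 τ
  rw [neg_zero] at h
  linear_combination h / 2

theorem oddTheta_add_one (z τ : ℂ) : oddTheta (z + 1) τ = -oddTheta z τ := by
  have h1 : z + 1 + 1 / 2 + τ / 2 = z + 1 / 2 + τ / 2 + 1 := by ring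
  rw [oddTheta, oddTheta, h1, jacobiTheta₂_add_left, ← neg_mul]
  congr 1
  rw [← mul_neg_one, ← Complex.exp_pi_mul_I, ← Complex.exp_add]
  ring_nf

theorem oddTheta_add_tau (z τ : ℂ) :
    oddTheta (z + τ) τ = -cexp (-π * I * τ - 2 * π * I * z) * oddTheta z τ := by
  have h1 : z + τ + 1 / 2 + τ / 2 = z + 1 / 2 + τ / 2 + τ := by ring
  rw [oddTheta, oddTheta, h1, jacobiTheta₂_add_left', ← mul_assoc, ← mul_assoc, neg_mul (cexp _)]
  congr 1
  rw [← Complex.exp_add, ← Complex.exp_add, ← mul_neg_one (cexp _), ← Complex.exp_pi_mul_I,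
    ← Complex.exp_add, Complex.exp_eq_exp_iff_exists_int]
  exact ⟨-1, by push_cast; ring⟩

theorem differentiable_oddTheta {τ : ℂ} (hτ : 0 < τ.im) :
    Differentiable ℂ fun z => oddTheta z τ := fun z => by
  unfold oddTheta
  have h := differentiableAt_jacobiTheta₂_fst (z + 1 / 2 + τ / 2) hτ
  have h2 : DifferentiableAt ℂ (fun z : ℂ => jacobiTheta₂ (z + 1 / 2 + τ / 2) τ) z :=
    h.comp z (f := fun z : ℂ => z + 1 / 2 + τ / 2) (by fun_prop)
  exact DifferentiableAt.mul (by fun_prop) h2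

theorem oddTheta_T (z τ : ℂ) (hτ : 0 < τ.im) :
    oddTheta z (τ + 1) = cexp (π * I / 4) * oddTheta z τ := by
  have hτ' : 0 < (τ + 1).im := by simpa using hτ
  refine (hasSum_oddTheta z hτ').unique ?_
  have h := (hasSum_oddTheta z hτ).mul_left (cexp (π * I / 4))
  refine HasSum.of_eq h (fun n => ?_) rfl
  rw [oddThetaTerm, oddThetaTerm, ← Complex.exp_add, Complex.exp_eq_exp_iff_exists_int]
  obtain ⟨k, hk⟩ := Int.even_mul_succ_self n
  have hk' : (n : ℂ) * (n + 1) = k + k := by exact_mod_cast hk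
  exact ⟨-k, by push_cast; linear_combination (-π * I) * hk'⟩

/-- The inversion formula, from the functional equation of the two-variable theta function. -/
theorem oddTheta_S (z τ : ℂ) (hτ : 0 < τ.im) :
    oddTheta (z / τ) (-1 / τ) =
      -I * (-I * τ) ^ (1 / 2 : ℂ) * cexp (π * I * z ^ 2 / τ) * oddTheta z τ := by
  have h0 : τ ≠ 0 := by rintro rfl; simp at hτ
  have h1 : z / τ + 1 / 2 + -1 / τ / 2 = (z + τ / 2 - 1 / 2) / τ := by field_simp; ring
  have h2 : z + 1 / 2 + τ / 2 = z + τ / 2 - 1 / 2 + 1 := by ring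
  rw [oddTheta, oddTheta, h1, h2, jacobiTheta₂_add_left,
    jacobiTheta₂_functional_equation (z + τ / 2 - 1 / 2) τ]
  have h3 : (-I * τ) ^ (1 / 2 : ℂ) ≠ 0 := by simp [Complex.cpow_eq_zero_iff, h0]
  have hI : -I = cexp (-(π * I / 2)) := by
    rw [Complex.exp_neg, show (π * I / 2 : ℂ) = π / 2 * I by ring, Complex.exp_pi_div_two_mul_I,
      Complex.inv_I]
  have h4 : cexp (π * I * (-1 / τ) / 4 + π * I * (z / τ)) =
      -I * cexp (π * I * z ^ 2 / τ) * cexp (π * I * τ / 4 + π * I * z) *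
        cexp (-π * I * (z + τ / 2 - 1 / 2) ^ 2 / τ) := by
    rw [hI, ← Complex.exp_add, ← Complex.exp_add, ← Complex.exp_add]
    congr 1
    field_simp
    ring
  rw [h4]
  field_simp

/-- The theta null value `θ'(0; τ)`. -/
def thetaNull (τ : ℂ) : ℂ := deriv (fun z => oddTheta z τ) 0

theorem hasDerivAt_oddTheta_zero {τ : ℂ} (hτ : 0 < τ.im) :
    HasDerivAt (fun z => oddTheta z τ) (thetaNull τ) 0 :=
  (differentiable_oddTheta hτ 0).hasDerivAt

theorem hasSum_thetaNull {τ : ℂ} (hτ : 0 < τ.im) :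
    HasSum (fun n : ℤ => 2 * π * I * (n + 1 / 2) * oddThetaTerm 0 τ n) (thetaNull τ) := by
  have hd : HasDerivAt (fun z => oddTheta z τ)
      (cexp (π * I * τ / 4 + π * I * 0) * (π * I) * jacobiTheta₂ (0 + 1 / 2 + τ / 2) τ +
        cexp (π * I * τ / 4 + π * I * 0) * jacobiTheta₂' (0 + 1 / 2 + τ / 2) τ) 0 := by
    have h1 : HasDerivAt (fun z : ℂ => jacobiTheta₂ (z + 1 / 2 + τ / 2) τ)
        (jacobiTheta₂' (0 + 1 / 2 + τ / 2) τ) 0 := by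
      have h := (hasDerivAt_jacobiTheta₂_fst (0 + 1 / 2 + τ / 2) hτ).comp 0
        (h := fun z : ℂ => z + 1 / 2 + τ / 2)
        (((hasDerivAt_id (0 : ℂ)).add_const (1 / 2)).add_const (τ / 2))
      simpa [Function.comp_def] using h
    have h2 : HasDerivAt (fun z : ℂ => cexp (π * I * τ / 4 + π * I * z))
        (cexp (π * I * τ / 4 + π * I * 0) * (π * I)) 0 := by
      have h := (((hasDerivAt_id (0 : ℂ)).const_mul (π * I : ℂ)).const_add (π * I * τ / 4)).cexp
      simpa using h
    exact h2.mul h1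
  rw [thetaNull, hd.deriv]
  have h3 := (((hasSum_jacobiTheta₂_term (0 + 1 / 2 + τ / 2) hτ).mul_left
    (cexp (π * I * τ / 4 + π * I * 0) * (π * I))).add
    ((hasSum_jacobiTheta₂'_term (0 + 1 / 2 + τ / 2) hτ).mul_left
      (cexp (π * I * τ / 4 + π * I * 0))))
  refine HasSum.of_eq h3 (fun n => ?_) rfl
  rw [← exp_mul_jacobiTheta₂_term, jacobiTheta₂'_term]
  ring

theorem thetaNull_T {τ : ℂ} (hτ : 0 < τ.im) :
    thetaNull (τ + 1) = cexp (π * I / 4) * thetaNull τ := by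
  have h := (hasDerivAt_oddTheta_zero hτ).const_mul (cexp (π * I / 4))
  rw [thetaNull, show (fun z => oddTheta z (τ + 1)) = fun z => cexp (π * I / 4) * oddTheta z τ from
    funext fun z => oddTheta_T z τ hτ, h.deriv]

/-- The inversion formula is differentiated at `z = 0`, where the factor `e^(πiz²/τ)` has no effect
because `θ` vanishes there. -/
theorem thetaNull_S {τ : ℂ} (hτ : 0 < τ.im) :
    thetaNull (-1 / τ) = -I * (-I * τ) ^ (1 / 2 : ℂ) * τ * thetaNull τ := by
  have h0 : τ ≠ 0 := by rintro rfl; simp at hτ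
  have h1 : (fun z => oddTheta z (-1 / τ)) = fun z =>
      -I * (-I * τ) ^ (1 / 2 : ℂ) * (cexp (π * I * (τ * z) ^ 2 / τ) * oddTheta (τ * z) τ) := by
    funext z
    have h := oddTheta_S (τ * z) τ hτ
    rw [mul_div_cancel_left₀ _ h0] at h
    rw [h]
    ring
  have h2 : HasDerivAt (fun z : ℂ => oddTheta (τ * z) τ) (thetaNull τ * τ) 0 := by
    have h3 := hasDerivAt_oddTheta_zero hτ
    rw [← mul_zero τ] at h3
    have h4 := h3.comp 0 (h := fun z : ℂ => τ * z) ((hasDerivAt_id (0 : ℂ)).const_mul τ)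
    simpa [Function.comp_def] using h4
  have h5 : DifferentiableAt ℂ (fun z : ℂ => cexp (π * I * (τ * z) ^ 2 / τ)) 0 := by fun_prop
  have h6 := (h5.hasDerivAt.mul h2).const_mul (-I * (-I * τ) ^ (1 / 2 : ℂ))
  rw [thetaNull, h1]
  refine h6.deriv.trans ?_
  simp
  ring

/-! ### Jacobi's derivative formula -/

/-- The nome `q = e^(2πiτ)`. -/
def nome (τ : ℂ) : ℂ := cexp (2 * π * I * τ)

theorem norm_nome (τ : ℂ) : ‖nome τ‖ = Real.exp (-2 * π * τ.im) := by
  rw [nome, Complex.norm_exp]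
  congr 1
  simp

theorem norm_nome_lt_one {τ : ℂ} (hτ : 0 < τ.im) : ‖nome τ‖ < 1 := by
  rw [norm_nome, Real.exp_lt_one_iff]
  have := Real.pi_pos
  nlinarith [mul_pos this hτ]

theorem nome_ne_zero (τ : ℂ) : nome τ ≠ 0 := Complex.exp_ne_zero _

theorem tendsto_nome_atImInfty : Tendsto (fun τ : ℍ => nome τ) atImInfty (𝓝 0) := by
  have h := qParam_tendsto_atImInfty (h := 1) one_pos
  refine h.congr fun τ => ?_
  simp [Function.Periodic.qParam, nome]

/-- The common majorant of the power series in `q` below, whose coefficients are at most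
`2n + 1`. -/
theorem summable_odd_mul_pow {r : ℝ} (h0 : 0 ≤ r) (h1 : r < 1) :
    Summable fun n : ℕ => (2 * n + 1 : ℝ) * r ^ n := by
  have h2 := summable_pow_mul_geometric_of_norm_lt_one 1
    (show ‖r‖ < 1 by rwa [Real.norm_of_nonneg h0])
  have h3 := (h2.mul_left 2).add (summable_geometric_of_lt_one h0 h1)
  refine h3.congr fun n => ?_
  ring

theorem norm_mul_pow_le_odd_mul_pow {c : ℕ → ℂ} {e : ℕ → ℕ} (hc : ∀ n, ‖c n‖ ≤ 2 * n + 1)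
    (he : ∀ n, n ≤ e n) {r : ℝ} (h1 : r < 1) {z : ℂ} (hz : ‖z‖ ≤ r) (n : ℕ) :
    ‖c n * z ^ e n‖ ≤ (2 * n + 1 : ℝ) * r ^ n := by
  have h0 : 0 ≤ r := (norm_nonneg z).trans hz
  rw [norm_mul, norm_pow]
  refine mul_le_mul (hc n) ?_ (by positivity) (by positivity)
  calc ‖z‖ ^ e n ≤ r ^ e n := pow_le_pow_left₀ (norm_nonneg _) hz _
    _ ≤ r ^ n := pow_le_pow_of_le_one h0 h1.le (he n)

theorem summable_mul_pow_of_le {c : ℕ → ℂ} {e : ℕ → ℕ} (hc : ∀ n, ‖c n‖ ≤ 2 * n + 1)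
    (he : ∀ n, n ≤ e n) {z : ℂ} (hz : ‖z‖ < 1) : Summable fun n => c n * z ^ e n :=
  Summable.of_norm_bounded (summable_odd_mul_pow (norm_nonneg z) hz)
    (norm_mul_pow_le_odd_mul_pow hc he hz le_rfl)

theorem differentiableOn_tsum_mul_pow {c : ℕ → ℂ} {e : ℕ → ℕ} (hc : ∀ n, ‖c n‖ ≤ 2 * n + 1)
    (he : ∀ n, n ≤ e n) :
    DifferentiableOn ℂ (fun z => ∑' n, c n * z ^ e n) (Metric.ball 0 1) := by
  intro z hz
  obtain ⟨r, hzr, hr⟩ := exists_between (mem_ball_zero_iff.1 hz)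
  have h0 : 0 ≤ r := (norm_nonneg z).trans hzr.le
  have h := differentiableOn_tsum_of_summable_norm (F := fun n (z : ℂ) => c n * z ^ e n)
    (summable_odd_mul_pow h0 hr) (fun n => by fun_prop) Metric.isOpen_ball
    (fun n w hw => norm_mul_pow_le_odd_mul_pow hc he hr (mem_ball_zero_iff.1 hw).le n)
  exact (h.differentiableAt (Metric.isOpen_ball.mem_nhds
    (mem_ball_zero_iff.2 hzr))).differentiableWithinAt

theorem le_triangle (n : ℕ) : n ≤ n * (n + 1) / 2 := by
  rw [Nat.le_div_iff_mul_le two_pos]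
  rcases n with _ | n
  · simp
  · nlinarith

theorem two_mul_triangle (n : ℕ) : 2 * ((n * (n + 1) / 2 : ℕ) : ℂ) = n * (n + 1) := by
  have h : 2 * (n * (n + 1) / 2) = n * (n + 1) :=
    Nat.mul_div_cancel' (Nat.even_mul_succ_self n).two_dvd
  exact_mod_cast h

/-- The power series `∑_{n ≥ 0} (-1)^n (2n+1) q^(n(n+1)/2)`. -/
def jacobiSeries (q : ℂ) : ℂ := ∑' n : ℕ, (-1) ^ n * (2 * n + 1) * q ^ (n * (n + 1) / 2)

theorem norm_jacobiSeries_coeff_le (n : ℕ) : ‖((-1) ^ n * (2 * n + 1) : ℂ)‖ ≤ 2 * n + 1 := by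
  have : ‖(2 * n + 1 : ℂ)‖ = 2 * n + 1 := by
    have h := Complex.norm_natCast (2 * n + 1)
    push_cast at h
    exact h
  simp [this]

theorem hasSum_jacobiSeries {q : ℂ} (hq : ‖q‖ < 1) :
    HasSum (fun n : ℕ => (-1) ^ n * (2 * n + 1) * q ^ (n * (n + 1) / 2)) (jacobiSeries q) :=
  (summable_mul_pow_of_le norm_jacobiSeries_coeff_le le_triangle hq).hasSum

theorem differentiableOn_jacobiSeries : DifferentiableOn ℂ jacobiSeries (Metric.ball 0 1) :=
  differentiableOn_tsum_mul_pow norm_jacobiSeries_coeff_le le_triangle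

theorem jacobiSeries_zero : jacobiSeries 0 = 1 := by
  rw [jacobiSeries, tsum_eq_single 0]
  · simp
  · intro n hn
    have := le_triangle n
    rw [zero_pow (by omega), mul_zero]

theorem oddThetaTerm_zero_nat (τ : ℂ) (n : ℕ) :
    oddThetaTerm 0 τ n = cexp (π * I * τ / 4) * ((-1) ^ n * nome τ ^ (n * (n + 1) / 2)) := by
  rw [oddThetaTerm, nome, ← Complex.exp_nat_mul, ← Complex.exp_pi_mul_I, ← Complex.exp_nat_mul,
    ← Complex.exp_add, ← Complex.exp_add]
  congr 1
  have h := two_mul_triangle n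
  push_cast
  linear_combination (-π * I * τ) * h

theorem oddThetaTerm_zero_reflect (τ : ℂ) (n : ℤ) :
    oddThetaTerm 0 τ (-(n + 1)) = -oddThetaTerm 0 τ n := by
  rw [oddThetaTerm, oddThetaTerm, ← mul_neg_one (cexp _), ← Complex.exp_pi_mul_I,
    ← Complex.exp_add, Complex.exp_eq_exp_iff_exists_int]
  exact ⟨-n - 1, by push_cast; ring⟩

/-- In the theta series at `z = 0` the terms `n` and `-1 - n` are equal, which gives
`θ'(0) = 2πi q^(1/8) ∑_{n ≥ 0} (-1)^n (2n+1) q^(n(n+1)/2)`. -/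
theorem thetaNull_eq {τ : ℂ} (hτ : 0 < τ.im) :
    thetaNull τ = 2 * π * I * cexp (π * I * τ / 4) * jacobiSeries (nome τ) := by
  refine (hasSum_thetaNull hτ).nat_add_neg_add_one.unique ?_
  refine HasSum.of_eq ((hasSum_jacobiSeries (norm_nome_lt_one hτ)).mul_left
    (2 * π * I * cexp (π * I * τ / 4))) (fun n => ?_) rfl
  rw [oddThetaTerm_zero_reflect, oddThetaTerm_zero_nat]
  push_cast
  ring

theorem differentiableAt_thetaNull {τ : ℂ} (hτ : 0 < τ.im) : DifferentiableAt ℂ thetaNull τ := by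
  have h1 : DifferentiableAt ℂ
      (fun τ => 2 * π * I * cexp (π * I * τ / 4) * jacobiSeries (nome τ)) τ := by
    have h2 : DifferentiableAt ℂ (fun τ => jacobiSeries (nome τ)) τ := by
      refine DifferentiableAt.comp τ (differentiableOn_jacobiSeries.differentiableAt
        (Metric.isOpen_ball.mem_nhds (mem_ball_zero_iff.2 (norm_nome_lt_one hτ)))) ?_
      unfold nome
      fun_prop
    exact DifferentiableAt.mul (by fun_prop) h2
  refine h1.congr_of_eventuallyEq ?_
  filter_upwards [isOpen_upperHalfPlaneSet.mem_nhds (show τ ∈ upperHalfPlaneSet from hτ)] with w hw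
  exact thetaNull_eq hw

theorem denom_SL_eq (γ : SL(2, ℤ)) (τ : ℍ) : denom γ τ = (γ 1 0 : ℂ) * τ + γ 1 1 := by
  simp [denom]

open scoped ModularForm in
theorem thetaNull_pow_eight_S :
    ((fun τ : ℍ => thetaNull τ ^ 8) ∣[(12 : ℤ)] ModularGroup.S) = fun τ : ℍ => thetaNull τ ^ 8 := by
  ext z
  have h0 := ne_zero z
  have h1 : thetaNull (-(z : ℂ)⁻¹) ^ 8 = (z : ℂ) ^ 12 * thetaNull z ^ 8 := by
    have h := thetaNull_S z.2
    rw [neg_div, one_div] at h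
    have h3 : ((-I * (z : ℂ)) ^ (1 / 2 : ℂ)) ^ 8 = (z : ℂ) ^ 4 := by
      rw [← cpow_nat_mul, show ((8 : ℕ) : ℂ) * (1 / 2) = (4 : ℕ) by norm_num, cpow_natCast, mul_pow]
      norm_num [neg_pow, I_pow_four]
    rw [show ((UpperHalfPlane.coe z)) = (z : ℂ) from rfl] at h
    rw [h, mul_pow, mul_pow, mul_pow, h3, neg_pow, show (I ^ 8 : ℂ) = (I ^ 4) ^ 2 by ring,
        I_pow_four]
    ring
  rw [ModularForm.SL_slash_apply, UpperHalfPlane.modular_S_smul, denom_SL_eq]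
  simp [ModularGroup.S, h1]
  field_simp

open scoped ModularForm in
theorem thetaNull_pow_eight_T :
    ((fun τ : ℍ => thetaNull τ ^ 8) ∣[(12 : ℤ)] ModularGroup.T) = fun τ : ℍ => thetaNull τ ^ 8 := by
  ext z
  have h1 : thetaNull ((z : ℂ) + 1) ^ 8 = thetaNull z ^ 8 := by
    rw [thetaNull_T z.2, mul_pow, ← Complex.exp_nat_mul,
      show ((8 : ℕ) : ℂ) * (π * I / 4) = 2 * π * I by push_cast; ring, Complex.exp_two_pi_mul_I,
      one_mul]
  rw [ModularForm.SL_slash_apply, UpperHalfPlane.modular_T_smul, denom_SL_eq]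
  simp [ModularGroup.T, add_comm (1 : ℂ), h1]

theorem thetaNull_pow_eight_isZeroAtImInfty : IsZeroAtImInfty fun τ : ℍ => thetaNull τ ^ 8 := by
  have h1 : Tendsto (fun τ : ℍ => (2 * π * I : ℂ) ^ 8 * (nome τ * jacobiSeries (nome τ) ^ 8))
      atImInfty (𝓝 ((2 * π * I : ℂ) ^ 8 * (0 * jacobiSeries 0 ^ 8))) := by
    have hc : ContinuousAt jacobiSeries 0 := (differentiableOn_jacobiSeries.differentiableAt
      (Metric.isOpen_ball.mem_nhds (by simp))).continuousAt
    exact (tendsto_nome_atImInfty.mul ((hc.tendsto.comp tendsto_nome_atImInfty).pow 8)).const_mul _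
  rw [zero_mul, mul_zero] at h1
  refine h1.congr fun τ => ?_
  rw [thetaNull_eq τ.2, mul_pow _ (jacobiSeries _), mul_pow _ (cexp _), ← Complex.exp_nat_mul,
    show ((8 : ℕ) : ℂ) * (π * I * (τ : ℂ) / 4) = 2 * π * I * τ by push_cast; ring]
  simp only [nome]
  ring

/-- The eighth power of `θ'(0)` as a cusp form of weight `12` and level `1`. -/
def thetaNullCuspForm : CuspForm 𝒮ℒ 12 where
  toFun τ := thetaNull τ ^ 8
  slash_action_eq' A hA := by
    obtain ⟨A, rfl⟩ := hA
    exact SlashInvariantForm.slash_action_generators_SL2Z thetaNull_pow_eight_S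
      thetaNull_pow_eight_T A
  holo' := by
    rw [UpperHalfPlane.mdifferentiable_iff]
    refine .congr (fun z hz ↦ ((differentiableAt_thetaNull hz).pow 8).differentiableWithinAt)
      fun z hz ↦ ?_
    simp [ofComplex_apply_of_im_pos (show 0 < z.im from hz)]
  zero_at_cusps' hc := by
    rw [Subgroup.IsArithmetic.isCusp_iff_isCusp_SL2Z] at hc
    rw [OnePoint.isZeroAt_iff_forall_SL2Z hc]
    intro γ _
    rw [SlashInvariantForm.slash_action_generators_SL2Z thetaNull_pow_eight_S thetaNull_pow_eight_T]
    exact thetaNull_pow_eight_isZeroAtImInfty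

theorem exists_thetaNull_ne_zero : ∃ τ : ℍ, thetaNull τ ≠ 0 := by
  by_contra! h
  have hc : ContinuousAt jacobiSeries 0 := (differentiableOn_jacobiSeries.differentiableAt
    (Metric.isOpen_ball.mem_nhds (by simp))).continuousAt
  have h1 := (hc.tendsto.comp tendsto_nome_atImInfty)
  have h2 : (jacobiSeries ∘ fun τ : ℍ => nome τ) = fun _ => 0 := by
    funext τ
    have h3 := h τ
    rw [thetaNull_eq τ.2] at h3
    simpa [Complex.exp_ne_zero, Real.pi_ne_zero] using h3
  rw [h2, jacobiSeries_zero] at h1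
  exact zero_ne_one (tendsto_nhds_unique tendsto_const_nhds h1)

/-- Jacobi's derivative formula `θ'(0) = κ η³`, up to the value of the constant: the eighth power of
`θ'(0)` is a cusp form of weight `12`, hence a multiple of `Δ = η²⁴`. -/
theorem exists_thetaNull_eq_mul_eta_pow :
    ∃ κ : ℂ, κ ≠ 0 ∧ ∀ τ : ℍ, thetaNull τ = κ * ModularForm.eta τ ^ 3 := by
  obtain ⟨c, hc⟩ := CuspForm.exists_smul_discriminant_of_weight_eq_twelve thetaNullCuspForm
  have h1 : ∀ τ : ℍ, thetaNull τ ^ 8 = c * ModularForm.eta τ ^ 24 := fun τ =>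
    (DFunLike.congr_fun hc τ).symm
  have he : ∀ τ : ℍ, ModularForm.eta τ ≠ 0 := fun τ => ModularForm.eta_ne_zero τ.2
  have hc0 : c ≠ 0 := by
    rintro rfl
    obtain ⟨τ, hτ⟩ := exists_thetaNull_ne_zero
    exact hτ (by simpa using h1 τ)
  have hfin : {z : ℂ | z ^ 8 = c}.Finite := by
    refine (Polynomial.nthRootsFinset 8 c).finite_toSet.subset fun z hz => ?_
    simpa [Polynomial.mem_nthRootsFinset] using hz
  -- a continuous function on `ℍ` whose values are eighth roots of `c` is constant
  let f : ℍ → ℂ := fun τ => thetaNull τ / ModularForm.eta τ ^ 3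
  have hf : Continuous f := by
    refine Continuous.div ?_ (Continuous.pow ?_ 3) fun τ => pow_ne_zero _ (he τ)
    · exact continuous_iff_continuousAt.2 fun τ =>
        (differentiableAt_thetaNull τ.2).continuousAt.comp continuous_coe.continuousAt
    · exact continuous_iff_continuousAt.2 fun τ =>
        (ModularForm.differentiableAt_eta_of_mem_upperHalfPlaneSet τ.2).continuousAt.comp
          continuous_coe.continuousAt
  have hf8 : ∀ τ, f τ ^ 8 = c := fun τ => by
    have := he τ
    simp only [f]
    rw [div_pow, h1]
    field_simp
  refine ⟨f UpperHalfPlane.I, fun h => hc0 ?_, fun τ => ?_⟩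
  · rw [← hf8 UpperHalfPlane.I, h]
    simp
  · have h2 : f UpperHalfPlane.I = f τ := isPreconnected_univ.constant_of_mapsTo hfin.isDiscrete
      hf.continuousOn (fun τ _ => hf8 τ) (Set.mem_univ _) (Set.mem_univ _)
    rw [h2]
    have := he τ
    simp only [f]
    field_simp

theorem thetaNull_ne_zero (τ : ℍ) : thetaNull τ ≠ 0 := by
  obtain ⟨κ, hκ, h⟩ := exists_thetaNull_eq_mul_eta_pow
  rw [h]
  exact mul_ne_zero hκ (pow_ne_zero _ (ModularForm.eta_ne_zero τ.2))

/-! ### The Appell–Lerch sum -/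

/-- The period pair `(1, τ)`. -/
def periods (τ : ℍ) : PeriodPair where
  ω₁ := 1
  ω₂ := τ
  indep := by
    rw [LinearIndependent.pair_iff]
    intro s t h
    have h1 := congrArg Complex.im h
    have h2 := congrArg Complex.re h
    have ht : t = 0 := by simpa [τ.im_ne_zero] using h1
    exact ⟨by simpa [ht] using h2, ht⟩

theorem mem_periods_lattice {τ : ℍ} {u : ℂ} :
    u ∈ (periods τ).lattice ↔ ∃ m n : ℤ, (m : ℂ) + n * τ = u := by
  simp [PeriodPair.mem_lattice, periods]

/-- The denominators of the Appell–Lerch sum are bounded away from zero at a distance `δ` from the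
horizontal line through their zeros. -/
theorem one_sub_rexp_le_norm_one_sub_cexp {w : ℂ} {δ : ℝ} (h : δ ≤ |w.im|) :
    1 - Real.exp (-2 * π * δ) ≤ ‖1 - cexp (2 * π * I * w)‖ := by
  have hn : ‖cexp (2 * π * I * w)‖ = Real.exp (-2 * π * w.im) := norm_nome w
  have hp := Real.pi_pos
  rcases le_abs.1 h with h | h
  · have h1 := norm_sub_norm_le (1 : ℂ) (cexp (2 * π * I * w))
    rw [hn, norm_one] at h1
    have h2 : Real.exp (-2 * π * w.im) ≤ Real.exp (-2 * π * δ) := Real.exp_le_exp.2 (by nlinarith)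
    linarith
  · have h1 := norm_sub_norm_le (cexp (2 * π * I * w)) 1
    rw [hn, norm_one, norm_sub_rev] at h1
    have h2 : Real.exp (2 * π * δ) ≤ Real.exp (-2 * π * w.im) := Real.exp_le_exp.2 (by nlinarith)
    have h3 : 2 ≤ Real.exp (-2 * π * δ) + Real.exp (2 * π * δ) := by
      have h4 := Real.add_one_le_exp (-2 * π * δ)
      have h5 := Real.add_one_le_exp (2 * π * δ)
      linarith
    linarith

theorem exp_eq_one_iff_mem_range {w : ℂ} : cexp (2 * π * I * w) = 1 ↔ ∃ n : ℤ, w = n := by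
  rw [Complex.exp_eq_one_iff]
  refine exists_congr fun n => ?_
  rw [mul_comm (n : ℂ), mul_right_inj' Complex.two_pi_I_ne_zero]

/-- The terms of the Appell–Lerch sum without the common factor `e^(πiu)`. -/
def appellTerm (u τ : ℂ) (m : ℤ) : ℂ :=
  jacobiTheta₂_term m (u + 1 / 2 + τ / 2) τ / (1 - cexp (2 * π * I * (u + m * τ)))

/-- The Appell–Lerch sum
`N(u; τ) = ∑_{m ∈ ℤ} (-1)^m q^(m(m+1)/2) e^(2πi(m+1/2)u) / (1 - e^(2πiu) q^m)`. -/
def appell (u τ : ℂ) : ℂ := cexp (π * I * u) * ∑' m : ℤ, appellTerm u τ m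

/-- The summable majorant of `appellTerm`. -/
def appellBound (S T : ℝ) (m : ℤ) : ℝ := Real.exp (-π * (T * m ^ 2 - 2 * S * |m|))

theorem summable_appellBound (S : ℝ) {T : ℝ} (hT : 0 < T) : Summable (appellBound S T) := by
  refine (summable_pow_mul_jacobiTheta₂_term_bound S hT 0).congr fun m => ?_
  rw [appellBound, pow_zero, one_mul]

theorem norm_appellTerm_le {u τ : ℂ} {S T δ : ℝ} (hT : 0 < T) (hS : |(u + 1 / 2 + τ / 2).im| ≤ S)
    (hτ : T ≤ τ.im) (hδ : 0 < δ) {m : ℤ} (hm : δ ≤ |(u + m * τ).im|) :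
    ‖appellTerm u τ m‖ ≤ appellBound S T m / (1 - Real.exp (-2 * π * δ)) := by
  have h1 : 0 < 1 - Real.exp (-2 * π * δ) := by
    have := Real.pi_pos
    rw [sub_pos, Real.exp_lt_one_iff]
    nlinarith [mul_pos this hδ]
  rw [appellTerm, norm_div]
  exact div_le_div₀ (Real.exp_nonneg _) (norm_jacobiTheta₂_term_le hT hS hτ m) h1
    (one_sub_rexp_le_norm_one_sub_cexp hm)

theorem isOpen_setOf_forall_exp_ne_one (τ : ℍ) (A : Set ℤ) :
    IsOpen {u : ℂ | ∀ m ∈ A, cexp (2 * π * I * (u + m * τ)) ≠ 1} := by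
  rw [← isClosed_compl_iff]
  refine (periods τ).isClosed_of_subset_lattice fun u hu => ?_
  simp only [Set.mem_compl_iff, Set.mem_ofPred_eq, not_forall, not_not] at hu
  obtain ⟨m, -, hm⟩ := hu
  obtain ⟨n, hn⟩ := exp_eq_one_iff_mem_range.1 hm
  exact mem_periods_lattice.2 ⟨n, -m, by push_cast; linear_combination -hn⟩

theorem exists_summable_bound_appellTerm (τ : ℍ) {K : Set ℂ} (hK : IsCompact K) :
    ∃ b : ℤ → ℝ, Summable b ∧ ∀ᶠ m in cofinite, ∀ u ∈ K, ‖appellTerm u τ m‖ ≤ b m := by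
  obtain ⟨R, hR⟩ := hK.isBounded.exists_norm_le
  have hy := τ.im_pos
  refine ⟨fun m => appellBound (R + τ.im) τ.im m / (1 - Real.exp (-2 * π * 1)),
    (summable_appellBound _ hy).div_const _, ?_⟩
  have hfin : {m : ℤ | ¬ (1 + |R|) / τ.im ≤ |(m : ℝ)|}.Finite := by
    refine (Set.finite_Icc (-⌈(1 + |R|) / τ.im⌉) ⌈(1 + |R|) / τ.im⌉).subset fun m hm => ?_
    rw [Set.mem_ofPred_eq, not_le] at hm
    have h1 := Int.le_ceil ((1 + |R|) / τ.im)
    have h2 := abs_lt.1 (hm.trans_le h1)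
    constructor
    · have : (-⌈(1 + |R|) / τ.im⌉ : ℝ) < m := h2.1
      exact_mod_cast this.le
    · exact_mod_cast h2.2.le
  filter_upwards [hfin.eventually_cofinite_notMem] with m hm u hu
  have hm' : (1 + |R|) / τ.im ≤ |(m : ℝ)| := not_not.1 hm
  rw [div_le_iff₀ hy] at hm'
  have hu1 : |u.im| ≤ R := (abs_im_le_norm u).trans (hR u hu)
  refine norm_appellTerm_le hy ?_ le_rfl one_pos ?_
  · have h3 : (u + 1 / 2 + (τ : ℂ) / 2).im = u.im + τ.im / 2 := by
      simp
    rw [h3]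
    refine (abs_add_le _ _).trans ?_
    rw [abs_of_pos (by positivity : (0 : ℝ) < τ.im / 2)]
    linarith
  · have h3 : (u + m * (τ : ℂ)).im = m * τ.im + u.im := by
      simp
      ring
    rw [h3]
    have h4 := abs_sub_abs_le_abs_add ((m : ℝ) * τ.im) u.im
    rw [abs_mul, abs_of_pos hy] at h4
    have := le_abs_self R
    linarith

/-- The set `A` of indices is left free so that the term with the pole at `0` can be omitted. -/
theorem differentiableOn_tsum_appellTerm (τ : ℍ) (A : Set ℤ) [DecidablePred (· ∈ A)] :
    DifferentiableOn ℂ (fun u => ∑' m : ℤ, if m ∈ A then appellTerm u τ m else 0)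
      {u : ℂ | ∀ m ∈ A, cexp (2 * π * I * (u + m * τ)) ≠ 1} := by
  have ho := isOpen_setOf_forall_exp_ne_one τ A
  have h : SummableLocallyUniformlyOn (fun (m : ℤ) (u : ℂ) => if m ∈ A then appellTerm u τ m else 0)
      {u : ℂ | ∀ m ∈ A, cexp (2 * π * I * (u + m * τ)) ≠ 1} := by
    refine SummableLocallyUniformlyOn.of_locally_bounded_eventually ho fun K _ hK => ?_
    obtain ⟨b, hb, hb'⟩ := exists_summable_bound_appellTerm τ hK
    refine ⟨b, hb, ?_⟩
    filter_upwards [hb'] with m hm u hu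
    have h1 := hm u hu
    split_ifs
    · exact h1
    · simpa using (norm_nonneg _).trans h1
  refine h.differentiableOn ho fun m u hu => ?_
  by_cases hm : m ∈ A
  · simp only [hm, if_true, appellTerm]
    refine DifferentiableAt.div ?_ (by fun_prop) (sub_ne_zero.2 fun h => hu m hm h.symm)
    unfold jacobiTheta₂_term
    fun_prop
  · simp [hm]

/-- At a pole the singular term is zero, by the convention for division by zero, and the series
still converges. -/
theorem summable_appellTerm (u : ℂ) (τ : ℍ) : Summable (appellTerm u τ) := by
  obtain ⟨b, hb, hb'⟩ := exists_summable_bound_appellTerm τ (isCompact_singleton (x := u))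
  exact Summable.of_norm_bounded_eventually hb (hb'.mono fun m hm => hm u rfl)

theorem exp_ne_one_of_notMem_lattice {τ : ℍ} {u : ℂ} (hu : u ∉ (periods τ).lattice) (m : ℤ) :
    cexp (2 * π * I * (u + m * τ)) ≠ 1 := fun h => by
  obtain ⟨n, hn⟩ := exp_eq_one_iff_mem_range.1 h
  exact hu (mem_periods_lattice.2 ⟨n, -m, by push_cast; linear_combination -hn⟩)

theorem differentiableOn_appell (τ : ℍ) :
    DifferentiableOn ℂ (fun u => appell u τ) (((periods τ).lattice : Set ℂ)ᶜ) := by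
  refine DifferentiableOn.mul (by fun_prop) ?_
  have h := differentiableOn_tsum_appellTerm τ Set.univ
  simp only [Set.mem_univ, if_true] at h
  exact h.mono fun u hu m _ => exp_ne_one_of_notMem_lattice hu m

/-- The Appell–Lerch sum has the same multipliers under the periods `1` and `τ` as the odd theta
function. -/
theorem appell_add_one (u τ : ℂ) : appell (u + 1) τ = -appell u τ := by
  have h1 : cexp (π * I * (u + 1)) = -cexp (π * I * u) := by
    rw [mul_add, mul_one, Complex.exp_add, Complex.exp_pi_mul_I, mul_neg_one]
  rw [appell, appell, h1, neg_mul]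
  congr 3
  funext m
  rw [appellTerm, appellTerm]
  congr 1
  · rw [jacobiTheta₂_term, jacobiTheta₂_term, Complex.exp_eq_exp_iff_exists_int]
    exact ⟨m, by ring⟩
  · congr 1
    rw [Complex.exp_eq_exp_iff_exists_int]
    exact ⟨1, by push_cast; ring⟩

theorem appell_add_tau (u τ : ℂ) :
    appell (u + τ) τ = -cexp (-π * I * τ - 2 * π * I * u) * appell u τ := by
  rw [appell, appell, ← (Equiv.addRight (1 : ℤ)).tsum_eq (appellTerm u τ), ← tsum_mul_left,
    ← tsum_mul_left, ← tsum_mul_left]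
  congr 1
  funext m
  rw [appellTerm, appellTerm, Equiv.coe_addRight,
    show u + τ + m * τ = u + ((m + 1 : ℤ) : ℂ) * τ by push_cast; ring, mul_div, mul_div, mul_div]
  congr 1
  rw [← mul_neg_one (cexp _), ← Complex.exp_pi_mul_I, jacobiTheta₂_term, jacobiTheta₂_term]
  simp only [← Complex.exp_add]
  rw [Complex.exp_eq_exp_iff_exists_int]
  exact ⟨-1, by push_cast; ring⟩

/-- The residue of the Appell–Lerch sum at `u = 0` is that of its term `m = 0`. -/
theorem tendsto_mul_appell (τ : ℍ) :
    Tendsto (fun u => u * appell u τ) (𝓝[≠] 0) (𝓝 (-(2 * π * I))⁻¹) := by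
  classical
  have h1 := differentiableOn_tsum_appellTerm τ {m | m ≠ 0}
  have h0 : (0 : ℂ) ∈ {u : ℂ | ∀ m ∈ {m : ℤ | m ≠ 0}, cexp (2 * π * I * (u + m * τ)) ≠ 1} := by
    intro m hm h
    obtain ⟨n, hn⟩ := exp_eq_one_iff_mem_range.1 h
    have h2 := congrArg Complex.im hn
    simp [τ.im_ne_zero] at h2
    exact hm h2
  have h2 := (h1.differentiableAt
    ((isOpen_setOf_forall_exp_ne_one τ {m | m ≠ 0}).mem_nhds h0)).continuousAt
  set g : ℂ → ℂ := fun u => ∑' m : ℤ, if m ∈ {m : ℤ | m ≠ 0} then appellTerm u τ m else 0 with hg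
  have h3 : ∀ u, appell u τ = cexp (π * I * u) * ((1 - cexp (2 * π * I * u))⁻¹ + g u) := by
    intro u
    rw [appell, (summable_appellTerm u τ).tsum_eq_add_tsum_ite 0]
    congr 2
    · simp [appellTerm, jacobiTheta₂_term]
    · rw [hg]
      refine tsum_congr fun m => ?_
      by_cases hm : m = 0 <;> simp [hm]
  have h4 : HasDerivAt (fun u : ℂ => 1 - cexp (2 * π * I * u)) (-(2 * π * I)) 0 := by
    have h := ((hasDerivAt_id (0 : ℂ)).const_mul (2 * π * I : ℂ)).cexp.const_sub 1
    simpa using h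
  have h5 := (hasDerivAt_iff_tendsto_slope.1 h4).inv₀
    (by simp [Real.pi_ne_zero])
  have h6 : Tendsto (fun u : ℂ => cexp (π * I * u) *
      ((slope (fun u : ℂ => 1 - cexp (2 * π * I * u)) 0 u)⁻¹ + u * g u)) (𝓝[≠] 0)
      (𝓝 (cexp (π * I * 0) * ((-(2 * π * I))⁻¹ + 0 * g 0))) := by
    have h7 : Tendsto (fun u : ℂ => cexp (π * I * u)) (𝓝[≠] 0) (𝓝 (cexp (π * I * 0))) :=
      (Continuous.tendsto (by fun_prop) 0).mono_left nhdsWithin_le_nhds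
    have h8 : Tendsto (fun u : ℂ => u * g u) (𝓝[≠] 0) (𝓝 (0 * g 0)) :=
      (tendsto_id.mul h2.tendsto).mono_left nhdsWithin_le_nhds
    exact h7.mul (h5.add h8)
  rw [mul_zero, Complex.exp_zero, one_mul, zero_mul, add_zero] at h6
  refine h6.congr fun u => ?_
  rw [h3, slope_def_field]
  simp
  ring

/-! ### Functions with the quasi-periods of the odd theta function -/

/-- `D` has the same quasi-periods `1` and `τ` as `oddTheta · τ`. -/
structure IsThetaLike (τ : ℍ) (D : ℂ → ℂ) : Prop where
  add_one : ∀ u, D (u + 1) = -D u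
  add_tau : ∀ u, D (u + τ) = -cexp (-π * I * τ - 2 * π * I * u) * D u

theorem isThetaLike_oddTheta (τ : ℍ) : IsThetaLike τ fun u => oddTheta u τ :=
  ⟨fun u => oddTheta_add_one u τ, fun u => oddTheta_add_tau u τ⟩

theorem isThetaLike_appell (τ : ℍ) : IsThetaLike τ fun u => appell u τ :=
  ⟨fun u => appell_add_one u τ, fun u => appell_add_tau u τ⟩

theorem IsThetaLike.sub {τ : ℍ} {D E : ℂ → ℂ} (hD : IsThetaLike τ D) (hE : IsThetaLike τ E) :
    IsThetaLike τ fun u => D u - E u :=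
  ⟨fun u => by rw [hD.add_one, hE.add_one]; ring, fun u => by rw [hD.add_tau, hE.add_tau]; ring⟩

/-- A theta-like function changes under translation by a period by a nowhere vanishing continuous
factor. -/
theorem IsThetaLike.exists_factor {τ : ℍ} {D : ℂ → ℂ} (hD : IsThetaLike τ D) {l : ℂ}
    (hl : l ∈ (periods τ).lattice) :
    ∃ χ : ℂ → ℂ, Continuous χ ∧ (∀ u, χ u ≠ 0) ∧ ∀ u, D (u + l) = χ u * D u := by
  let G : AddSubgroup ℂ :=
    { carrier := {l | ∃ χ : ℂ → ℂ, Continuous χ ∧ (∀ u, χ u ≠ 0) ∧ ∀ u, D (u + l) = χ u * D u}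
      zero_mem' := ⟨fun _ => 1, continuous_const, fun _ => one_ne_zero, fun u => by simp⟩
      add_mem' := by
        rintro a b ⟨χ, h1, h2, h3⟩ ⟨ψ, h4, h5, h6⟩
        refine ⟨fun u => ψ (u + a) * χ u, by fun_prop, fun u => mul_ne_zero (h5 _) (h2 _),
            fun u => ?_⟩
        rw [← add_assoc, h6, h3]
        ring
      neg_mem' := by
        rintro a ⟨χ, h1, h2, h3⟩
        refine ⟨fun u => (χ (u - a))⁻¹, Continuous.inv₀ (by fun_prop) fun u => h2 _,
          fun u => inv_ne_zero (h2 _), fun u => ?_⟩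
        have h := h3 (u - a)
        rw [sub_add_cancel] at h
        rw [h, ← sub_eq_add_neg, inv_mul_cancel_left₀ (h2 _)] }
  have h1 : (1 : ℂ) ∈ G := ⟨fun _ => -1, continuous_const, fun _ => by norm_num,
    fun u => by rw [hD.add_one]; ring⟩
  have h2 : (τ : ℂ) ∈ G := ⟨fun u => -cexp (-π * I * τ - 2 * π * I * u), by fun_prop,
    fun u => neg_ne_zero.2 (Complex.exp_ne_zero _), hD.add_tau⟩
  obtain ⟨m, n, rfl⟩ := mem_periods_lattice.1 hl
  have h3 := G.add_mem (G.zsmul_mem h1 m) (G.zsmul_mem h2 n)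
  rw [zsmul_eq_mul, zsmul_eq_mul, mul_one] at h3
  exact h3

/-- The `n`-th Fourier coefficient of a theta-like function along the real axis. -/
def thetaCoeff (D : ℂ → ℂ) (n : ℤ) : ℂ :=
  ∫ b in (0 : ℝ)..1, D b * cexp (-2 * π * I * (n + 1 / 2) * b)

/-- Cauchy's theorem: the integral of an entire `1`-periodic function over a period does not change
when the path is moved vertically, nor, by periodicity, when it is moved horizontally. -/
theorem integral_add_eq_of_periodic {E : ℂ → ℂ} (hE : Differentiable ℂ E)
    (hp : ∀ u, E (u + 1) = E u) (τ : ℂ) :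
    ∫ b in (0 : ℝ)..1, E (b + τ) = ∫ b in (0 : ℝ)..1, E b := by
  have h1 := Complex.integral_boundary_rect_eq_zero_of_differentiableOn E 0 (1 + τ.im * I)
    hE.differentiableOn
  have h2 : ∀ y : ℝ, E (1 + y * I) = E (y * I) := fun y => by rw [add_comm, hp]
  simp only [Complex.zero_re, Complex.zero_im, Complex.add_re, Complex.one_re, Complex.mul_re,
    Complex.ofReal_re, Complex.I_re, mul_zero, Complex.ofReal_im, Complex.I_im, mul_one, sub_self,
    add_zero, Complex.add_im, Complex.one_im, Complex.mul_im, zero_add, Complex.ofReal_zero,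
    zero_mul, Complex.ofReal_one, h2, add_sub_cancel_right] at h1
  rw [sub_eq_zero] at h1
  rw [h1]
  have h3 : Function.Periodic (fun b : ℝ => E (b + τ.im * I)) 1 := fun b => by
    have h := hp (b + τ.im * I)
    push_cast
    rw [← h]
    ring_nf
  have h4 := h3.intervalIntegral_add_eq τ.re 0
  rw [zero_add] at h4
  rw [← h4]
  have h5 := intervalIntegral.integral_comp_add_right (a := 0) (b := 1)
    (fun b : ℝ => E (b + τ.im * I)) τ.re
  rw [zero_add, add_comm (1 : ℝ)] at h5
  rw [← h5]
  refine intervalIntegral.integral_congr fun b _ => ?_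
  congr 1
  conv_lhs => rw [← Complex.re_add_im τ]
  push_cast
  ring

/-- Moving the path of integration by `τ` and using the quasi-period `τ` gives a two-term recursion,
so a single coefficient determines all of them. -/
theorem thetaCoeff_succ {τ : ℍ} {D : ℂ → ℂ} (hD : IsThetaLike τ D) (hd : Differentiable ℂ D)
    (n : ℤ) : thetaCoeff D n = -cexp (-2 * π * I * (n + 1) * τ) * thetaCoeff D (n + 1) := by
  have hE : Differentiable ℂ fun u => D u * cexp (-2 * π * I * (n + 1 / 2) * u) :=
    hd.mul (by fun_prop)
  have hp : ∀ u, D (u + 1) * cexp (-2 * π * I * (n + 1 / 2) * (u + 1)) =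
      D u * cexp (-2 * π * I * (n + 1 / 2) * u) := by
    intro u
    rw [hD.add_one, neg_mul, neg_eq_iff_eq_neg, ← mul_neg]
    congr 1
    rw [← mul_neg_one (cexp _), ← Complex.exp_pi_mul_I, ← Complex.exp_add,
      Complex.exp_eq_exp_iff_exists_int]
    exact ⟨-n - 1, by push_cast; ring⟩
  rw [thetaCoeff, ← integral_add_eq_of_periodic hE hp τ, thetaCoeff,
    ← intervalIntegral.integral_const_mul]
  refine intervalIntegral.integral_congr fun b _ => ?_
  rw [hD.add_tau]
  have h : cexp (-π * I * τ - 2 * π * I * b) * cexp (-2 * π * I * (n + 1 / 2) * (b + τ)) =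
      cexp (-2 * π * I * (n + 1) * τ) * cexp (-2 * π * I * (((n + 1 : ℤ) : ℂ) + 1 / 2) * b) := by
    rw [← Complex.exp_add, ← Complex.exp_add]
    push_cast
    ring_nf
  linear_combination (-D b) * h

theorem thetaCoeff_eq_zero {τ : ℍ} {D : ℂ → ℂ} (hD : IsThetaLike τ D) (hd : Differentiable ℂ D)
    (h0 : thetaCoeff D 0 = 0) (n : ℤ) : thetaCoeff D n = 0 := by
  have h1 : ∀ n : ℤ, thetaCoeff D n = 0 ↔ thetaCoeff D (n + 1) = 0 := fun n => by
    rw [thetaCoeff_succ hD hd n]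
    simp [Complex.exp_ne_zero]
  induction n using Int.induction_on with
  | zero => exact h0
  | succ i hi => exact (h1 _).1 hi
  | pred i hi => exact (h1 _).2 (by simpa using hi)

/-- All Fourier coefficients on the real axis vanish, hence `D` vanishes on the real axis and, being
entire, everywhere. -/
theorem eq_zero_of_thetaCoeff_eq_zero {τ : ℍ} {D : ℂ → ℂ} (hD : IsThetaLike τ D)
    (hd : Differentiable ℂ D) (h0 : thetaCoeff D 0 = 0) : D = 0 := by
  have h1 := thetaCoeff_eq_zero hD hd h0
  have hper : Function.Periodic (fun b : ℝ => D b * cexp (-π * I * b)) 1 := fun b => by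
    have h := hD.add_one b
    push_cast
    rw [h, mul_add, mul_one, Complex.exp_add, neg_mul (π : ℂ) I, Complex.exp_neg (π * I),
      Complex.exp_pi_mul_I]
    norm_num
  have hcont : Continuous (fun b : ℝ => D b * cexp (-π * I * b)) :=
    (hd.continuous.comp Complex.continuous_ofReal).mul (by fun_prop)
  let f : C(AddCircle (1 : ℝ), ℂ) := ⟨hper.lift, continuous_coinduced_dom.2 hcont⟩
  have : Fact ((0 : ℝ) < 1) := ⟨one_pos⟩
  have h2 : ∀ n, fourierCoeff f n = 0 := fun n => by
    rw [fourierCoeff_eq_intervalIntegral f n 0, zero_add]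
    simp only [one_div, inv_one, one_smul]
    rw [← h1 n, thetaCoeff]
    refine intervalIntegral.integral_congr fun b _ => ?_
    have h3 : f (b : AddCircle (1 : ℝ)) = D b * cexp (-π * I * b) := hper.lift_coe b
    rw [h3, fourier_coe_apply, smul_eq_mul, mul_left_comm, ← Complex.exp_add]
    congr 2
    push_cast
    ring
  have h3 : f = 0 := by
    ext x
    have h := has_pointwise_sum_fourier_series_of_summable (f := f)
      (by rw [show fourierCoeff f = 0 from funext h2]; exact summable_zero) x
    simp only [h2, zero_smul] at h
    exact h.unique hasSum_zero
  have h4 : ∀ b : ℝ, D b = 0 := fun b => by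
    have h : f (b : AddCircle (1 : ℝ)) = D b * cexp (-π * I * b) := hper.lift_coe b
    rw [h3] at h
    simpa [Complex.exp_ne_zero] using h.symm
  have h5 : AnalyticOnNhd ℂ D Set.univ := hd.differentiableOn.analyticOnNhd isOpen_univ
  refine funext fun u => h5.eqOn_zero_of_preconnected_of_frequently_eq_zero isPreconnected_univ
    (Set.mem_univ (0 : ℂ)) ?_ (Set.mem_univ u)
  have h6 : Tendsto (fun n : ℕ => ((1 / ((n : ℝ) + 1) : ℝ) : ℂ)) atTop (𝓝[≠] 0) := by
    refine tendsto_nhdsWithin_iff.2 ⟨?_, Eventually.of_forall fun n => ?_⟩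
    · have h := (Complex.continuous_ofReal.tendsto 0).comp
        (tendsto_one_div_add_atTop_nhds_zero_nat (𝕜 := ℝ))
      simpa [Function.comp_def] using h
    · have : (n : ℝ) + 1 ≠ 0 := by positivity
      simp only [Set.mem_compl_iff, Set.mem_singleton_iff, Complex.ofReal_eq_zero]
      positivity
  exact h6.frequently (Frequently.of_forall fun n => h4 _)

/-- The space of entire theta-like functions is one-dimensional. -/
theorem IsThetaLike.exists_eq_mul {τ : ℍ} {D : ℂ → ℂ} (hD : IsThetaLike τ D)
    (hd : Differentiable ℂ D) : ∃ M : ℂ, ∀ u, D u = M * oddTheta u τ := by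
  have hθ := differentiable_oddTheta τ.2
  have h0 : thetaCoeff (fun u => oddTheta u τ) 0 ≠ 0 := fun h => by
    have h1 := eq_zero_of_thetaCoeff_eq_zero (isThetaLike_oddTheta τ) hθ h
    refine thetaNull_ne_zero τ ?_
    rw [thetaNull, show (fun z => oddTheta z τ) = 0 from h1]
    exact deriv_const 0 0
  -- the multiple of `θ` that cancels the zeroth coefficient of `D`
  set M := thetaCoeff D 0 / thetaCoeff (fun u => oddTheta u τ) 0 with hM
  have h2 : IsThetaLike τ fun u => D u - M * oddTheta u τ :=
    ⟨fun u => by rw [hD.add_one, oddTheta_add_one]; ring,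
      fun u => by rw [hD.add_tau, oddTheta_add_tau]; ring⟩
  have h3 : thetaCoeff (fun u => D u - M * oddTheta u τ) 0 = 0 := by
    have hi : ∀ E : ℂ → ℂ, Differentiable ℂ E → IntervalIntegrable
        (fun b : ℝ => E b * cexp (-2 * π * I * ((0 : ℤ) + 1 / 2) * b)) MeasureTheory.volume 0 1 :=
      fun E hE => (Continuous.mul (hE.continuous.comp Complex.continuous_ofReal)
        (by fun_prop)).intervalIntegrable 0 1
    have h : thetaCoeff (fun u => D u - M * oddTheta u τ) 0 =
        thetaCoeff D 0 - M * thetaCoeff (fun u => oddTheta u τ) 0 := by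
      rw [thetaCoeff, thetaCoeff, thetaCoeff, ← intervalIntegral.integral_const_mul,
        ← intervalIntegral.integral_sub (hi D hd) ((hi _ hθ).const_mul M)]
      refine intervalIntegral.integral_congr fun b _ => ?_
      ring
    rw [h, hM, div_mul_cancel₀ _ h0, sub_self]
  have h4 := eq_zero_of_thetaCoeff_eq_zero h2 (hd.sub (hθ.const_mul M)) h3
  exact ⟨M, fun u => sub_eq_zero.1 (congrFun h4 u)⟩

/-- Riemann's theorem for a function on the complement of a period lattice. -/
theorem exists_entire_extension (L : PeriodPair) {f : ℂ → ℂ}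
    (hf : DifferentiableOn ℂ f ((L.lattice : Set ℂ)ᶜ))
    (h0 : ∀ l ∈ L.lattice, Tendsto (fun z => (z - l) * f z) (𝓝[≠] l) (𝓝 0)) :
    ∃ g : ℂ → ℂ, Differentiable ℂ g ∧ ∀ z ∉ L.lattice, g z = f z := by
  have ho : IsOpen ((L.lattice : Set ℂ)ᶜ) := L.isClosed_lattice.isOpen_compl
  have h1 : ∀ z ∉ L.lattice, limUnder (𝓝[≠] z) f = f z := fun z hz =>
    Tendsto.limUnder_eq ((hf.differentiableAt (ho.mem_nhds hz)).continuousAt.tendsto.mono_left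
      nhdsWithin_le_nhds)
  refine ⟨fun z => limUnder (𝓝[≠] z) f, fun z => ?_, h1⟩
  by_cases hz : z ∈ L.lattice
  · have hs := L.compl_lattice_sdiff_singleton_mem_nhds z
    have hd : DifferentiableOn ℂ f (((L.lattice : Set ℂ) \ {z})ᶜ \ {z}) :=
      hf.mono fun w hw hwl => hw.1 ⟨hwl, hw.2⟩
    have hlo : (fun w => f w - f z) =o[𝓝[≠] z] fun w => (w - z)⁻¹ := by
      refine (isLittleO_iff_tendsto' ?_).2 ?_
      · filter_upwards [self_mem_nhdsWithin] with w hw h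
        exact absurd (inv_eq_zero.1 h) (sub_ne_zero.2 hw)
      · have h2 : Tendsto (fun w => (w - z) * f w - (w - z) * f z) (𝓝[≠] z)
            (𝓝 (0 - (z - z) * f z)) :=
          (h0 z hz).sub ((Continuous.tendsto (by fun_prop) z).mono_left nhdsWithin_le_nhds)
        rw [sub_self, zero_mul, sub_zero] at h2
        refine h2.congr fun w => ?_
        rw [div_inv_eq_mul]
        ring
    have h3 := (differentiableOn_update_limUnder_of_isLittleO hs hd hlo).differentiableAt hs
    refine h3.congr_of_eventuallyEq ?_
    filter_upwards [hs] with w hw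
    by_cases hwz : w = z
    · rw [hwz, Function.update_self]
    · rw [Function.update_of_ne hwz]
      exact h1 w fun hwl => hw ⟨hwl, hwz⟩
  · refine (hf.differentiableAt (ho.mem_nhds hz)).congr_of_eventuallyEq ?_
    filter_upwards [ho.mem_nhds hz] with w hw
    exact h1 w hw

/-- Density of the complement lets functional equations pass from a function to its entire
extension. -/
theorem dense_compl_lattice (L : PeriodPair) : Dense ((L.lattice : Set ℂ)ᶜ) := by
  have : Countable L.lattice := L.latticeEquivProd.toEquiv.countable_iff.2 inferInstance
  exact Set.Countable.dense_compl ℝ (Set.countable_coe_iff.1 this)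

theorem add_mem_lattice_iff_left {L : PeriodPair} {u l : ℂ} (hl : l ∈ L.lattice) :
    u + l ∈ L.lattice ↔ u ∈ L.lattice :=
  ⟨fun h => by simpa using L.lattice.sub_mem h hl, fun h => L.lattice.add_mem h hl⟩

theorem one_mem_lattice (τ : ℍ) : (1 : ℂ) ∈ (periods τ).lattice :=
  mem_periods_lattice.2 ⟨1, 0, by simp⟩

theorem tau_mem_lattice (τ : ℍ) : (τ : ℂ) ∈ (periods τ).lattice :=
  mem_periods_lattice.2 ⟨0, 1, by simp⟩

/-- A theta-like function with at most simple poles on the lattice, and none at `0`, is a multiple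
of the odd theta function off the lattice. -/
theorem IsThetaLike.exists_eq_mul_of_tendsto {τ : ℍ} {D : ℂ → ℂ} (hD : IsThetaLike τ D)
    (hd : DifferentiableOn ℂ D (((periods τ).lattice : Set ℂ)ᶜ))
    (h0 : Tendsto (fun z => z * D z) (𝓝[≠] 0) (𝓝 0)) :
    ∃ M : ℂ, ∀ u ∉ (periods τ).lattice, D u = M * oddTheta u τ := by
  obtain ⟨g, hg, hgD⟩ := exists_entire_extension (periods τ) hd fun l hl => by
    obtain ⟨χ, hχ, -, h1⟩ := hD.exists_factor hl
    have h2 : Tendsto (fun z => z - l) (𝓝[≠] l) (𝓝[≠] 0) := by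
      refine tendsto_nhdsWithin_iff.2 ⟨?_, ?_⟩
      · have h : Tendsto (fun z => z - l) (𝓝 l) (𝓝 (l - l)) := Continuous.tendsto (by fun_prop) l
        rw [sub_self] at h
        exact h.mono_left nhdsWithin_le_nhds
      · filter_upwards [self_mem_nhdsWithin] with z hz
        exact sub_ne_zero.2 hz
    have h3 : Tendsto (fun z => χ (z - l)) (𝓝[≠] l) (𝓝 (χ (l - l))) :=
      (Continuous.tendsto (by fun_prop) l).mono_left nhdsWithin_le_nhds
    have h4 := h3.mul (h0.comp h2)
    rw [mul_zero] at h4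
    refine h4.congr fun z => ?_
    have h5 := h1 (z - l)
    rw [sub_add_cancel] at h5
    rw [h5]
    simp only [Function.comp_apply]
    ring
  have hdense := dense_compl_lattice (periods τ)
  have hgθ : IsThetaLike τ g := by
    constructor
    · refine fun u => congrFun (Continuous.ext_on hdense (f := fun u => g (u + 1))
        (g := fun u => -g u) (hg.continuous.comp (by fun_prop)) hg.continuous.neg fun w hw => ?_) u
      simp only
      rw [hgD w hw, hgD (w + 1) fun h => hw ((add_mem_lattice_iff_left (one_mem_lattice τ)).1 h),
        hD.add_one]
    · refine fun u => congrFun (Continuous.ext_on hdense (f := fun u => g (u + τ))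
        (g := fun u => -cexp (-π * I * τ - 2 * π * I * u) * g u) (hg.continuous.comp (by fun_prop))
        (Continuous.mul (by fun_prop) hg.continuous) fun w hw => ?_) u
      simp only
      rw [hgD w hw, hgD (w + τ) fun h => hw ((add_mem_lattice_iff_left (tau_mem_lattice τ)).1 h),
        hD.add_tau]
  obtain ⟨M, hM⟩ := hgθ.exists_eq_mul hg
  exact ⟨M, fun u hu => by rw [← hgD u hu, hM]⟩

/-- The residue constant `c = -1 / (2πi θ'(0))`. -/
def appellConst (τ : ℂ) : ℂ := (-(2 * π * I))⁻¹ / thetaNull τ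

theorem tendsto_sq_mul_weierstrassP (L : PeriodPair) :
    Tendsto (fun z => z ^ 2 * L.weierstrassP z) (𝓝[≠] 0) (𝓝 1) := by
  have h1 := (L.analyticAt_weierstrassPExcept 0).continuousAt
  have h2 : Tendsto (fun z => z ^ 2 * L.weierstrassPExcept 0 z + 1) (𝓝[≠] 0)
      (𝓝 (0 ^ 2 * L.weierstrassPExcept 0 0 + 1)) :=
    (((tendsto_id.pow 2).mul h1.tendsto).add_const 1).mono_left nhdsWithin_le_nhds
  rw [zero_pow two_ne_zero, zero_mul, zero_add] at h2
  refine h2.congr' ?_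
  filter_upwards [self_mem_nhdsWithin] with z hz
  have hz : z ≠ 0 := hz
  have h := L.weierstrassPExcept_add ⟨0, L.lattice.zero_mem⟩ z
  simp only [sub_zero] at h
  rw [← h]
  field_simp
  simp

/-- The Appell–Lerch sum is `N = cθ℘ + Mθ` with constants `c`, `M`: the poles of `N` and `cθ℘`
cancel. -/
theorem exists_appell_eq (τ : ℍ) : ∃ M : ℂ, ∀ u ∉ (periods τ).lattice,
    appell u τ =
      (appellConst τ * (periods τ).weierstrassP u + M) * oddTheta u τ := by
  set L := periods τ with hL
  have hn := thetaNull_ne_zero τ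
  have hP : IsThetaLike τ fun u => appellConst τ * (oddTheta u τ * L.weierstrassP u) := by
    constructor
    · intro u
      have h := L.weierstrassP_add_coe u ⟨1, one_mem_lattice τ⟩
      simp only at h ⊢
      rw [h, oddTheta_add_one]
      ring
    · intro u
      have h := L.weierstrassP_add_coe u ⟨τ, tau_mem_lattice τ⟩
      simp only at h ⊢
      rw [h, oddTheta_add_tau]
      ring
  -- the residues of `N` and of `cθ℘ ~ cθ'(0)/z` at the origin agree by the choice of `c`
  have h1 : Tendsto (fun z => z * (appell z τ - appellConst τ * (oddTheta z τ * L.weierstrassP z)))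
      (𝓝[≠] 0) (𝓝 0) := by
    have h2 := (hasDerivAt_iff_tendsto_slope.1 (hasDerivAt_oddTheta_zero τ.2))
    have h3 := (tendsto_mul_appell τ).sub
      ((h2.mul (tendsto_sq_mul_weierstrassP L)).const_mul (appellConst τ))
    rw [mul_one, show (-(2 * π * I) : ℂ)⁻¹ - appellConst τ * thetaNull τ = 0 by
      rw [appellConst, div_mul_cancel₀ _ hn, sub_self]] at h3
    refine h3.congr' ?_
    filter_upwards [self_mem_nhdsWithin] with z hz
    have hz : z ≠ 0 := hz
    rw [slope_def_field]
    simp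
    field_simp
  obtain ⟨M, hM⟩ := ((isThetaLike_appell τ).sub hP).exists_eq_mul_of_tendsto
    ((differentiableOn_appell τ).sub ((((differentiable_oddTheta τ.2).differentiableOn).mul
      L.differentiableOn_weierstrassP).const_mul _)) h1
  exact ⟨M, fun u hu => by linear_combination hM u hu⟩

/-! ### Bounds for the theta function and the Appell–Lerch sum -/

/-- A Gaussian exponent `Q ≥ -k` is split into a factor that is summable for the least admissible
`y`, and an exponential of `y`. -/
theorem exp_neg_pi_mul_le {y y₀ Q k : ℝ} (hy : y₀ ≤ y) (hQ : 0 ≤ Q + k) :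
    Real.exp (-π * (y * Q)) ≤ Real.exp (π * k * y) * Real.exp (-π * (y₀ * (Q + k))) := by
  rw [← Real.exp_add, Real.exp_le_exp]
  nlinarith [mul_nonneg (mul_nonneg Real.pi_pos.le hQ) (sub_nonneg.2 hy)]

theorem norm_pow_sub_one_le {E : ℂ} {r : ℝ} (h1 : 1 ≤ r) (hE : ‖E‖ ≤ r) (k : ℕ) :
    ‖E ^ (k + 1) - 1‖ ≤ (k + 1) * r ^ k * ‖E - 1‖ := by
  rw [← mul_geom_sum, norm_mul, mul_comm]
  refine mul_le_mul_of_nonneg_right ?_ (norm_nonneg _)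
  refine (norm_sum_le _ _).trans ?_
  have h : ∀ i ∈ Finset.range (k + 1), ‖E ^ i‖ ≤ r ^ k := fun i hi => by
    rw [norm_pow]
    exact (pow_le_pow_left₀ (norm_nonneg _) hE i).trans
      (pow_le_pow_right₀ h1 (Nat.lt_succ_iff.1 (Finset.mem_range.1 hi)))
  refine (Finset.sum_le_sum h).trans ?_
  simp

/-- Up to an exponential factor, the sum of the terms `n` and `-1 - n` is
`E^(2n+1) - 1` with `E = e^(2πiv)`, which is divisible by `E - 1`. -/
theorem oddThetaTerm_add_reflect (v τ : ℂ) (n : ℕ) :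
    oddThetaTerm v τ n + oddThetaTerm v τ (-((n : ℤ) + 1)) =
      cexp (π * I * (n + 1 / 2) ^ 2 * τ - 2 * π * I * (n + 1 / 2) * v + π * I * n) *
        (cexp (2 * π * I * v) ^ (2 * n + 1) - 1) := by
  have h1 : oddThetaTerm v τ (-((n : ℤ) + 1)) =
      -cexp (π * I * (n + 1 / 2) ^ 2 * τ - 2 * π * I * (n + 1 / 2) * v + π * I * n) := by
    rw [oddThetaTerm, ← mul_neg_one (cexp _), ← Complex.exp_pi_mul_I, ← Complex.exp_add,
      Complex.exp_eq_exp_iff_exists_int]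
    exact ⟨-n - 1, by push_cast; ring⟩
  rw [h1, oddThetaTerm, mul_sub, mul_one, ← sub_eq_add_neg, ← Complex.exp_nat_mul,
    ← Complex.exp_add]
  push_cast
  ring_nf

theorem summable_odd_mul_exp {y₀ : ℝ} (hy₀ : 0 < y₀) :
    Summable fun n : ℕ => (2 * n + 1 : ℝ) * Real.exp (-π * (y₀ * ((n ^ 2 - 5 * n) + 7))) := by
  have h (k : ℕ) := (summable_pow_mul_jacobiTheta₂_term_bound (5 / 2 * y₀) hy₀ k).comp_injective
    (i := fun n : ℕ => (n : ℤ)) Nat.cast_injective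
  have h2 := (((h 1).mul_left 2).add (h 0)).mul_right (Real.exp (-π * (y₀ * 7)))
  refine h2.congr fun n => ?_
  simp only [Function.comp_apply, Int.cast_natCast, Int.cast_abs, Nat.abs_cast, pow_one, pow_zero,
    one_mul]
  rw [show -π * (y₀ * ((n : ℝ) ^ 2 - 5 * n + 7)) =
    -π * (y₀ * n ^ 2 - 2 * (5 / 2 * y₀) * n) + -π * (y₀ * 7) by ring, Real.exp_add]
  ring

/-- Pairing the terms `n` and `-1 - n` of the theta series makes the factor `1 - e^(2πiv)` visible,
which cancels the poles of the Appell–Lerch sum; the rest is bounded by an exponential of `Im τ`. -/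
theorem exists_norm_oddTheta_le {y₀ : ℝ} (hy₀ : 0 < y₀) : ∃ C : ℝ, 0 ≤ C ∧ ∀ v τ : ℂ, y₀ ≤ τ.im →
    |v.im| ≤ τ.im →
      ‖oddTheta v τ‖ ≤ C * Real.exp (8 * π * τ.im) * ‖1 - cexp (2 * π * I * v)‖ := by
  refine ⟨∑' n : ℕ, (2 * n + 1 : ℝ) * Real.exp (-π * (y₀ * ((n ^ 2 - 5 * n) + 7))),
    tsum_nonneg fun n => by positivity, fun v τ hτ hv => ?_⟩
  have hπ := Real.pi_pos
  have hy : 0 < τ.im := hy₀.trans_le hτ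
  have hs := (hasSum_oddTheta v hy).nat_add_neg_add_one
  rw [← hs.tsum_eq]
  have hE : ‖cexp (2 * π * I * v)‖ ≤ Real.exp (2 * π * τ.im) := by
    have h := norm_nome v
    rw [nome] at h
    rw [h, Real.exp_le_exp]
    nlinarith [neg_abs_le v.im]
  have hb : ∀ n : ℕ, ‖oddThetaTerm v τ n + oddThetaTerm v τ (-((n : ℤ) + 1))‖ ≤
      (2 * n + 1 : ℝ) * Real.exp (-π * (y₀ * ((n ^ 2 - 5 * n) + 7))) *
        (Real.exp (8 * π * τ.im) * ‖1 - cexp (2 * π * I * v)‖) := fun n => by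
    rw [oddThetaTerm_add_reflect, norm_mul]
    have h1 : ‖cexp (π * I * (n + 1 / 2) ^ 2 * τ - 2 * π * I * (n + 1 / 2) * v + π * I * n)‖ ≤
        Real.exp (-π * (n + 1 / 2) ^ 2 * τ.im + 2 * π * (n + 1 / 2) * τ.im) := by
      rw [Complex.norm_exp, Real.exp_le_exp,
        show (π * I * (n + 1 / 2) ^ 2 * τ - 2 * π * I * (n + 1 / 2) * v + π * I * n : ℂ) =
          ((π * (n + 1 / 2) ^ 2 : ℝ) : ℂ) * (I * τ) - ((2 * π * (n + 1 / 2) : ℝ) : ℂ) * (I * v) +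
            ((π * n : ℝ) : ℂ) * I by push_cast; ring]
      simp only [Complex.add_re, Complex.sub_re, Complex.re_ofReal_mul, Complex.I_mul_re,
        Complex.I_re]
      have h2 : 2 * π * ((n : ℝ) + 1 / 2) * v.im ≤ 2 * π * (n + 1 / 2) * τ.im :=
        mul_le_mul_of_nonneg_left ((le_abs_self _).trans hv) (by positivity)
      nlinarith
    have h3 := norm_pow_sub_one_le (Real.one_le_exp (by positivity)) hE (2 * n)
    rw [norm_sub_rev _ (1 : ℂ), norm_sub_rev (cexp _) (1 : ℂ), ← Real.exp_nat_mul] at h3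
    rw [norm_sub_rev]
    refine (mul_le_mul h1 h3 (norm_nonneg _) (Real.exp_nonneg _)).trans ?_
    have h4 : Real.exp (-π * (n + 1 / 2) ^ 2 * τ.im + 2 * π * (n + 1 / 2) * τ.im) *
        Real.exp ((2 * n : ℕ) * (2 * π * τ.im)) ≤
          Real.exp (8 * π * τ.im) * Real.exp (-π * (y₀ * ((n ^ 2 - 5 * n) + 7))) := by
      rw [← Real.exp_add]
      have hq : (0 : ℝ) ≤ ((n : ℝ) ^ 2 - 5 * n) + 7 := by nlinarith [sq_nonneg ((n : ℝ) - 5 / 2)]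
      have h5 := exp_neg_pi_mul_le hτ hq
      have h6 : Real.exp (π * 7 * τ.im) = Real.exp (8 * π * τ.im) * Real.exp (-π * τ.im) := by
        rw [← Real.exp_add]
        ring_nf
      rw [h6] at h5
      have h7 : Real.exp (-π * (n + 1 / 2) ^ 2 * τ.im + 2 * π * (n + 1 / 2) * τ.im +
          (2 * n : ℕ) * (2 * π * τ.im)) ≤
          Real.exp (π * τ.im) * Real.exp (-π * (τ.im * ((n : ℝ) ^ 2 - 5 * n))) := by
        rw [← Real.exp_add, Real.exp_le_exp]
        push_cast
        nlinarith [mul_pos hπ hy]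
      refine h7.trans ((mul_le_mul_of_nonneg_left h5 (Real.exp_nonneg _)).trans (le_of_eq ?_))
      rw [← mul_assoc, mul_left_comm, ← Real.exp_add, show π * τ.im + -π * τ.im = 0 by ring,
        Real.exp_zero, mul_one]
    have h8 : (0 : ℝ) ≤ (2 * n + 1) * ‖1 - cexp (2 * π * I * v)‖ := by positivity
    have h9 := mul_le_mul_of_nonneg_right h4 h8
    push_cast at h9 ⊢
    linarith
  have h := tsum_of_norm_bounded ((summable_odd_mul_exp hy₀).hasSum.mul_right _) hb
  rw [← mul_assoc] at h
  exact h

theorem summable_appellBound_shift {y₀ : ℝ} (hy₀ : 0 < y₀) :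
    Summable fun m : ℤ => Real.exp (-π * (y₀ * ((m ^ 2 - 3 * |m|) + 3))) := by
  have h := (summable_appellBound (3 / 2 * y₀) hy₀).mul_right (Real.exp (-π * (y₀ * 3)))
  refine h.congr fun m => ?_
  rw [appellBound, ← Real.exp_add]
  ring_nf

theorem im_add_mul_coe (τ : ℍ) (a b : ℝ) : (a * (τ : ℂ) + b).im = a * τ.im := by
  simp

/-- The poles of the Appell–Lerch sum are cancelled by the zeros of the theta function, with a bound
that is uniform in the period parallelogram. -/
theorem exists_norm_appell_mul_oddTheta_le {y₀ : ℝ} (hy₀ : 0 < y₀) : ∃ C A : ℝ, 0 ≤ C ∧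
    ∀ τ : ℍ, y₀ ≤ τ.im → ∀ a ∈ Set.Ioo (0 : ℝ) 1, ∀ b : ℝ,
      ‖appell (a * τ + b) τ‖ * ‖oddTheta (a * τ + b) τ‖ ≤ C * Real.exp (A * τ.im) := by
  obtain ⟨C, hC, hθ⟩ := exists_norm_oddTheta_le hy₀
  set B : ℝ := ∑' m : ℤ, Real.exp (-π * (y₀ * ((m ^ 2 - 3 * |m|) + 3))) with hB
  have hB0 : 0 ≤ B := tsum_nonneg fun m => Real.exp_nonneg _
  have hπ := Real.pi_pos
  have hδ : 0 < 1 - Real.exp (-2 * π * y₀) := by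
    rw [sub_pos, Real.exp_lt_one_iff]
    nlinarith [mul_pos hπ hy₀]
  -- the three parts of the estimate grow at most like `e^(11πy)`, `e^(8πy)` and `e^(11πy)`
  refine ⟨C + C + B / (1 - Real.exp (-2 * π * y₀)) * (C * 2), 14 * π, by positivity,
    fun τ hτ a ha b => ?_⟩
  have hy := τ.im_pos
  set u : ℂ := a * τ + b with hu
  have him : u.im = a * τ.im := im_add_mul_coe τ a b
  have ha0 := ha.1
  have ha1 := ha.2
  have hay : a * τ.im < τ.im := by nlinarith
  have hay0 : 0 < a * τ.im := mul_pos ha0 hy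
  -- the terms `m = 0` and `m = -1`, whose poles lie on the boundary of the parallelogram
  have h0 : ‖appellTerm u τ 0‖ * ‖oddTheta u τ‖ ≤ C * Real.exp (8 * π * τ.im) := by
    have h1 := hθ u τ hτ (by rw [him, abs_of_pos hay0]; exact hay.le)
    have h2 : appellTerm u τ 0 = (1 - cexp (2 * π * I * u))⁻¹ := by
      simp [appellTerm, jacobiTheta₂_term]
    have h3 : 0 < ‖1 - cexp (2 * π * I * u)‖ := by
      refine lt_of_lt_of_le ?_ (one_sub_rexp_le_norm_one_sub_cexp (δ := a * τ.im) ?_)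
      · rw [sub_pos, Real.exp_lt_one_iff]
        nlinarith
      · rw [him]
        exact le_abs_self _
    rw [h2, norm_inv, inv_mul_le_iff₀ h3, mul_comm]
    exact h1
  have hm1 : ‖appellTerm u τ (-1)‖ * ‖oddTheta u τ‖ ≤ C * Real.exp (11 * π * τ.im) := by
    set v := u - τ with hv
    have hvim : v.im = (a - 1) * τ.im := by
      rw [hv, Complex.sub_im, him, UpperHalfPlane.coe_im]
      ring
    have hv0 : (1 - a) * τ.im > 0 := mul_pos (by linarith) hy
    have h1 := hθ v τ hτ (by
      rw [hvim, abs_le]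
      constructor
      · simp only [UpperHalfPlane.coe_im]
        nlinarith
      · simp only [UpperHalfPlane.coe_im]
        nlinarith)
    have h2 : appellTerm u τ (-1) = jacobiTheta₂_term (-1) (u + 1 / 2 + τ / 2) τ /
        (1 - cexp (2 * π * I * v)) := by
      rw [appellTerm, hv]
      push_cast
      ring_nf
    have h3 : 0 < ‖1 - cexp (2 * π * I * v)‖ := by
      refine lt_of_lt_of_le ?_ (one_sub_rexp_le_norm_one_sub_cexp (δ := (1 - a) * τ.im) ?_)
      · rw [sub_pos, Real.exp_lt_one_iff]
        nlinarith
      · rw [hvim]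
        refine le_trans (le_of_eq ?_) (neg_le_abs _)
        ring
    have h4 : ‖jacobiTheta₂_term (-1) (u + 1 / 2 + τ / 2) τ‖ ≤ Real.exp (2 * π * τ.im) := by
      rw [norm_jacobiTheta₂_term, Real.exp_le_exp]
      have : (u + 1 / 2 + (τ : ℂ) / 2).im = a * τ.im + τ.im / 2 := by
        rw [Complex.add_im, Complex.add_im, him]
        simp
      rw [this]
      push_cast
      simp only [UpperHalfPlane.coe_im]
      nlinarith
    have h5 : ‖oddTheta u τ‖ ≤ Real.exp (π * τ.im) * ‖oddTheta v τ‖ := by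
      have h := oddTheta_add_tau v τ
      rw [hv, sub_add_cancel] at h
      rw [h, norm_mul, norm_neg, ← hv]
      refine mul_le_mul_of_nonneg_right ?_ (norm_nonneg _)
      rw [Complex.norm_exp, Real.exp_le_exp]
      have : (-π * I * τ - 2 * π * I * v : ℂ).re = π * τ.im + 2 * π * v.im := by
        simp
      rw [this, hvim]
      nlinarith
    rw [h2, norm_div, div_mul_eq_mul_div, div_le_iff₀ h3]
    calc _ ≤ Real.exp (2 * π * τ.im) * (Real.exp (π * τ.im) *
          (C * Real.exp (8 * π * τ.im) * ‖1 - cexp (2 * π * I * v)‖)) :=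
        mul_le_mul h4 (h5.trans (mul_le_mul_of_nonneg_left h1 (Real.exp_nonneg _)))
          (norm_nonneg _) (Real.exp_nonneg _)
      _ = C * (Real.exp (2 * π * τ.im) * Real.exp (π * τ.im) * Real.exp (8 * π * τ.im)) *
          ‖1 - cexp (2 * π * I * v)‖ := by ring
      _ = _ := by
        rw [← Real.exp_add, ← Real.exp_add]
        ring_nf
  -- the remaining terms
  have hrest : ∀ m : ℤ, ‖if m = -1 then 0 else if m = 0 then 0 else appellTerm u τ m‖ ≤
      Real.exp (-π * (y₀ * ((m ^ 2 - 3 * |m|) + 3))) *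
        (Real.exp (3 * π * τ.im) / (1 - Real.exp (-2 * π * y₀))) := fun m => by
    by_cases h1 : m = -1
    · simp only [h1, if_true, norm_zero]
      positivity
    by_cases h2 : m = 0
    · simp only [h2, if_true, ite_self, norm_zero]
      positivity
    simp only [h1, h2, if_false]
    have h3 := norm_appellTerm_le (u := u) (τ := τ) (S := 3 / 2 * τ.im) (T := τ.im) (m := m) hy (by
      rw [Complex.add_im, Complex.add_im, him]
      simp only [Complex.div_ofNat_im, Complex.one_im, zero_div, add_zero, UpperHalfPlane.coe_im]
      rw [abs_of_pos (by positivity)]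
      linarith) le_rfl hy₀ (by
      have : (u + m * (τ : ℂ)).im = (a + m) * τ.im := by
        rw [Complex.add_im, him]
        simp
        ring
      rw [this, abs_mul, abs_of_pos hy]
      have h4 : 1 ≤ |a + m| := by
        rcases lt_or_gt_of_ne h2 with h | h
        · have h5 : (m : ℝ) ≤ -2 := by
            have : m ≤ -2 := by omega
            exact_mod_cast this
          exact le_abs.2 (Or.inr (by linarith))
        · have h5 : (1 : ℝ) ≤ m := by exact_mod_cast h
          exact le_abs.2 (Or.inl (by linarith))
      nlinarith)
    refine h3.trans ?_
    rw [← mul_div_assoc]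
    refine div_le_div_of_nonneg_right ?_ hδ.le
    rw [appellBound, mul_comm (Real.exp _)]
    have h5 := exp_neg_pi_mul_le (Q := (m : ℝ) ^ 2 - 3 * |(m : ℝ)|) (k := 3) hτ
      (by nlinarith [sq_nonneg (|(m : ℝ)| - 3 / 2), sq_abs (m : ℝ)])
    push_cast
    rw [mul_comm 3 π]
    refine le_trans (le_of_eq ?_) h5
    congr 1
    ring
  have hsum := summable_appellTerm u τ
  have hsplit : ∑' m, appellTerm u τ m = appellTerm u τ (-1) + (appellTerm u τ 0 +
      ∑' m : ℤ, if m = -1 then 0 else if m = 0 then 0 else appellTerm u τ m) := by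
    rw [hsum.tsum_eq_add_tsum_ite (-1)]
    congr 1
    have h1 : Summable fun m : ℤ => if m = -1 then 0 else appellTerm u τ m :=
      (hsum.update (-1) 0).congr fun m => by simp [Function.update_apply]
    rw [h1.tsum_eq_add_tsum_ite 0]
    congr 1
    refine tsum_congr fun m => ?_
    by_cases h : m = 0 <;> simp [h]
  have htail := tsum_of_norm_bounded ((summable_appellBound_shift hy₀).hasSum.mul_right _) hrest
  rw [← hB] at htail
  have hθu : ‖oddTheta u τ‖ ≤ C * Real.exp (8 * π * τ.im) * 2 := by
    refine (hθ u τ hτ (by rw [him, abs_of_pos hay0]; exact hay.le)).trans ?_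
    refine mul_le_mul_of_nonneg_left ?_ (by positivity)
    refine (norm_sub_le _ _).trans ?_
    have h := norm_nome u
    rw [nome] at h
    rw [h, norm_one]
    have : Real.exp (-2 * π * u.im) ≤ 1 := Real.exp_le_one_iff.2 (by rw [him]; nlinarith)
    linarith
  have he : ‖cexp (π * I * u)‖ ≤ 1 := by
    rw [Complex.norm_exp, Real.exp_le_one_iff]
    have : (π * I * u : ℂ).re = -(π * u.im) := by simp
    rw [this, him]
    nlinarith
  rw [appell, norm_mul, hsplit]
  have hmono : ∀ k : ℝ, k ≤ 14 → Real.exp (k * π * τ.im) ≤ Real.exp (14 * π * τ.im) :=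
      fun k hk => by
    rw [Real.exp_le_exp]
    nlinarith [mul_pos hπ hy]
  have hfin : (‖appellTerm u τ (-1)‖ + (‖appellTerm u τ 0‖ +
      B * (Real.exp (3 * π * τ.im) / (1 - Real.exp (-2 * π * y₀))))) * ‖oddTheta u τ‖ ≤
        (C + C + B / (1 - Real.exp (-2 * π * y₀)) * (C * 2)) * Real.exp (14 * π * τ.im) := by
    have e1 := hm1.trans (mul_le_mul_of_nonneg_left (hmono 11 (by norm_num)) hC)
    have e2 := h0.trans (mul_le_mul_of_nonneg_left (hmono 8 (by norm_num)) hC)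
    have e3 : B * (Real.exp (3 * π * τ.im) / (1 - Real.exp (-2 * π * y₀))) * ‖oddTheta u τ‖ ≤
        B / (1 - Real.exp (-2 * π * y₀)) * (C * 2) * Real.exp (14 * π * τ.im) := by
      refine (mul_le_mul_of_nonneg_left hθu (by positivity)).trans ?_
      have e4 : B * (Real.exp (3 * π * τ.im) / (1 - Real.exp (-2 * π * y₀))) *
          (C * Real.exp (8 * π * τ.im) * 2) = B / (1 - Real.exp (-2 * π * y₀)) * (C * 2) *
            (Real.exp (3 * π * τ.im) * Real.exp (8 * π * τ.im)) := by ring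
      rw [e4, ← Real.exp_add]
      refine mul_le_mul_of_nonneg_left ?_ (by positivity)
      have := hmono 11 (by norm_num)
      refine le_trans (le_of_eq ?_) this
      ring_nf
    linarith
  refine le_trans ?_ hfin
  refine mul_le_mul_of_nonneg_right ?_ (norm_nonneg _)
  calc _ ≤ 1 * ‖appellTerm u τ (-1) + (appellTerm u τ 0 +
        ∑' m : ℤ, if m = -1 then 0 else if m = 0 then 0 else appellTerm u τ m)‖ :=
      mul_le_mul_of_nonneg_right he (norm_nonneg _)
    _ ≤ _ := by
      rw [one_mul]
      exact (norm_add_le _ _).trans (add_le_add_right ((norm_add_le _ _).trans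
        (add_le_add_right htail _)) _)

/-! ### Averages over the period torus -/

/-- The average `∫₀¹ ∫₀¹ f(aτ + b) db da` over the period parallelogram. -/
def torusAvg (τ : ℍ) (f : ℂ → ℂ) : ℂ :=
  ∫ a in Set.Ioo (0 : ℝ) 1, ∫ b in Set.Ioo (0 : ℝ) 1, f (a * τ + b)

/-- The elliptic weight `W(u; τ) = |θ(u; τ)|² e^(-2π (Im u)² / Im τ)`. -/
def thetaWeight (u τ : ℂ) : ℝ := ‖oddTheta u τ‖ ^ 2 * Real.exp (-2 * π * u.im ^ 2 / τ.im)

theorem thetaWeight_add_one (u τ : ℂ) : thetaWeight (u + 1) τ = thetaWeight u τ := by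
  simp [thetaWeight, oddTheta_add_one]

/-- The Gaussian in the imaginary part compensates the multiplier of `θ` under the period `τ`. -/
theorem thetaWeight_add_tau (u : ℂ) {τ : ℂ} (hτ : 0 < τ.im) :
    thetaWeight (u + τ) τ = thetaWeight u τ := by
  rw [thetaWeight, thetaWeight, oddTheta_add_tau, norm_mul, norm_neg, mul_pow, Complex.norm_exp,
    ← Real.exp_nat_mul, mul_right_comm, ← Real.exp_add, mul_comm (‖_‖ ^ 2)]
  congr 2
  have h : (-π * I * τ - 2 * π * I * u : ℂ).re = π * τ.im + 2 * π * u.im := by simp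
  rw [h, Complex.add_im]
  field_simp
  push_cast
  ring

theorem thetaWeight_T (u : ℂ) {τ : ℂ} (hτ : 0 < τ.im) :
    thetaWeight u (τ + 1) = thetaWeight u τ := by
  have h : ‖cexp (π * I / 4)‖ = 1 := by
    rw [show (π * I / 4 : ℂ) = ((π / 4 : ℝ) : ℂ) * I by push_cast; ring,
      Complex.norm_exp_ofReal_mul_I]
  simp [thetaWeight, oddTheta_T u τ hτ, h]

/-- Under inversion the weight is multiplied by `|τ|`, which cancels in weighted averages. -/
theorem thetaWeight_S (u : ℂ) {τ : ℂ} (hτ : 0 < τ.im) :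
    thetaWeight (u / τ) (-1 / τ) = ‖τ‖ * thetaWeight u τ := by
  have h0 : τ ≠ 0 := by rintro rfl; simp at hτ
  have hn : Complex.normSq τ ≠ 0 := by simpa using h0
  have h1 : ‖(-I * τ) ^ (1 / 2 : ℂ)‖ ^ 2 = ‖τ‖ := by
    rw [← norm_pow, ← cpow_nat_mul]
    simp
  rw [thetaWeight, thetaWeight, oddTheta_S u τ hτ]
  simp only [norm_mul, mul_pow, h1, norm_neg, norm_I, one_mul]
  rw [Complex.norm_exp, ← Real.exp_nat_mul]
  have h2 : Real.exp ((2 : ℕ) * (π * I * u ^ 2 / τ).re) *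
      Real.exp (-2 * π * (u / τ).im ^ 2 / (-1 / τ).im) =
        Real.exp (-2 * π * u.im ^ 2 / τ.im) := by
    rw [← Real.exp_add]
    congr 1
    have h3 : (π * I * u ^ 2 / τ : ℂ) = ((π : ℝ) : ℂ) * (I * (u ^ 2 / τ)) := by ring
    rw [h3, Complex.re_ofReal_mul, Complex.I_mul_re, Complex.div_im, Complex.div_im,
      Complex.div_im]
    simp only [Complex.neg_im, Complex.neg_re, Complex.one_im, Complex.one_re, pow_two,
      Complex.mul_re, Complex.mul_im, neg_zero, zero_mul, zero_div, zero_sub]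
    field_simp
    rw [Complex.normSq_apply]
    push_cast
    ring
  rw [← h2]
  ring

theorem continuous_thetaWeight {τ : ℂ} (hτ : 0 < τ.im) : Continuous fun u => thetaWeight u τ := by
  have h := (differentiable_oddTheta hτ).continuous
  unfold thetaWeight
  fun_prop

/-- Doubly periodic functions with respect to the lattice `ℤ + ℤτ`. -/
structure IsElliptic (τ : ℍ) (f : ℂ → ℂ) : Prop where
  add_one : ∀ u, f (u + 1) = f u
  add_tau : ∀ u, f (u + τ) = f u

/-- The function on the unit square corresponding to `f` on the period parallelogram. -/
def onSquare (τ : ℍ) (f : ℂ → ℂ) (p : ℝ × ℝ) : ℂ := f (p.1 * τ + p.2)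

/-- Integrability of `f` on the period parallelogram. -/
def IntegrableOnTorus (τ : ℍ) (f : ℂ → ℂ) : Prop :=
  MeasureTheory.Integrable (onSquare τ f)
    ((MeasureTheory.volume.restrict (Set.Ioo (0 : ℝ) 1)).prod
      (MeasureTheory.volume.restrict (Set.Ioo (0 : ℝ) 1)))

theorem setIntegral_Ioo_add_of_periodic {g : ℝ → ℂ} (hg : Function.Periodic g 1) (t : ℝ) :
    ∫ b in Set.Ioo (0 : ℝ) 1, g (b + t) = ∫ b in Set.Ioo (0 : ℝ) 1, g b := by
  rw [← MeasureTheory.integral_Ioc_eq_integral_Ioo, ← MeasureTheory.integral_Ioc_eq_integral_Ioo,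
    ← intervalIntegral.integral_of_le zero_le_one, ← intervalIntegral.integral_of_le zero_le_one,
    intervalIntegral.integral_comp_add_right]
  have h := hg.intervalIntegral_add_eq t 0
  rw [zero_add, add_comm t] at h
  rw [zero_add]
  exact h

theorem setIntegral_Ioo_one_sub (g : ℝ → ℂ) :
    ∫ b in Set.Ioo (0 : ℝ) 1, g (1 - b) = ∫ b in Set.Ioo (0 : ℝ) 1, g b := by
  rw [← MeasureTheory.integral_Ioc_eq_integral_Ioo, ← MeasureTheory.integral_Ioc_eq_integral_Ioo,
    ← intervalIntegral.integral_of_le zero_le_one, ← intervalIntegral.integral_of_le zero_le_one,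
    intervalIntegral.integral_comp_sub_left]
  simp

theorem coe_T_smul (τ : ℍ) : ((ModularGroup.T • τ : ℍ) : ℂ) = τ + 1 := by
  rw [UpperHalfPlane.modular_T_smul]
  simp [add_comm]

theorem coe_S_smul (τ : ℍ) : ((ModularGroup.S • τ : ℍ) : ℂ) = -1 / τ := by
  rw [UpperHalfPlane.modular_S_smul]
  simp [neg_div]

/-- The parallelograms spanned by `1, τ + 1` and by `1, τ` are sheared copies of each other. -/
theorem torusAvg_T {τ : ℍ} {f : ℂ → ℂ} (hf : IsElliptic τ f) :
    torusAvg (ModularGroup.T • τ) f = torusAvg τ f := by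
  rw [torusAvg, torusAvg]
  refine MeasureTheory.integral_congr_ae (Eventually.of_forall fun a => ?_)
  simp only [coe_T_smul]
  have h : Function.Periodic (fun b : ℝ => f (a * τ + b)) 1 := fun b => by
    have := hf.add_one (a * τ + b)
    push_cast
    rw [← this, add_assoc]
  rw [← setIntegral_Ioo_add_of_periodic h a]
  refine MeasureTheory.integral_congr_ae (Eventually.of_forall fun b => ?_)
  push_cast
  congr 1
  ring

/-- The map `u ↦ τu` exchanges the two sides of the period parallelogram, up to the reflection
`a ↦ 1 - a`, so the assertion is Fubini's theorem. -/
theorem torusAvg_S {τ : ℍ} {f : ℂ → ℂ} (hf : IsElliptic τ f) (hi : IntegrableOnTorus τ f) :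
    torusAvg (ModularGroup.S • τ) (fun u => f (τ * u)) = torusAvg τ f := by
  have h0 := ne_zero τ
  have h1 : ∀ a b : ℝ, f (τ * (a * (ModularGroup.S • τ : ℍ) + b)) =
      onSquare τ f (b, 1 - a) := fun a b => by
    rw [onSquare, coe_S_smul, ← hf.add_one]
    congr 1
    push_cast
    field_simp
    ring
  rw [torusAvg]
  simp only [h1]
  rw [setIntegral_Ioo_one_sub fun a => ∫ b in Set.Ioo (0 : ℝ) 1, onSquare τ f (b, a)]
  exact MeasureTheory.integral_integral_swap (f := fun a b => onSquare τ f (b, a)) hi.swap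

theorem torusAvg_const_mul (τ : ℍ) (c : ℂ) (f : ℂ → ℂ) :
    torusAvg τ (fun u => c * f u) = c * torusAvg τ f := by
  simp only [torusAvg, MeasureTheory.integral_const_mul]

theorem torusAvg_add {τ : ℍ} {f g : ℂ → ℂ} (hf : IntegrableOnTorus τ f)
    (hg : IntegrableOnTorus τ g) :
    torusAvg τ (fun u => f u + g u) = torusAvg τ f + torusAvg τ g :=
  MeasureTheory.integral_integral_add (f := fun p => onSquare τ f p) (g := fun p => onSquare τ g p)
    hf hg

theorem torusAvg_congr {τ : ℍ} {f g : ℂ → ℂ}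
    (h : ∀ a ∈ Set.Ioo (0 : ℝ) 1, ∀ b : ℝ, f (a * τ + b) = g (a * τ + b)) :
    torusAvg τ f = torusAvg τ g :=
  MeasureTheory.setIntegral_congr_fun measurableSet_Ioo fun a ha =>
    MeasureTheory.integral_congr_ae (Eventually.of_forall fun b => h a ha b)

theorem notMem_lattice_of_mem_Ioo {τ : ℍ} {a : ℝ} (ha : a ∈ Set.Ioo (0 : ℝ) 1) (b : ℝ) :
    (a * τ + b : ℂ) ∉ (periods τ).lattice := fun h => by
  obtain ⟨m, n, hmn⟩ := mem_periods_lattice.1 h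
  have h1 := congrArg Complex.im hmn
  rw [im_add_mul_coe] at h1
  have h2 : (n : ℝ) = a := by
    have h3 : (n : ℝ) * τ.im = a * τ.im := by simpa using h1
    exact mul_right_cancel₀ τ.im_ne_zero h3
  have h3 : (0 : ℝ) < n := h2 ▸ ha.1
  have h4 : (n : ℝ) < 1 := h2 ▸ ha.2
  have h5 : 0 < n := by exact_mod_cast h3
  have h6 : n < 1 := by exact_mod_cast h4
  omega

/-- A function that is continuous off the lattice and bounded is integrable over the torus. -/
theorem integrableOnTorus_of_bounded {τ : ℍ} {f : ℂ → ℂ}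
    (hf : ContinuousOn f (((periods τ).lattice : Set ℂ)ᶜ)) {B : ℝ}
    (hB : ∀ a ∈ Set.Ioo (0 : ℝ) 1, ∀ b : ℝ, ‖f (a * τ + b)‖ ≤ B) : IntegrableOnTorus τ f := by
  rw [IntegrableOnTorus, MeasureTheory.Measure.prod_restrict]
  have hm : MeasurableSet (Set.Ioo (0 : ℝ) 1 ×ˢ Set.Ioo (0 : ℝ) 1) :=
    measurableSet_Ioo.prod measurableSet_Ioo
  have hfin : MeasureTheory.IsFiniteMeasure (((MeasureTheory.volume : MeasureTheory.Measure ℝ).prod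
      (MeasureTheory.volume : MeasureTheory.Measure ℝ)).restrict
        (Set.Ioo (0 : ℝ) 1 ×ˢ Set.Ioo (0 : ℝ) 1)) := by
    rw [← MeasureTheory.Measure.prod_restrict]
    infer_instance
  have hc : ContinuousOn (onSquare τ f) (Set.Ioo (0 : ℝ) 1 ×ˢ Set.Ioo (0 : ℝ) 1) :=
    hf.comp (f := fun p : ℝ × ℝ => (p.1 * τ + p.2 : ℂ)) (by fun_prop)
      fun p hp => notMem_lattice_of_mem_Ioo hp.1 p.2
  refine MeasureTheory.Integrable.of_bound (hc.aestronglyMeasurable hm) B ?_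
  filter_upwards [MeasureTheory.ae_restrict_mem hm] with p hp
  exact hB p.1 hp.1 p.2

/-- The integral kernel `conj θ(u) e^(-2π (Im u)² / Im τ)`, so that `W = θ * thetaKernel`. -/
def thetaKernel (u τ : ℂ) : ℂ :=
  (starRingEnd ℂ) (oddTheta u τ) * (Real.exp (-2 * π * u.im ^ 2 / τ.im) : ℝ)

theorem oddTheta_mul_thetaKernel (u τ : ℂ) : oddTheta u τ * thetaKernel u τ = thetaWeight u τ := by
  rw [thetaKernel, thetaWeight, ← mul_assoc, Complex.mul_conj, Complex.normSq_eq_norm_sq]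
  push_cast
  ring

theorem norm_thetaKernel_le (u : ℂ) {τ : ℂ} (hτ : 0 < τ.im) :
    ‖thetaKernel u τ‖ ≤ ‖oddTheta u τ‖ := by
  rw [thetaKernel, norm_mul, RCLike.norm_conj, Complex.norm_real, Real.norm_of_nonneg
    (Real.exp_nonneg _)]
  refine mul_le_of_le_one_right (norm_nonneg _) (Real.exp_le_one_iff.2 ?_)
  have := Real.pi_pos
  have h : 0 ≤ 2 * π * u.im ^ 2 / τ.im := by positivity
  rw [neg_mul, neg_mul, neg_div]
  linarith

theorem continuous_thetaKernel {τ : ℂ} (hτ : 0 < τ.im) : Continuous fun u => thetaKernel u τ := by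
  have h := (differentiable_oddTheta hτ).continuous
  unfold thetaKernel
  fun_prop

theorem integrableOnTorus_appell_mul_thetaKernel (τ : ℍ) :
    IntegrableOnTorus τ fun u => appell u τ * thetaKernel u τ := by
  obtain ⟨C, A, -, h⟩ := exists_norm_appell_mul_oddTheta_le τ.im_pos
  refine integrableOnTorus_of_bounded (((differentiableOn_appell τ).continuousOn).mul
    (continuous_thetaKernel τ.2).continuousOn) (B := C * Real.exp (A * τ.im)) fun a ha b => ?_
  rw [norm_mul]
  exact (mul_le_mul_of_nonneg_left (norm_thetaKernel_le _ τ.2) (norm_nonneg _)).trans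
    (h τ le_rfl a ha b)

theorem integrableOnTorus_thetaWeight (τ : ℍ) : IntegrableOnTorus τ fun u => thetaWeight u τ := by
  have hc := continuous_thetaWeight τ.2
  have hf : Continuous (onSquare τ fun u => thetaWeight u τ) := by
    unfold onSquare
    fun_prop
  rw [IntegrableOnTorus, MeasureTheory.Measure.prod_restrict]
  exact (hf.continuousOn.integrableOn_compact (isCompact_Icc.prod isCompact_Icc)).mono_set
    (Set.prod_mono Set.Ioo_subset_Icc_self Set.Ioo_subset_Icc_self)

theorem appellConst_ne_zero (τ : ℍ) : appellConst τ ≠ 0 :=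
  div_ne_zero (inv_ne_zero (neg_ne_zero.2 Complex.two_pi_I_ne_zero)) (thetaNull_ne_zero τ)

/-- The weight vanishes to second order at the pole of `℘`. Here this is deduced from the bound for
`N` times the kernel, since `℘` is a combination of `N/θ` and a constant. -/
theorem integrableOnTorus_weierstrassP_mul_thetaWeight (τ : ℍ) :
    IntegrableOnTorus τ fun u => (periods τ).weierstrassP u * thetaWeight u τ := by
  obtain ⟨M, hM⟩ := exists_appell_eq τ
  have hc := appellConst_ne_zero τ
  have h : IntegrableOnTorus τ fun u => (appellConst τ)⁻¹ *
      (appell u τ * thetaKernel u τ - M * thetaWeight u τ) :=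
    ((integrableOnTorus_appell_mul_thetaKernel τ).sub
      ((integrableOnTorus_thetaWeight τ).const_mul M)).const_mul _
  refine MeasureTheory.Integrable.congr h ?_
  rw [MeasureTheory.Measure.prod_restrict]
  filter_upwards [MeasureTheory.ae_restrict_mem (measurableSet_Ioo.prod measurableSet_Ioo)]
    with p hp
  simp only [onSquare]
  rw [hM _ (notMem_lattice_of_mem_Ioo hp.1 p.2), ← oddTheta_mul_thetaKernel]
  field_simp
  ring

/-! ### Modularity of the averaged Weierstrass function -/

/-- The Weierstrass function is homogeneous of degree `-2` in the argument and the lattice. -/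
theorem weierstrassP_mul {L L' : PeriodPair} {c : ℂ} (hc : c ≠ 0)
    (h : ∀ l, l ∈ L.lattice ↔ c * l ∈ L'.lattice) (z : ℂ) :
    L'.weierstrassP (c * z) = (c ^ 2)⁻¹ * L.weierstrassP z := by
  let e : L.lattice ≃ L'.lattice :=
    { toFun := fun l => ⟨c * l, (h l).1 l.2⟩
      invFun := fun l => ⟨c⁻¹ * l, (h _).2 (by rw [mul_inv_cancel_left₀ hc]; exact l.2)⟩
      left_inv := fun l => Subtype.ext (inv_mul_cancel_left₀ hc _)
      right_inv := fun l => Subtype.ext (mul_inv_cancel_left₀ hc _) }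
  rw [PeriodPair.weierstrassP, ← e.tsum_eq, PeriodPair.weierstrassP, ← tsum_mul_left]
  refine tsum_congr fun l => ?_
  have h1 : ((e l : L'.lattice) : ℂ) = c * l := rfl
  rw [h1, ← mul_sub, mul_pow, mul_pow, one_div, one_div, one_div, one_div, mul_inv, mul_inv]
  ring

theorem coe_SL_smul (γ : SL(2, ℤ)) (τ : ℍ) :
    ((γ • τ : ℍ) : ℂ) = ((γ 0 0 : ℂ) * τ + γ 0 1) / ((γ 1 0 : ℂ) * τ + γ 1 1) := by
  rw [UpperHalfPlane.specialLinearGroup_apply]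
  simp

theorem SL_det_eq (γ : SL(2, ℤ)) : γ 0 0 * γ 1 1 - γ 0 1 * γ 1 0 = 1 := by
  rw [← Matrix.det_fin_two]
  exact γ.2

theorem mem_lattice_smul_iff (γ : SL(2, ℤ)) (τ : ℍ) (l : ℂ) :
    l ∈ (periods τ).lattice ↔ (denom γ τ)⁻¹ * l ∈ (periods (γ • τ)).lattice := by
  have hd := denom_ne_zero γ τ
  have hdet : ((γ 0 0 : ℂ) * γ 1 1 - γ 0 1 * γ 1 0) = 1 := by exact_mod_cast SL_det_eq γ
  rw [mem_periods_lattice, mem_periods_lattice]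
  rw [denom_SL_eq] at hd ⊢
  rw [coe_SL_smul]
  have hd' : (τ : ℂ) * γ 1 0 + γ 1 1 ≠ 0 := by rwa [mul_comm (τ : ℂ)]
  constructor
  · rintro ⟨m, n, rfl⟩
    refine ⟨m * γ 0 0 - n * γ 0 1, n * γ 1 1 - m * γ 1 0, ?_⟩
    field_simp
    push_cast
    linear_combination (m + n * τ : ℂ) * hdet
  · rintro ⟨m, n, h⟩
    refine ⟨m * γ 1 1 + n * γ 0 1, m * γ 1 0 + n * γ 0 0, ?_⟩
    field_simp at h
    push_cast
    linear_combination h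

theorem weierstrassP_smul (γ : SL(2, ℤ)) (τ : ℍ) (u : ℂ) :
    (periods (γ • τ)).weierstrassP ((denom γ τ)⁻¹ * u) =
      denom γ τ ^ 2 * (periods τ).weierstrassP u := by
  rw [weierstrassP_mul (inv_ne_zero (denom_ne_zero γ τ)) (mem_lattice_smul_iff γ τ), inv_pow,
      inv_inv]

/-- The total mass of the elliptic weight. -/
def weightAvg (τ : ℍ) : ℂ := torusAvg τ fun u => thetaWeight u τ

/-- The weighted average of the Weierstrass function over the period torus. -/
def averagedWeierstrassP (τ : ℍ) : ℂ :=
  torusAvg τ (fun u => (periods τ).weierstrassP u * thetaWeight u τ) / weightAvg τ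

theorem isElliptic_thetaWeight (τ : ℍ) : IsElliptic τ fun u => thetaWeight u τ :=
  ⟨fun u => by simp only [thetaWeight_add_one], fun u => by simp only [thetaWeight_add_tau u τ.2]⟩

theorem isElliptic_weierstrassP_mul_thetaWeight (τ : ℍ) :
    IsElliptic τ fun u => (periods τ).weierstrassP u * thetaWeight u τ := by
  constructor
  · intro u
    have h := (periods τ).weierstrassP_add_coe u ⟨1, one_mem_lattice τ⟩
    simp only at h ⊢
    rw [h, thetaWeight_add_one]
  · intro u
    have h := (periods τ).weierstrassP_add_coe u ⟨τ, tau_mem_lattice τ⟩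
    simp only at h ⊢
    rw [h, thetaWeight_add_tau u τ.2]

theorem denom_S (τ : ℍ) : denom ModularGroup.S τ = τ := by
  rw [denom_SL_eq]
  simp [ModularGroup.S]

theorem denom_T (τ : ℍ) : denom ModularGroup.T τ = 1 := by
  rw [denom_SL_eq]
  simp [ModularGroup.T]

theorem averagedWeierstrassP_T (τ : ℍ) :
    averagedWeierstrassP (ModularGroup.T • τ) = averagedWeierstrassP τ := by
  have h1 : ∀ u, (periods (ModularGroup.T • τ)).weierstrassP u = (periods τ).weierstrassP u :=
    fun u => by
      have h := weierstrassP_smul ModularGroup.T τ u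
      rwa [denom_T, inv_one, one_mul, one_pow, one_mul] at h
  simp only [averagedWeierstrassP, weightAvg, h1, coe_T_smul, thetaWeight_T _ τ.2]
  rw [torusAvg_T (isElliptic_weierstrassP_mul_thetaWeight τ), torusAvg_T (isElliptic_thetaWeight τ)]

theorem averagedWeierstrassP_S (τ : ℍ) :
    averagedWeierstrassP (ModularGroup.S • τ) = (τ : ℂ) ^ 2 * averagedWeierstrassP τ := by
  have h0 := ne_zero τ
  have hn : (‖(τ : ℂ)‖ : ℂ) ≠ 0 := by simpa using h0
  have h1 : ∀ u, (periods (ModularGroup.S • τ)).weierstrassP u =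
      (τ : ℂ) ^ 2 * (periods τ).weierstrassP (τ * u) := fun u => by
    have h := weierstrassP_smul ModularGroup.S τ (τ * u)
    rwa [denom_S, inv_mul_cancel_left₀ h0] at h
  have h2 : ∀ u, (thetaWeight u (ModularGroup.S • τ : ℍ) : ℂ) =
      ‖(τ : ℂ)‖ * thetaWeight (τ * u) τ := fun u => by
    have h := thetaWeight_S (τ * u) τ.2
    rw [mul_div_cancel_left₀ _ h0] at h
    rw [coe_S_smul]
    exact_mod_cast h
  have h3 : (fun u => (periods (ModularGroup.S • τ)).weierstrassP u *
      (thetaWeight u (ModularGroup.S • τ : ℍ) : ℂ)) = fun u => ((τ : ℂ) ^ 2 * ‖(τ : ℂ)‖) *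
        ((fun v => (periods τ).weierstrassP v * (thetaWeight v τ : ℂ)) (τ * u)) := by
    funext u
    simp only
    rw [h1, h2]
    ring
  have h4 : (fun u => (thetaWeight u (ModularGroup.S • τ : ℍ) : ℂ)) = fun u => (‖(τ : ℂ)‖ : ℂ) *
        ((fun v => (thetaWeight v τ : ℂ)) (τ * u)) := funext h2
  rw [averagedWeierstrassP, averagedWeierstrassP, weightAvg, weightAvg, h3, h4, torusAvg_const_mul,
    torusAvg_const_mul, torusAvg_S (isElliptic_weierstrassP_mul_thetaWeight τ)
        (integrableOnTorus_weierstrassP_mul_thetaWeight τ),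
    torusAvg_S (isElliptic_thetaWeight τ) (integrableOnTorus_thetaWeight τ)]
  field_simp

/-- The average of `℘` transforms like `℘` itself, with weight `2`. -/
theorem averagedWeierstrassP_smul (γ : SL(2, ℤ)) (τ : ℍ) :
    averagedWeierstrassP (γ • τ) = denom γ τ ^ 2 * averagedWeierstrassP τ := by
  have h := SlashInvariantForm.slash_action_generators_SL2Z (f := averagedWeierstrassP) (k := 2)
    (by
      ext τ
      rw [ModularForm.SL_slash_apply, averagedWeierstrassP_S, denom_S]
      have h0 := ne_zero τ
      rw [zpow_neg]
      field_simp)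
    (by
      ext τ
      rw [ModularForm.SL_slash_apply, averagedWeierstrassP_T, denom_T]
      simp) γ
  have h1 := congrFun h τ
  rw [ModularForm.SL_slash_apply] at h1
  rw [← h1, zpow_neg]
  have h0 := denom_ne_zero γ τ
  have h2 : denom γ τ ^ (2 : ℤ) = denom γ τ ^ 2 := by norm_cast
  rw [h2]
  field_simp

/-! ### Fourier expansion of the torus averages -/

/-- Termwise integration of a product of two normally convergent series over the unit interval. -/
theorem hasSum_setIntegral_mul {f g : ℤ → ℝ → ℂ} {F G : ℝ → ℂ} {α β : ℤ → ℝ}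
    (hF : ∀ b, HasSum (fun m => f m b) (F b)) (hG : ∀ b, HasSum (fun n => g n b) (G b))
    (hf : ∀ m, Continuous (f m)) (hg : ∀ n, Continuous (g n))
    (hα : Summable α) (hβ : Summable β) (hfα : ∀ m b, ‖f m b‖ ≤ α m) (hgβ : ∀ n b, ‖g n b‖ ≤ β n) :
    HasSum (fun p : ℤ × ℤ => ∫ b in Set.Ioo (0 : ℝ) 1, f p.1 b * g p.2 b)
      (∫ b in Set.Ioo (0 : ℝ) 1, F b * G b) := by
  have hα0 : 0 ≤ α := fun m => (norm_nonneg _).trans (hfα m 0)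
  have hβ0 : 0 ≤ β := fun n => (norm_nonneg _).trans (hgβ n 0)
  have hbd : ∀ (p : ℤ × ℤ) b, ‖f p.1 b * g p.2 b‖ ≤ α p.1 * β p.2 := fun p b => by
    rw [norm_mul]
    exact mul_le_mul (hfα _ _) (hgβ _ _) (norm_nonneg _) (hα0 _)
  have hprod : Summable fun p : ℤ × ℤ => α p.1 * β p.2 := hα.mul_of_nonneg hβ hα0 hβ0
  have hint : ∀ p : ℤ × ℤ, MeasureTheory.IntegrableOn (fun b => f p.1 b * g p.2 b)
      (Set.Ioo (0 : ℝ) 1) := fun p =>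
    (((hf p.1).mul (hg p.2)).continuousOn.integrableOn_compact
      isCompact_Icc).mono_set Set.Ioo_subset_Icc_self
  have h := MeasureTheory.hasSum_integral_of_summable_integral_norm
    (μ := MeasureTheory.volume.restrict (Set.Ioo (0 : ℝ) 1)) hint
    (Summable.of_nonneg_of_le (fun p => MeasureTheory.integral_nonneg fun b => norm_nonneg _)
      (fun p => (MeasureTheory.integral_mono (hint p).norm (MeasureTheory.integrable_const _)
        (hbd p)).trans (by simp)) hprod)
  refine HasSum.of_eq h (fun _ => rfl) ?_
  refine MeasureTheory.integral_congr_ae (Eventually.of_forall fun b => ?_)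
  have h1 := tsum_mul_tsum_of_summable_norm
    (Summable.of_nonneg_of_le (fun _ => norm_nonneg _) (fun m => hfα m b) hα)
    (Summable.of_nonneg_of_le (fun _ => norm_nonneg _) (fun n => hgβ n b) hβ)
  simp only
  rw [← h1, (hF b).tsum_eq, (hG b).tsum_eq]

theorem norm_oddThetaTerm (z τ : ℂ) (n : ℤ) : ‖oddThetaTerm z τ n‖ =
    Real.exp (-π * (n + 1 / 2) ^ 2 * τ.im - 2 * π * (n + 1 / 2) * z.im) := by
  rw [oddThetaTerm, Complex.norm_exp]
  have h : (π * I * (n + 1 / 2) ^ 2 * τ + 2 * π * I * (n + 1 / 2) * z + π * I * n : ℂ) =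
      ((π * (n + 1 / 2) ^ 2 : ℝ) : ℂ) * (I * τ) + ((2 * π * (n + 1 / 2) : ℝ) : ℂ) * (I * z) +
        ((π * n : ℝ) : ℂ) * I := by
    push_cast
    ring
  rw [h, Complex.add_re, Complex.add_re, Complex.re_ofReal_mul, Complex.re_ofReal_mul,
    Complex.re_ofReal_mul, Complex.I_mul_re, Complex.I_mul_re, Complex.I_re]
  ring_nf

theorem norm_oddThetaTerm_add_ofReal (z τ : ℂ) (b : ℝ) (n : ℤ) :
    ‖oddThetaTerm (z + b) τ n‖ = ‖oddThetaTerm z τ n‖ := by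
  rw [norm_oddThetaTerm, norm_oddThetaTerm]
  simp

theorem summable_norm_oddThetaTerm (z : ℂ) {τ : ℂ} (hτ : 0 < τ.im) :
    Summable fun n => ‖oddThetaTerm z τ n‖ := (hasSum_oddTheta z hτ).summable.norm

theorem continuous_oddThetaTerm (z τ : ℂ) (n : ℤ) :
    Continuous fun b : ℝ => oddThetaTerm (z + b) τ n := by
  unfold oddThetaTerm
  fun_prop

/-- The factor of `thetaKernel` that is constant on horizontal lines. -/
def kernelFactor (a y : ℝ) : ℝ := Real.exp (-2 * π * a ^ 2 * y)

theorem thetaKernel_eq (τ : ℍ) (a b : ℝ) : thetaKernel (a * τ + b) τ =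
    kernelFactor a τ.im * (starRingEnd ℂ) (oddTheta (a * τ + b) τ) := by
  rw [thetaKernel, kernelFactor, im_add_mul_coe, mul_comm]
  congr 4
  have := τ.im_pos.ne'
  rw [UpperHalfPlane.coe_im]
  field_simp

theorem hasSum_conj_oddTheta (z : ℂ) {τ : ℂ} (hτ : 0 < τ.im) :
    HasSum (fun n => (starRingEnd ℂ) (oddThetaTerm z τ n)) ((starRingEnd ℂ) (oddTheta z τ)) :=
  (Complex.hasSum_conj' ).2 (hasSum_oddTheta z hτ)

/-- The product of the `m`-th term of the Appell–Lerch sum and the `n`-th term of the conjugate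
theta series. -/
def pairTerm (u τ : ℂ) (p : ℤ × ℤ) : ℂ :=
  cexp (π * I * u) * appellTerm u τ p.1 * (starRingEnd ℂ) (oddThetaTerm u τ p.2)

/-- Under a horizontal translation of `τ` and a simultaneous shift of `u` the pairing of the `m`-th
and the `n`-th term is multiplied by a phase that depends on `(n - m + 1/2)²` only. -/
theorem pairTerm_shift (u τ : ℂ) (t : ℝ) (p : ℤ × ℤ) :
    pairTerm (u - p.1 * t) (τ + t) p =
      cexp (-π * I * ((p.2 - p.1 : ℤ) + 1 / 2) ^ 2 * t) * pairTerm u τ p := by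
  obtain ⟨m, n⟩ := p
  have h1 : u - m * t + m * (τ + t) = u + m * τ := by ring
  simp only [pairTerm, appellTerm, jacobiTheta₂_term, oddThetaTerm, h1]
  rw [mul_div, mul_div, div_mul_eq_mul_div, div_mul_eq_mul_div, mul_div]
  congr 1
  rw [← Complex.exp_conj, ← Complex.exp_conj, ← Complex.exp_add, ← Complex.exp_add,
    ← Complex.exp_add, ← Complex.exp_add, ← Complex.exp_add]
  simp only [map_add, map_mul, map_pow, map_sub, Complex.conj_ofReal, Complex.conj_I, map_intCast,
    map_div₀, map_one, map_ofNat]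
  congr 1
  push_cast
  ring

theorem pairTerm_add_one (u τ : ℂ) (p : ℤ × ℤ) : pairTerm (u + 1) τ p = pairTerm u τ p := by
  obtain ⟨m, n⟩ := p
  have h1 : cexp (2 * π * I * (u + 1 + m * τ)) = cexp (2 * π * I * (u + m * τ)) :=
    Complex.exp_eq_exp_iff_exists_int.2 ⟨1, by push_cast; ring⟩
  simp only [pairTerm, appellTerm, jacobiTheta₂_term, oddThetaTerm, h1]
  rw [mul_div, mul_div, div_mul_eq_mul_div, div_mul_eq_mul_div]
  congr 1
  rw [← Complex.exp_conj, ← Complex.exp_conj, ← Complex.exp_add, ← Complex.exp_add,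
    ← Complex.exp_add, ← Complex.exp_add, Complex.exp_eq_exp_iff_exists_int]
  simp only [map_add, map_mul, map_pow, Complex.conj_ofReal, Complex.conj_I, map_intCast,
    map_div₀, map_one, map_ofNat]
  exact ⟨m - n, by push_cast; ring⟩

/-- The coefficient function of the pair `p` on the horizontal line at height `a * Im τ`. -/
def pairCoeff (τ : ℍ) (a : ℝ) (p : ℤ × ℤ) : ℂ :=
  ∫ b in Set.Ioo (0 : ℝ) 1, pairTerm (a * τ + b) τ p

/-- The shift of `u` in `pairTerm_shift` is horizontal, so it does not affect the integral over a
period. -/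
theorem pairCoeff_vadd (τ : ℍ) (a t : ℝ) (p : ℤ × ℤ) : pairCoeff (t +ᵥ τ) a p =
    cexp (-π * I * ((p.2 - p.1 : ℤ) + 1 / 2) ^ 2 * t) * pairCoeff τ a p := by
  have h : Function.Periodic (fun b : ℝ => pairTerm (a * (t +ᵥ τ : ℍ) + b) (t +ᵥ τ : ℍ) p) 1 :=
    fun b => by
      have := pairTerm_add_one (a * (t +ᵥ τ : ℍ) + b) (t +ᵥ τ : ℍ) p
      push_cast
      rw [← this, add_assoc]
  rw [pairCoeff, pairCoeff, ← setIntegral_Ioo_add_of_periodic h (-(a + p.1) * t),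
    ← MeasureTheory.integral_const_mul]
  refine MeasureTheory.integral_congr_ae (Eventually.of_forall fun b => ?_)
  simp only
  rw [← pairTerm_shift, UpperHalfPlane.coe_vadd]
  push_cast
  congr 1 <;> ring

/-- On a horizontal line strictly between the rows of poles the Appell–Lerch series converges
normally. -/
theorem hasSum_pairCoeff (τ : ℍ) {a : ℝ} (ha : a ∈ Set.Ioo (0 : ℝ) 1) :
    HasSum (pairCoeff τ a) (∫ b in Set.Ioo (0 : ℝ) 1,
      appell (a * τ + b) τ * (starRingEnd ℂ) (oddTheta (a * τ + b) τ)) := by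
  have hy := τ.im_pos
  have hπ := Real.pi_pos
  set δ : ℝ := min a (1 - a) * τ.im with hδ
  have hδ0 : 0 < δ := mul_pos (lt_min ha.1 (by linarith [ha.2])) hy
  have hm : ∀ (m : ℤ) (b : ℝ), δ ≤ |((a * τ + b : ℂ) + m * τ).im| := fun m b => by
    have h1 : ((a * τ + b : ℂ) + m * τ).im = (a + m) * τ.im := by
      rw [Complex.add_im, im_add_mul_coe]
      simp
      ring
    rw [h1, abs_mul, abs_of_pos hy]
    refine mul_le_mul_of_nonneg_right ?_ hy.le
    rcases le_or_gt 0 m with h | h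
    · have : (0 : ℝ) ≤ m := by exact_mod_cast h
      exact (min_le_left _ _).trans ((by linarith : a ≤ a + m).trans (le_abs_self _))
    · have : (m : ℝ) ≤ -1 := by exact_mod_cast Int.le_sub_one_of_lt h
      exact (min_le_right _ _).trans ((by linarith : 1 - a ≤ -(a + m)).trans (neg_le_abs _))
  have hS : ∀ b : ℝ, |((a * τ + b : ℂ) + 1 / 2 + τ / 2).im| ≤ 2 * τ.im := fun b => by
    have h1 : ((a * τ + b : ℂ) + 1 / 2 + τ / 2).im = (a + 1 / 2) * τ.im := by
      rw [Complex.add_im, Complex.add_im, im_add_mul_coe]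
      simp
      ring
    rw [h1, abs_of_pos (mul_pos (by linarith [ha.1]) hy)]
    nlinarith [ha.2]
  refine hasSum_setIntegral_mul (f := fun m b => cexp (π * I * (a * τ + b)) *
    appellTerm (a * τ + b) τ m) (g := fun n b => (starRingEnd ℂ) (oddThetaTerm (a * τ + b) τ n))
    (α := fun m => ‖cexp (π * I * (a * τ))‖ *
      (appellBound (2 * τ.im) τ.im m / (1 - Real.exp (-2 * π * δ))))
    (β := fun n => ‖oddThetaTerm (a * τ) τ n‖)
    (fun b => (summable_appellTerm _ τ).hasSum.mul_left _)
    (fun b => hasSum_conj_oddTheta _ τ.2) (fun m => ?_) (fun n => ?_)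
    (((summable_appellBound _ hy).div_const _).mul_left _) (summable_norm_oddThetaTerm _ τ.2)
    (fun m b => ?_) (fun n b => ?_)
  · have h1 : ∀ b : ℝ, 1 - cexp (2 * π * I * (a * τ + b + m * τ)) ≠ 0 := fun b =>
      sub_ne_zero.2 (exp_ne_one_of_notMem_lattice (notMem_lattice_of_mem_Ioo ha b) m).symm
    unfold appellTerm jacobiTheta₂_term
    exact Continuous.mul (by fun_prop) (Continuous.div (by fun_prop) (by fun_prop) h1)
  · exact Complex.continuous_conj.comp (continuous_oddThetaTerm _ _ n)
  · rw [norm_mul]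
    refine mul_le_mul (le_of_eq ?_) (norm_appellTerm_le hy (hS b) le_rfl hδ0 (hm m b))
      (norm_nonneg _) (norm_nonneg _)
    rw [Complex.norm_exp, Complex.norm_exp]
    simp
  · rw [RCLike.norm_conj, norm_oddThetaTerm_add_ofReal]

/-- The numerator of the non-holomorphic part. -/
def appellAvg (τ : ℍ) : ℂ := torusAvg τ fun u => appell u τ * thetaKernel u τ

theorem appellAvg_eq (τ : ℍ) : appellAvg τ =
    ∫ a in Set.Ioo (0 : ℝ) 1, kernelFactor a τ.im * ∑' p, pairCoeff τ a p := by
  refine MeasureTheory.setIntegral_congr_fun measurableSet_Ioo fun a ha => ?_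
  simp only [thetaKernel_eq, mul_left_comm _ (kernelFactor a τ.im : ℂ)]
  rw [MeasureTheory.integral_const_mul, (hasSum_pairCoeff τ ha).tsum_eq]

theorem integrableOn_pairCoeff (τ : ℍ) : MeasureTheory.IntegrableOn
    (fun a : ℝ => kernelFactor a τ.im * ∑' p, pairCoeff τ a p) (Set.Ioo (0 : ℝ) 1) := by
  refine MeasureTheory.Integrable.congr
    (integrableOnTorus_appell_mul_thetaKernel τ).integral_prod_left ?_
  filter_upwards [MeasureTheory.ae_restrict_mem measurableSet_Ioo] with a ha
  simp only [onSquare, thetaKernel_eq, mul_left_comm _ (kernelFactor a τ.im : ℂ)]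
  rw [MeasureTheory.integral_const_mul, (hasSum_pairCoeff τ ha).tsum_eq]

/-- The averages of the Appell–Lerch sum involve the real part of `τ` only through the characters
`e^(-πi(k+1/2)² Re τ)`, so they are annihilated by every sieve that annihilates these. -/
theorem sum_appellAvg_vadd_eq_zero {ι : Type*} (s : Finset ι) (χ : ι → ℂ) (t : ι → ℝ)
    (h : ∀ k : ℤ, ∑ j ∈ s, χ j * cexp (-π * I * (k + 1 / 2) ^ 2 * t j) = 0) (τ : ℍ) :
    ∑ j ∈ s, χ j * appellAvg (t j +ᵥ τ) = 0 := by
  simp only [appellAvg_eq, ← MeasureTheory.integral_const_mul]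
  rw [← MeasureTheory.integral_finsetSum s
    fun j _ => (integrableOn_pairCoeff (t j +ᵥ τ)).const_mul (χ j)]
  refine MeasureTheory.setIntegral_eq_zero_of_forall_eq_zero fun a ha => ?_
  have h1 : ∀ j, χ j * (kernelFactor a (t j +ᵥ τ).im * ∑' p, pairCoeff (t j +ᵥ τ) a p) =
      kernelFactor a τ.im * ∑' p : ℤ × ℤ,
        χ j * cexp (-π * I * ((p.2 - p.1 : ℤ) + 1 / 2) ^ 2 * t j) * pairCoeff τ a p := fun j => by
    rw [UpperHalfPlane.vadd_im, mul_left_comm, ← tsum_mul_left]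
    congr 2
    funext p
    rw [pairCoeff_vadd]
    exact (mul_assoc _ _ _).symm
  simp only [h1]
  have h2 : ∀ j ∈ s, Summable fun p : ℤ × ℤ =>
      χ j * cexp (-π * I * ((p.2 - p.1 : ℤ) + 1 / 2) ^ 2 * t j) * pairCoeff τ a p := fun j _ => by
    refine ((hasSum_pairCoeff (t j +ᵥ τ) ha).summable.mul_left (χ j)).congr fun p => ?_
    rw [pairCoeff_vadd]
    exact (mul_assoc _ _ _).symm
  rw [← Finset.mul_sum, ← Summable.tsum_finsetSum h2]
  simp only [← Finset.sum_mul, h, zero_mul, tsum_zero, mul_zero]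

/-! ### The total mass of the weight -/

theorem setIntegral_exp_int_mul {k : ℤ} (hk : k ≠ 0) :
    ∫ b in Set.Ioo (0 : ℝ) 1, cexp (2 * π * I * k * b) = 0 := by
  have hc : (2 * π * I * k : ℂ) ≠ 0 := mul_ne_zero Complex.two_pi_I_ne_zero (by exact_mod_cast hk)
  rw [← MeasureTheory.integral_Ioc_eq_integral_Ioo, ← intervalIntegral.integral_of_le zero_le_one,
    integral_exp_mul_complex hc]
  have h : cexp (2 * π * I * k) = 1 := Complex.exp_eq_one_iff.2 ⟨k, by ring⟩
  simp [h]

/-- The terms of the theta series are orthogonal on every horizontal line. -/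
theorem setIntegral_oddThetaTerm_mul_conj (τ : ℍ) (a : ℝ) (p : ℤ × ℤ) :
    ∫ b in Set.Ioo (0 : ℝ) 1, oddThetaTerm (a * τ + b) τ p.1 *
      (starRingEnd ℂ) (oddThetaTerm (a * τ + b) τ p.2) =
        if p.1 = p.2 then ((‖oddThetaTerm (a * τ) τ p.1‖ ^ 2 : ℝ) : ℂ) else 0 := by
  obtain ⟨m, n⟩ := p
  simp only
  split_ifs with h
  · subst h
    simp [Complex.mul_conj, Complex.normSq_eq_norm_sq, norm_oddThetaTerm_add_ofReal]
  · have h1 : ∀ b : ℝ, oddThetaTerm (a * τ + b) τ m *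
        (starRingEnd ℂ) (oddThetaTerm (a * τ + b) τ n) = oddThetaTerm (a * τ) τ m *
          (starRingEnd ℂ) (oddThetaTerm (a * τ) τ n) * cexp (2 * π * I * (m - n : ℤ) * b) :=
      fun b => by
        simp only [oddThetaTerm]
        rw [← Complex.exp_conj, ← Complex.exp_conj, ← Complex.exp_add, ← Complex.exp_add,
          ← Complex.exp_add]
        simp only [map_add, map_mul, map_pow, Complex.conj_ofReal, Complex.conj_I,
          map_intCast, map_div₀, map_one, map_ofNat]
        congr 1
        push_cast
        ring
    simp only [h1]
    rw [MeasureTheory.integral_const_mul, setIntegral_exp_int_mul (sub_ne_zero.2 h), mul_zero]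

theorem kernelFactor_mul_norm_sq (τ : ℍ) (a : ℝ) (n : ℤ) :
    kernelFactor a τ.im * ‖oddThetaTerm (a * τ) τ n‖ ^ 2 =
      Real.exp (-2 * π * τ.im * (n + 1 / 2 + a) ^ 2) := by
  rw [norm_oddThetaTerm, kernelFactor, ← Real.exp_nat_mul, ← Real.exp_add]
  congr 1
  simp
  ring

/-- The mean of the weight on a horizontal line, as a sum of Gaussians. -/
def gaussianSum (a y : ℝ) : ℝ := ∑' n : ℤ, Real.exp (-2 * π * y * (n + 1 / 2 + a) ^ 2)

theorem summable_gaussianSum (τ : ℍ) (a : ℝ) :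
    Summable fun n : ℤ => Real.exp (-2 * π * τ.im * (n + 1 / 2 + a) ^ 2) := by
  simp only [← kernelFactor_mul_norm_sq]
  refine Summable.mul_left _ (Summable.of_nonneg_of_le (fun _ => by positivity) (fun n => ?_)
    (summable_norm_oddThetaTerm (a * τ) τ.2 |>.mul_left (∑' n, ‖oddThetaTerm (a * τ) τ n‖)))
  rw [sq]
  exact mul_le_mul_of_nonneg_right ((summable_norm_oddThetaTerm (a * τ) τ.2).le_tsum n
    fun _ _ => norm_nonneg _) (norm_nonneg _)

theorem setIntegral_thetaWeight (τ : ℍ) (a : ℝ) :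
    ∫ b in Set.Ioo (0 : ℝ) 1, (thetaWeight (a * τ + b) τ : ℂ) = gaussianSum a τ.im := by
  have h1 := hasSum_setIntegral_mul (f := fun m b => oddThetaTerm (a * τ + b) τ m)
    (g := fun n b => (starRingEnd ℂ) (oddThetaTerm (a * τ + b) τ n))
    (α := fun n => ‖oddThetaTerm (a * τ) τ n‖) (β := fun n => ‖oddThetaTerm (a * τ) τ n‖)
    (fun b => hasSum_oddTheta (a * τ + b) τ.2)
    (fun b => hasSum_conj_oddTheta (a * τ + b) τ.2) (continuous_oddThetaTerm _ _)
    (fun n => Complex.continuous_conj.comp (continuous_oddThetaTerm _ _ n))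
    (summable_norm_oddThetaTerm _ τ.2) (summable_norm_oddThetaTerm _ τ.2)
    (fun n b => (norm_oddThetaTerm_add_ofReal _ _ b n).le)
    (fun n b => by rw [RCLike.norm_conj, norm_oddThetaTerm_add_ofReal])
  simp only [setIntegral_oddThetaTerm_mul_conj] at h1
  have h2 : Function.Injective fun n : ℤ => (n, n) := fun a b h => (Prod.mk.inj h).1
  have h3 := h2.tsum_eq (f := fun p : ℤ × ℤ =>
    if p.1 = p.2 then ((‖oddThetaTerm (a * τ) τ p.1‖ ^ 2 : ℝ) : ℂ) else 0) (by
      intro p hp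
      rw [Function.mem_support] at hp
      by_cases h : p.1 = p.2
      · exact ⟨p.1, Prod.ext rfl h⟩
      · simp [h] at hp)
  simp only [if_true] at h3
  simp only [← oddTheta_mul_thetaKernel, thetaKernel_eq, mul_left_comm _ (kernelFactor a τ.im : ℂ)]
  rw [MeasureTheory.integral_const_mul, ← h1.tsum_eq, ← h3, gaussianSum, Complex.ofReal_tsum,
    ← tsum_mul_left]
  refine tsum_congr fun n => ?_
  rw [← kernelFactor_mul_norm_sq]
  push_cast
  rfl

theorem weightAvg_eq (τ : ℍ) :
    weightAvg τ = ((∫ a in Set.Ioo (0 : ℝ) 1, gaussianSum a τ.im : ℝ) : ℂ) := by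
  rw [weightAvg, torusAvg, ← integral_complex_ofReal]
  exact MeasureTheory.integral_congr_ae (Eventually.of_forall fun a => setIntegral_thetaWeight τ a)

/-- By orthogonality the mass of the weight depends on `Im τ` only. -/
theorem weightAvg_vadd (t : ℝ) (τ : ℍ) : weightAvg (t +ᵥ τ) = weightAvg τ := by
  rw [weightAvg_eq, weightAvg_eq, UpperHalfPlane.vadd_im]

/-- The Gaussian with `n = -1` alone has mean at least `e^(-πy)`, since `|a - 1/2| ≤ 1/2` for
`0 < a < 1`. -/
theorem exp_le_norm_weightAvg (τ : ℍ) : Real.exp (-(π * τ.im)) ≤ ‖weightAvg τ‖ := by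
  have hi : MeasureTheory.IntegrableOn (fun a => gaussianSum a τ.im) (Set.Ioo (0 : ℝ) 1) := by
    have h := (integrableOnTorus_thetaWeight τ).integral_prod_left
    simp only [onSquare, setIntegral_thetaWeight] at h
    exact h.re
  have h1 : ∀ a ∈ Set.Ioo (0 : ℝ) 1, Real.exp (-(π * τ.im)) ≤ gaussianSum a τ.im := fun a ha => by
    refine le_trans ?_ ((summable_gaussianSum τ a).le_tsum (-1) fun _ _ => Real.exp_nonneg _)
    rw [Real.exp_le_exp]
    have h2 : ((-1 : ℤ) + 1 / 2 + a : ℝ) ^ 2 ≤ 1 / 2 := by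
      push_cast
      nlinarith [ha.1, ha.2]
    have h3 : 0 < π * τ.im := mul_pos Real.pi_pos τ.im_pos
    nlinarith
  have h2 : Real.exp (-(π * τ.im)) ≤ ∫ a in Set.Ioo (0 : ℝ) 1, gaussianSum a τ.im := by
    have h := MeasureTheory.setIntegral_mono_on (f := fun _ => Real.exp (-(π * τ.im)))
      (by simp) hi measurableSet_Ioo h1
    simpa using h
  rw [weightAvg_eq, Complex.norm_real]
  exact h2.trans (le_abs_self _)

theorem weightAvg_ne_zero (τ : ℍ) : weightAvg τ ≠ 0 :=
  norm_pos_iff.1 ((Real.exp_pos _).trans_le (exp_le_norm_weightAvg τ))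

/-! ### Decomposition of the Appell–Lerch quotient -/

/-- The non-holomorphic part of the quotient `N(u)/θ(u)`; it does not depend on `u`. -/
def nonholPart (τ : ℍ) : ℂ := appellAvg τ / weightAvg τ

/-- The modular completion of `N(u)/θ(u)`. -/
def completion (u : ℂ) (τ : ℍ) : ℂ :=
  appellConst τ * ((periods τ).weierstrassP u - averagedWeierstrassP τ)

/-- Averaging `N = (c℘ + M)θ` against the kernel expresses the unknown constant `M` by the averages
of `N` and of `℘`. -/
theorem appell_eq_mul_oddTheta {τ : ℍ} {u : ℂ} (hu : u ∉ (periods τ).lattice) :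
    appell u τ = (completion u τ + nonholPart τ) * oddTheta u τ := by
  obtain ⟨M, hM⟩ := exists_appell_eq τ
  have hw := weightAvg_ne_zero τ
  have h1 : appellAvg τ = appellConst τ *
      torusAvg τ (fun u => (periods τ).weierstrassP u * thetaWeight u τ) + M * weightAvg τ := by
    rw [weightAvg, ← torusAvg_const_mul, ← torusAvg_const_mul,
      ← torusAvg_add (f := fun u => appellConst τ * ((periods τ).weierstrassP u * thetaWeight u τ))
        (g := fun u => M * thetaWeight u τ)
        ((integrableOnTorus_weierstrassP_mul_thetaWeight τ).const_mul _)
        ((integrableOnTorus_thetaWeight τ).const_mul _)]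
    refine torusAvg_congr fun a ha b => ?_
    rw [hM _ (notMem_lattice_of_mem_Ioo ha b), ← oddTheta_mul_thetaKernel]
    ring
  have h2 : nonholPart τ = appellConst τ * averagedWeierstrassP τ + M := by
    rw [nonholPart, h1, averagedWeierstrassP]
    field_simp
  rw [hM u hu, h2, completion]
  ring

/-! ### Gauss' product for the triangular number series -/

/-- A finite form of Gauss' identity, for the partial products `R n` of
`∏ (1 - x^(2k+1)) / (1 - x^(2k+2))`. -/
theorem finite_gauss_identity {x : ℂ} {R : ℕ → ℂ}
    (hR : ∀ n, R (n + 1) * (1 - x ^ (2 * n + 2)) = R n * (1 - x ^ (2 * n + 1)))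
    (hx : ∀ n : ℕ, 1 - x ^ (2 * n + 2) ≠ 0) (n : ℕ) :
    R n * ∑ s ∈ Finset.range (2 * n), x ^ (s * (s + 1) / 2) =
      ∑ s ∈ Finset.range n, R s * x ^ (s * (2 * n + 1)) := by
  induction n with
  | zero => simp
  | succ n ih =>
    refine mul_left_cancel₀ (hx n) ?_
    -- Abel summation
    have h1 : ∀ m, (1 - x ^ (2 * n + 2)) * ∑ s ∈ Finset.range m, R s * x ^ (s * (2 * n + 3)) =
        (1 - x ^ (2 * n + 1)) * (∑ s ∈ Finset.range m, R s * x ^ (s * (2 * n + 1))) +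
          R m * x ^ (m * (2 * n + 1)) * (1 - x ^ (2 * m)) := fun m => by
      induction m with
      | zero => simp
      | succ m ihm =>
        rw [Finset.sum_range_succ, Finset.sum_range_succ, mul_add, ihm]
        have := hR m
        have e1 : x ^ (m * (2 * n + 3)) = x ^ (m * (2 * n + 1)) * x ^ (2 * m) := by
          rw [← pow_add]; ring_nf
        have e2 : x ^ ((m + 1) * (2 * n + 1)) = x ^ (m * (2 * n + 1)) * x ^ (2 * n + 1) := by
          rw [← pow_add]; ring_nf
        have e3 : x ^ (2 * (m + 1)) = x ^ (2 * m + 2) := by ring_nf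
        rw [e1, e2, e3]
        have e4 : x ^ (2 * n + 2) = x * x ^ (2 * n + 1) := by ring
        have e5 : x ^ (2 * m + 1) = x * x ^ (2 * m) := by ring
        rw [e5] at this
        rw [e4]
        linear_combination (-x ^ (m * (2 * n + 1)) * x ^ (2 * n + 1)) * this
    have h2 : 2 * (n + 1) + 1 = 2 * n + 3 := by ring
    have h3 : (2 * n) * (2 * n + 1) / 2 = n * (2 * n + 1) := by
      rw [mul_assoc, Nat.mul_div_cancel_left _ two_pos]
    have h4 : (2 * n + 1) * (2 * n + 1 + 1) / 2 = n * (2 * n + 1) + (2 * n + 1) := by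
      rw [show (2 * n + 1) * (2 * n + 1 + 1) = 2 * (n * (2 * n + 1) + (2 * n + 1)) by ring,
        Nat.mul_div_cancel_left _ two_pos]
    rw [h2, Finset.sum_range_succ (n := n), mul_add (1 - _), h1 n, ← ih,
      show 2 * (n + 1) = 2 * n + 1 + 1 by ring, Finset.sum_range_succ, Finset.sum_range_succ, h3,
          h4]
    have e1 : x ^ (n * (2 * n + 3)) = x ^ (n * (2 * n + 1)) * x ^ (2 * n) := by
      rw [← pow_add]; ring_nf
    rw [e1, pow_add x (n * (2 * n + 1))]
    have e2 : x ^ (2 * n + 2) = x ^ 2 * x ^ (2 * n) := by ring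
    have e3 : x ^ (2 * n + 1) = x * x ^ (2 * n) := by ring
    have := hR n
    rw [e2, e3] at this ⊢
    linear_combination (∑ s ∈ Finset.range (2 * n), x ^ (s * (s + 1) / 2) +
      x ^ (n * (2 * n + 1)) + x ^ (n * (2 * n + 1)) * (x * x ^ (2 * n))) * this

theorem one_sub_pow_ne_zero {x : ℂ} (hx : ‖x‖ < 1) {n : ℕ} (hn : n ≠ 0) : 1 - x ^ n ≠ 0 := by
  intro h
  have h1 := congrArg norm (sub_eq_zero.1 h)
  rw [norm_one, norm_pow] at h1
  exact (pow_lt_one₀ (norm_nonneg x) hx hn).ne h1.symm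

/-- A lower bound for the denominators that is uniform in the exponent. -/
theorem one_sub_norm_le_norm_one_sub_pow {x : ℂ} (hx : ‖x‖ ≤ 1) {n : ℕ} (hn : n ≠ 0) :
    1 - ‖x‖ ≤ ‖1 - x ^ n‖ := by
  have h := norm_sub_norm_le (1 : ℂ) (x ^ n)
  rw [norm_one, norm_pow] at h
  have h1 : ‖x‖ ^ n ≤ ‖x‖ := pow_le_of_le_one (norm_nonneg x) hx hn
  linarith

/-- The series `ψ(q) = ∑_{n ≥ 0} q^(n(n+1)/2)`. -/
def triangleSeries (q : ℂ) : ℂ := ∑' n : ℕ, q ^ (n * (n + 1) / 2)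

theorem hasSum_triangleSeries {q : ℂ} (hq : ‖q‖ < 1) :
    HasSum (fun n : ℕ => q ^ (n * (n + 1) / 2)) (triangleSeries q) := by
  have h := summable_mul_pow_of_le (c := fun _ => 1) (fun n => by simp) le_triangle hq
  simp only [one_mul] at h
  exact h.hasSum

theorem differentiableOn_triangleSeries : DifferentiableOn ℂ triangleSeries (Metric.ball 0 1) := by
  have h := differentiableOn_tsum_mul_pow (c := fun _ => 1) (fun n => by simp) le_triangle
  simp only [one_mul] at h
  exact h

/-- The product `∏_{n ≥ 0} (1 - q^(2n+1)) / (1 - q^(2n+2))`. -/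
def gaussProduct (q : ℂ) : ℂ := ∏' n : ℕ, (1 - q ^ (2 * n + 1)) / (1 - q ^ (2 * n + 2))

theorem multipliable_gaussProduct {q : ℂ} (hq : ‖q‖ < 1) :
    Multipliable fun n : ℕ => (1 - q ^ (2 * n + 1)) / (1 - q ^ (2 * n + 2)) := by
  have h1 : Summable fun n : ℕ => (q ^ (2 * n + 2) - q ^ (2 * n + 1)) / (1 - q ^ (2 * n + 2)) := by
    refine Summable.of_norm_bounded ((summable_geometric_of_lt_one (norm_nonneg q) hq).mul_left
      (2 / (1 - ‖q‖))) fun n => ?_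
    have h2 : ∀ m, n ≤ m → ‖q ^ m‖ ≤ ‖q‖ ^ n := fun m hm => by
      rw [norm_pow]
      exact pow_le_pow_of_le_one (norm_nonneg q) hq.le hm
    rw [norm_div, div_mul_eq_mul_div]
    refine div_le_div₀ (by positivity) ?_ (by linarith)
      (one_sub_norm_le_norm_one_sub_pow hq.le (by omega))
    have h3 := norm_sub_le (q ^ (2 * n + 2)) (q ^ (2 * n + 1))
    linarith [h2 (2 * n + 2) (by omega), h2 (2 * n + 1) (by omega)]
  refine (Complex.multipliable_one_add_of_summable h1).congr fun n => ?_
  have := one_sub_pow_ne_zero hq (n := 2 * n + 2) (by omega)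
  field_simp
  ring

/-- Gauss' identity `∏ (1 - q^(2n)) / (1 - q^(2n-1)) = ∑ q^(n(n+1)/2)`, as the limit of the finite
identity: only the term `s = 0` of its right-hand side survives. -/
theorem gaussProduct_mul_triangleSeries {q : ℂ} (hq : ‖q‖ < 1) :
    gaussProduct q * triangleSeries q = 1 := by
  set R : ℕ → ℂ := fun n =>
    ∏ k ∈ Finset.range n, (1 - q ^ (2 * k + 1)) / (1 - q ^ (2 * k + 2)) with hRdef
  have hR : Tendsto R atTop (𝓝 (gaussProduct q)) :=
    (multipliable_gaussProduct hq).tendsto_prod_tprod_nat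
  have hx : ∀ n : ℕ, 1 - q ^ (2 * n + 2) ≠ 0 := fun n => one_sub_pow_ne_zero hq (by omega)
  have hid := finite_gauss_identity (x := q) (R := R) (fun n => by
    rw [hRdef]
    simp only
    rw [Finset.prod_range_succ, mul_assoc, div_mul_cancel₀ _ (hx n)]) hx
  have h1 : Tendsto (fun n => R n * ∑ s ∈ Finset.range (2 * n), q ^ (s * (s + 1) / 2)) atTop
      (𝓝 (gaussProduct q * triangleSeries q)) :=
    hR.mul ((hasSum_triangleSeries hq).tendsto_sum_nat.comp
      (tendsto_id.const_mul_atTop' two_pos))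
  refine tendsto_nhds_unique h1 ?_
  simp only [hid]
  obtain ⟨C, hC⟩ := hR.norm.bddAbove_range
  have hC' : ∀ n, ‖R n‖ ≤ C := fun n => hC ⟨n, rfl⟩
  have hC0 : 0 ≤ C := (norm_nonneg _).trans (hC' 0)
  have h2 : Tendsto (fun n : ℕ => C * (n * ‖q‖ ^ n)) atTop (𝓝 0) := by
    have := (tendsto_self_mul_const_pow_of_lt_one (norm_nonneg q) hq).const_mul C
    rwa [mul_zero] at this
  rw [tendsto_iff_norm_sub_tendsto_zero]
  refine squeeze_zero' (Eventually.of_forall fun _ => norm_nonneg _) ?_ h2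
  filter_upwards [eventually_ge_atTop 1] with n hn
  obtain ⟨m, rfl⟩ : ∃ m, n = m + 1 := ⟨n - 1, by omega⟩
  rw [Finset.sum_range_succ']
  have h3 : R 0 * q ^ (0 * (2 * (m + 1) + 1)) = 1 := by simp [hRdef]
  rw [h3, add_sub_cancel_right]
  refine (norm_sum_le _ _).trans ?_
  have h4 : ∀ s ∈ Finset.range m, ‖R (s + 1) * q ^ ((s + 1) * (2 * (m + 1) + 1))‖ ≤
      C * ‖q‖ ^ (m + 1) := fun s _ => by
    rw [norm_mul, norm_pow]
    exact mul_le_mul (hC' _) (pow_le_pow_of_le_one (norm_nonneg q) hq.le (by nlinarith))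
      (by positivity) hC0
  refine (Finset.sum_le_card_nsmul _ _ _ h4).trans ?_
  rw [Finset.card_range, nsmul_eq_mul]
  have h5 : 0 ≤ C * ‖q‖ ^ (m + 1) := by positivity
  push_cast
  nlinarith

theorem triangleSeries_ne_zero {q : ℂ} (hq : ‖q‖ < 1) : triangleSeries q ≠ 0 :=
  right_ne_zero_of_mul_eq_one (gaussProduct_mul_triangleSeries hq)

/-! ### The theta quotient at the half period `1/2` -/

/-- The analytic function `1/2 + 2 ∑_{n ≥ 1} q^(n(n+1)/2) / (1 + q^n)` on the unit disc. -/
def lambertSeries (q : ℂ) : ℂ :=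
  1 / 2 + 2 * ∑' n : ℕ, q ^ ((n + 1) * (n + 2) / 2) / (1 + q ^ (n + 1))

theorem one_sub_norm_le_norm_one_add_pow {x : ℂ} (hx : ‖x‖ ≤ 1) {n : ℕ} (hn : n ≠ 0) :
    1 - ‖x‖ ≤ ‖1 + x ^ n‖ := by
  have h := norm_sub_le (1 + x ^ n) (x ^ n)
  rw [add_sub_cancel_right, norm_one, norm_pow] at h
  have h1 : ‖x‖ ^ n ≤ ‖x‖ := pow_le_of_le_one (norm_nonneg x) hx hn
  linarith

theorem one_add_pow_ne_zero {x : ℂ} (hx : ‖x‖ < 1) {n : ℕ} (hn : n ≠ 0) : 1 + x ^ n ≠ 0 :=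
  norm_pos_iff.1 ((sub_pos.2 hx).trans_le (one_sub_norm_le_norm_one_add_pow hx.le hn))

theorem norm_lambertSeries_term_le {r : ℝ} (hr : r < 1) {z : ℂ} (hz : ‖z‖ ≤ r) (n : ℕ) :
    ‖z ^ ((n + 1) * (n + 2) / 2) / (1 + z ^ (n + 1))‖ ≤ r ^ n / (1 - r) := by
  have h0 : 0 ≤ r := (norm_nonneg z).trans hz
  rw [norm_div]
  refine div_le_div₀ (by positivity) ?_ (by linarith)
    ((sub_le_sub_left hz 1).trans (one_sub_norm_le_norm_one_add_pow (hz.trans hr.le) (by omega)))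
  rw [norm_pow]
  calc ‖z‖ ^ _ ≤ r ^ _ := pow_le_pow_left₀ (norm_nonneg _) hz _
    _ ≤ r ^ n := pow_le_pow_of_le_one h0 hr.le ((Nat.le_succ n).trans (le_triangle (n + 1)))

theorem differentiableOn_lambertSeries : DifferentiableOn ℂ lambertSeries (Metric.ball 0 1) := by
  intro z hz
  obtain ⟨r, hzr, hr⟩ := exists_between (mem_ball_zero_iff.1 hz)
  have h0 : 0 ≤ r := (norm_nonneg z).trans hzr.le
  have h := differentiableOn_tsum_of_summable_norm
    (F := fun n (z : ℂ) => z ^ ((n + 1) * (n + 2) / 2) / (1 + z ^ (n + 1)))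
    ((summable_geometric_of_lt_one h0 hr).div_const (1 - r))
    (fun n w hw => DifferentiableAt.differentiableWithinAt <| by
      have h2 := one_add_pow_ne_zero ((mem_ball_zero_iff.1 hw).trans hr) n.succ_ne_zero
      fun_prop (disch := exact h2)) Metric.isOpen_ball
    (fun n w hw => norm_lambertSeries_term_le hr (mem_ball_zero_iff.1 hw).le n)
  have h1 := h.differentiableAt (Metric.isOpen_ball.mem_nhds (mem_ball_zero_iff.2 hzr))
  exact ((h1.const_mul 2).const_add (1 / 2)).differentiableWithinAt

theorem nome_zpow (τ : ℂ) (n : ℤ) : nome τ ^ n = cexp (2 * π * I * (n * τ)) := by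
  rw [nome, ← Complex.exp_int_mul]
  ring_nf

theorem appellTerm_half (τ : ℂ) (n : ℤ) :
    appellTerm (1 / 2) τ n = nome τ ^ (n * (n + 1) / 2) / (1 + nome τ ^ n) := by
  have h : 2 * ((n * (n + 1) / 2 : ℤ) : ℂ) = n * (n + 1) := by
    exact_mod_cast Int.mul_ediv_cancel' (Int.even_mul_succ_self n).two_dvd
  rw [appellTerm, jacobiTheta₂_term, nome_zpow, nome_zpow]
  congr 1
  · rw [Complex.exp_eq_exp_iff_exists_int]
    exact ⟨n, by linear_combination (-π * I * τ) * h⟩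
  · rw [mul_add, Complex.exp_add, show (2 * π * I * (1 / 2) : ℂ) = π * I by ring,
      Complex.exp_pi_mul_I]
    ring

/-- The terms `n` and `-n` agree at `u = 1/2`. -/
theorem tsum_appellTerm_half (τ : ℍ) : ∑' n, appellTerm (1 / 2) τ n = lambertSeries (nome τ) := by
  have hs := (summable_appellTerm (1 / 2) τ).hasSum
  have hq := norm_nome_lt_one τ.2
  have hneg : ∀ n : ℤ, appellTerm (1 / 2) τ (-n) = appellTerm (1 / 2) τ n := fun n => by
    have h : -n * (-n + 1) / 2 = n * (n + 1) / 2 - n := by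
      rw [show -n * (-n + 1) = n * (n + 1) + (-n) * 2 by ring,
        Int.add_mul_ediv_right _ _ two_ne_zero]
      ring
    have h0 : nome τ ^ n ≠ 0 := zpow_ne_zero _ (nome_ne_zero τ)
    rw [appellTerm_half, appellTerm_half, h, zpow_sub₀ (nome_ne_zero τ), zpow_neg, div_div]
    congr 1
    field_simp
    ring
  have h1 := hs.nat_add_neg
  simp only [hneg] at h1
  have h0 : appellTerm (1 / 2) τ 0 = 1 / 2 := by
    rw [appellTerm_half]
    norm_num
  have h2 := (hasSum_nat_add_iff' 1).2 h1
  simp only [Finset.sum_range_one, Nat.cast_zero, h0] at h2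
  have h3 : HasSum (fun n : ℕ => 2 * (nome τ ^ ((n + 1) * (n + 2) / 2) / (1 + nome τ ^ (n + 1))))
      (∑' n, appellTerm (1 / 2) τ n + 1 / 2 - (1 / 2 + 1 / 2)) := by
    refine HasSum.of_eq h2 (fun n => ?_) rfl
    have h4 : ((n + 1 : ℕ) : ℤ) * ((n + 1 : ℕ) + 1) / 2 = (((n + 1) * (n + 2) / 2 : ℕ) : ℤ) := by
      push_cast
      ring_nf
    rw [appellTerm_half, h4, zpow_natCast, zpow_natCast]
    ring
  rw [lambertSeries, ← tsum_mul_left, h3.tsum_eq]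
  ring

theorem appell_half (τ : ℍ) : appell (1 / 2) τ = I * lambertSeries (nome τ) := by
  rw [appell, tsum_appellTerm_half, show (π * I * (1 / 2) : ℂ) = π / 2 * I by ring,
    Complex.exp_pi_div_two_mul_I]

theorem oddTheta_half {τ : ℂ} (hτ : 0 < τ.im) :
    oddTheta (1 / 2) τ = 2 * I * cexp (π * I * τ / 4) * triangleSeries (nome τ) := by
  have h1 : ∀ n : ℤ, oddThetaTerm (1 / 2) τ n =
      I * cexp (π * I * (n + 1 / 2) ^ 2 * τ) := fun n => by
    have hI := Complex.exp_pi_div_two_mul_I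
    rw [oddThetaTerm]
    nth_rewrite 4 [← hI]
    rw [← Complex.exp_add, Complex.exp_eq_exp_iff_exists_int]
    exact ⟨n, by ring⟩
  refine (hasSum_oddTheta (1 / 2) hτ).nat_add_neg_add_one.unique ?_
  refine HasSum.of_eq ((hasSum_triangleSeries (norm_nome_lt_one hτ)).mul_left
    (2 * I * cexp (π * I * τ / 4))) (fun n => ?_) rfl
  have h2 : cexp (π * I * τ / 4) * nome τ ^ (n * (n + 1) / 2) =
      cexp (π * I * ((n : ℤ) + 1 / 2) ^ 2 * τ) := by
    rw [nome, ← Complex.exp_nat_mul, ← Complex.exp_add]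
    congr 1
    push_cast
    linear_combination (π * I * τ) * two_mul_triangle n
  have h3 : (((-((n : ℤ) + 1) : ℤ) : ℂ) + 1 / 2) ^ 2 = ((n : ℤ) + 1 / 2) ^ 2 := by
    push_cast
    ring
  rw [h1, h1, h3, ← h2]
  ring

/-- By Gauss' identity the product in the definition of `𝒞` is the reciprocal of the theta value
`θ(1/2)`, up to an elementary factor, and the sum is the Appell–Lerch sum at `u = 1/2`. -/
theorem cesaro_eq (τ : ℍ) :
    cesaro τ = 2 * lambertSeries (nome τ) / triangleSeries (nome τ) := by
  have hq := norm_nome_lt_one τ.2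
  have h := gaussProduct_mul_triangleSeries hq
  have h0 := triangleSeries_ne_zero hq
  rw [cesaro, eq_div_iff h0, ← tsum_appellTerm_half]
  simp only [appellTerm_half]
  change 2 * gaussProduct (nome τ) *
    (∑' n : ℤ, nome τ ^ (n * (n + 1) / 2) / (1 + nome τ ^ n)) * _ = _
  linear_combination (2 * ∑' n : ℤ, nome τ ^ (n * (n + 1) / 2) / (1 + nome τ ^ n)) * h

theorem half_notMem_lattice (τ : ℍ) : (1 / 2 : ℂ) ∉ (periods τ).lattice := fun h => by
  obtain ⟨m, n, hmn⟩ := mem_periods_lattice.1 h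
  have h1 := congrArg Complex.im hmn
  have h2 : n = 0 := by simpa [τ.im_ne_zero] using h1
  subst h2
  have h3 := congrArg Complex.re hmn
  have h4 : (m : ℝ) = 1 / 2 := by simpa using h3
  have h5 : (2 * m : ℝ) = 1 := by linarith
  have h6 : 2 * m = 1 := by exact_mod_cast h5
  omega

/-- The normalised function `q^(-1/8) 𝒞(τ)` as a theta quotient. -/
theorem exp_mul_cesaro (τ : ℍ) :
    cexp (-π * I * τ / 4) * cesaro τ = 4 * (completion (1 / 2) τ + nonholPart τ) := by
  have h := appell_eq_mul_oddTheta (half_notMem_lattice τ)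
  have h0 := triangleSeries_ne_zero (norm_nome_lt_one τ.2)
  have h1 := Complex.exp_ne_zero (π * I * τ / 4)
  rw [appell_half, oddTheta_half τ.2] at h
  rw [cesaro_eq, show (-π * I * τ / 4 : ℂ) = -(π * I * τ / 4) by ring, Complex.exp_neg]
  have h2 : lambertSeries (nome τ) = (completion (1 / 2) τ + nonholPart τ) *
      (2 * cexp (π * I * τ / 4) * triangleSeries (nome τ)) := by
    refine mul_left_cancel₀ Complex.I_ne_zero ?_
    linear_combination h
  rw [h2]
  field_simp
  ring

/-! ### The Fourier expansion of `𝒞` -/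

/-- The function of `q` whose value at `q = e^(2πiτ)` is `𝒞(τ)`. -/
def cesaroDisc (q : ℂ) : ℂ := 2 * lambertSeries q / triangleSeries q

theorem differentiableOn_cesaroDisc : DifferentiableOn ℂ cesaroDisc (Metric.ball 0 1) :=
  (differentiableOn_lambertSeries.const_mul 2).div differentiableOn_triangleSeries
    fun _ hq => triangleSeries_ne_zero (mem_ball_zero_iff.1 hq)

/-- `𝒞` is a holomorphic function of `q` on the unit disc, so it is the sum of its `q`-expansion. -/
theorem hasSum_cesaro (τ : ℍ) : HasSum (fun n : ℕ => cesaroCoeff n * nome τ ^ n) (cesaro τ) := by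
  have hb : ∀ τ : ℍ, nome τ ∈ Metric.ball (0 : ℂ) 1 := fun τ =>
    mem_ball_zero_iff.2 (norm_nome_lt_one τ.2)
  have hd : ∀ τ : ℂ, 0 < τ.im → DifferentiableAt ℂ (fun τ => cesaroDisc (nome τ)) τ :=
      fun τ hτ => by
    refine DifferentiableAt.comp τ (differentiableOn_cesaroDisc.differentiableAt
      (Metric.isOpen_ball.mem_nhds (hb ⟨τ, hτ⟩))) ?_
    unfold nome
    fun_prop
  have hof : ∀ τ : ℂ, 0 < τ.im → cesaro (ofComplex τ) = cesaroDisc (nome τ) := fun τ hτ => by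
    rw [ofComplex_apply_of_im_pos hτ, cesaro_eq]
    rfl
  have hper : Function.Periodic (cesaro ∘ ofComplex) ((1 : ℝ) : ℂ) := fun τ => by
    rw [Function.comp, Function.comp]
    by_cases hτ : 0 < τ.im
    · rw [hof τ hτ, hof _ (by simpa using hτ)]
      congr 1
      rw [nome, nome, Complex.exp_eq_exp_iff_exists_int]
      exact ⟨1, by push_cast; ring⟩
    · rw [ofComplex_apply_of_im_nonpos (not_lt.1 hτ),
        ofComplex_apply_of_im_nonpos (by simpa using hτ)]
  have hhol : MDifferentiable 𝓘(ℂ) 𝓘(ℂ) cesaro := by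
    rw [UpperHalfPlane.mdifferentiable_iff]
    intro τ hτ
    refine DifferentiableAt.differentiableWithinAt ((hd τ hτ).congr_of_eventuallyEq ?_)
    filter_upwards [isOpen_upperHalfPlaneSet.mem_nhds hτ] with w hw
    exact hof w hw
  have hbdd : IsBoundedAtImInfty cesaro := by
    have h1 : Tendsto cesaro atImInfty (𝓝 (cesaroDisc 0)) := by
      have h2 : ContinuousAt cesaroDisc 0 := (differentiableOn_cesaroDisc.differentiableAt
        (Metric.isOpen_ball.mem_nhds (by simp))).continuousAt
      refine (h2.tendsto.comp tendsto_nome_atImInfty).congr fun τ => ?_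
      rw [cesaro_eq]
      rfl
    exact h1.isBigO_one ℝ
  have h := UpperHalfPlane.hasSum_qExpansion one_pos hper hhol hbdd τ
  refine HasSum.of_eq h (fun n => ?_) rfl
  rw [cesaroCoeff, smul_eq_mul, nome, Function.Periodic.qParam]
  congr 3
  simp

/-! ### Finite Fourier analysis -/

/-- The additive character `n ↦ e^(2πin/p)`. -/
def phase (p : ℕ) (n : ℤ) : ℂ := cexp (2 * π * I * n / p)

theorem phase_add (p : ℕ) (m n : ℤ) : phase p (m + n) = phase p m * phase p n := by
  rw [phase, phase, phase, ← Complex.exp_add]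
  push_cast
  ring_nf

theorem phase_nat_mul (p : ℕ) (j : ℕ) (n : ℤ) : phase p (j * n) = phase p n ^ j := by
  rw [phase, phase, ← Complex.exp_nat_mul]
  push_cast
  ring_nf

theorem phase_eq_one_iff {p : ℕ} (hp : p ≠ 0) (n : ℤ) : phase p n = 1 ↔ (p : ℤ) ∣ n := by
  have hp' : (p : ℂ) ≠ 0 := by exact_mod_cast hp
  rw [phase, Complex.exp_eq_one_iff]
  constructor
  · rintro ⟨k, hk⟩
    refine ⟨k, ?_⟩
    rw [mul_comm (k : ℂ), mul_div_assoc, mul_right_inj' Complex.two_pi_I_ne_zero,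
      div_eq_iff hp'] at hk
    have h : (n : ℂ) = ((p * k : ℤ) : ℂ) := by rw [hk]; push_cast; ring
    exact_mod_cast h
  · rintro ⟨k, rfl⟩
    refine ⟨k, ?_⟩
    push_cast
    field_simp

theorem phase_congr {p : ℕ} (hp : p ≠ 0) {m n : ℤ} (h : (p : ℤ) ∣ m - n) :
    phase p m = phase p n := by
  rw [← sub_add_cancel m n, phase_add, (phase_eq_one_iff hp _).2 h, one_mul]

theorem sum_phase {p : ℕ} (hp : p ≠ 0) (n : ℤ) :
    ∑ j ∈ Finset.range p, phase p (j * n) = if (p : ℤ) ∣ n then (p : ℂ) else 0 := by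
  simp only [phase_nat_mul]
  split_ifs with h
  · simp [(phase_eq_one_iff hp n).2 h]
  · have h1 : phase p n ≠ 1 := fun h' => h ((phase_eq_one_iff hp n).1 h')
    rw [geom_sum_eq h1, ← phase_nat_mul, (phase_eq_one_iff hp _).2 (dvd_mul_right _ _), sub_self,
      zero_div]

/-- A function on the residues modulo `p` whose Fourier transform is supported at zero is
constant. -/
theorem eq_of_forall_sum_phase_eq_zero {p : ℕ} (hp : p ≠ 0) {x : ℕ → ℂ}
    (h : ∀ t : ℤ, ¬ (p : ℤ) ∣ t → ∑ j ∈ Finset.range p, x j * phase p (j * t) = 0)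
    {i : ℕ} (hi : i < p) : p * x i = ∑ j ∈ Finset.range p, x j := by
  have h1 : ∀ j ∈ Finset.range p, x j * ∑ t ∈ Finset.range p, phase p (t * ((j : ℤ) - i)) =
      if j = i then p * x i else 0 := fun j hj => by
    rw [sum_phase hp]
    have h2 : (p : ℤ) ∣ (j : ℤ) - i ↔ j = i := by
      constructor
      · intro h3
        have h4 := Int.eq_zero_of_abs_lt_dvd h3 (by
          have := Finset.mem_range.1 hj
          rw [abs_lt]
          omega)
        omega
      · rintro rfl
        simp
    simp only [h2]
    split_ifs with h3
    · rw [h3, mul_comm]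
    · rw [mul_zero]
  have h2 := Finset.sum_congr rfl h1
  rw [Finset.sum_ite_eq' (Finset.range p) i, if_pos (Finset.mem_range.2 hi)] at h2
  rw [← h2]
  simp only [Finset.mul_sum]
  rw [Finset.sum_comm]
  have h3 : ∀ t ∈ Finset.range p, ∑ j ∈ Finset.range p, x j * phase p (t * ((j : ℤ) - i)) =
      phase p (-(t * i)) * ∑ j ∈ Finset.range p, x j * phase p (j * t) := fun t _ => by
    rw [Finset.mul_sum]
    refine Finset.sum_congr rfl fun j _ => ?_
    rw [show (t * ((j : ℤ) - i) : ℤ) = -(t * i) + j * t by ring, phase_add]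
    ring
  rw [Finset.sum_congr rfl h3, Finset.sum_eq_single 0]
  · simp [phase]
  · intro t ht ht0
    rw [h t, mul_zero]
    intro h4
    have h5 := Int.le_of_dvd (by omega) h4
    have := Finset.mem_range.1 ht
    omega
  · intro h0
    exact absurd (Finset.mem_range.2 (by omega)) h0

/-! ### Transformation of the completion -/

theorem etaMultiplier_ne_zero (γ : SL(2, ℤ)) : etaMultiplier γ ≠ 0 := fun h => by
  have h1 := etaQuotient_pow γ UpperHalfPlane.I
  rw [← etaMultiplier, h] at h1
  norm_num at h1

theorem denom_cpow_half_ne_zero (γ : SL(2, ℤ)) (τ : ℍ) : denom γ τ ^ (1 / 2 : ℂ) ≠ 0 := by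
  simp [cpow_eq_zero_iff, denom_ne_zero]

theorem denom_cpow_half_sq (γ : SL(2, ℤ)) (τ : ℍ) : (denom γ τ ^ (1 / 2 : ℂ)) ^ 2 = denom γ τ := by
  rw [← cpow_nat_mul]
  norm_num

theorem eta_smul (γ : SL(2, ℤ)) (τ : ℍ) : ModularForm.eta (γ • τ : ℍ) =
    etaMultiplier γ * denom γ τ ^ (1 / 2 : ℂ) * ModularForm.eta τ := by
  have h1 := denom_cpow_half_ne_zero γ τ
  have h2 : ModularForm.eta τ ≠ 0 := ModularForm.eta_ne_zero τ.2
  rw [etaMultiplier_eq γ τ, etaQuotient]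
  field_simp

theorem thetaNull_smul (γ : SL(2, ℤ)) (τ : ℍ) : thetaNull (γ • τ : ℍ) =
    etaMultiplier γ ^ 3 * (denom γ τ ^ (1 / 2 : ℂ)) ^ 3 * thetaNull τ := by
  obtain ⟨κ, -, h⟩ := exists_thetaNull_eq_mul_eta_pow
  rw [h, h, eta_smul]
  ring

/-- The weights of `c` and `℘` are `-3/2` and `2`, and the multiplier `ν_η⁻³` comes from
`θ'(0) = κη³`. -/
theorem completion_smul (γ : SL(2, ℤ)) (τ : ℍ) (u : ℂ) :
    completion ((denom γ τ)⁻¹ * u) (γ • τ) =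
      etaMultiplier γ ^ (-3 : ℤ) * denom γ τ ^ (1 / 2 : ℂ) * completion u τ := by
  have h1 := denom_cpow_half_ne_zero γ τ
  have h2 := etaMultiplier_ne_zero γ
  have h3 := thetaNull_ne_zero τ
  have h4 : denom γ τ ^ 2 = (denom γ τ ^ (1 / 2 : ℂ)) ^ 4 := by
    rw [← denom_cpow_half_sq, ← pow_mul, denom_cpow_half_sq]
  have h5 : etaMultiplier γ ^ (-3 : ℤ) = (etaMultiplier γ ^ 3)⁻¹ := by
    rw [zpow_neg]
    norm_cast
  rw [completion, completion, weierstrassP_smul, averagedWeierstrassP_smul, appellConst,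
    appellConst, thetaNull_smul, h4, h5]
  field_simp

theorem completion_add_coe (τ : ℍ) (u : ℂ) (l : (periods τ).lattice) :
    completion (u + l) τ = completion u τ := by
  rw [completion, completion, PeriodPair.weierstrassP_add_coe]

/-- The completion at the half period `1/2` transforms under `Γ₀(2)` with weight `1/2` and
multiplier `ν_η⁻³`. -/
theorem completion_half_smul {γ : SL(2, ℤ)} (hγ : 2 ∣ γ 1 0) (τ : ℍ) :
    completion (1 / 2) (γ • τ) =
      etaMultiplier γ ^ (-3 : ℤ) * denom γ τ ^ (1 / 2 : ℂ) * completion (1 / 2) τ := by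
  have hdet := SL_det_eq γ
  obtain ⟨c, hc⟩ := hγ
  have hodd : γ 1 1 % 2 = 1 := by
    rcases Int.emod_two_eq_zero_or_one (γ 1 1) with h | h
    · exfalso
      obtain ⟨d, hd⟩ := Int.dvd_of_emod_eq_zero h
      rw [hc, hd] at hdet
      have : 2 * (γ 0 0 * d - γ 0 1 * c) = 1 := by linear_combination hdet
      omega
    · exact h
  obtain ⟨d, hd⟩ : ∃ d, γ 1 1 = 2 * d + 1 := ⟨γ 1 1 / 2, by omega⟩
  have h0 := denom_ne_zero γ τ
  have h1 := completion_smul γ τ (denom γ τ * (1 / 2))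
  rw [inv_mul_cancel_left₀ h0] at h1
  have hl : (d + c * τ : ℂ) ∈ (periods τ).lattice := mem_periods_lattice.2 ⟨d, c, rfl⟩
  have h2 : denom γ τ * (1 / 2) = 1 / 2 + (⟨_, hl⟩ : (periods τ).lattice) := by
    rw [denom_SL_eq, hc, hd]
    push_cast
    ring
  rw [h1, h2, completion_add_coe]

/-! ### Conjugation by horizontal translations -/

/-- The translation `8j/p` that enters the sieving. -/
def sieveShift (p : ℕ) (j : ℤ) : ℝ := 8 * j / p

/-- Conjugation with the translation by `8j/p` maps `γ` to an integral matrix when `p² ∣ c` and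
`a ≡ d` modulo `p`. -/
theorem exists_translate_conj {p : ℕ} (hp : p ≠ 0) {γ : SL(2, ℤ)} (hc : (p : ℤ) ^ 2 ∣ γ 1 0)
    (hd : (p : ℤ) ∣ γ 1 1 - γ 0 0) (j : ℤ) :
    ∃ γ' : SL(2, ℤ), γ' 1 0 = γ 1 0 ∧ ∀ τ : ℍ,
      γ' • (sieveShift p j +ᵥ τ) = sieveShift p j +ᵥ γ • τ ∧
        denom γ' (sieveShift p j +ᵥ τ : ℍ) = denom γ τ := by
  obtain ⟨c, hc⟩ := hc
  obtain ⟨e, he⟩ := hd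
  have hp' : (p : ℂ) ≠ 0 := by exact_mod_cast hp
  have hdet := SL_det_eq γ
  -- the conjugate of `γ` by the translation, where `γ 1 0 = p² * c` and `γ 1 1 - γ 0 0 = p * e`
  let M : Matrix (Fin 2) (Fin 2) ℤ := !![γ 0 0 + 8 * j * p * c, γ 0 1 + 8 * j * e - 64 * j ^ 2 * c;
    γ 1 0, γ 1 1 - 8 * j * p * c]
  have hM : M.det = 1 := by
    rw [Matrix.det_fin_two_of]
    rw [hc] at hdet ⊢
    linear_combination hdet + 8 * j * p * c * he
  obtain ⟨γ', h00, h01, h10, h11⟩ : ∃ γ' : SL(2, ℤ), γ' 0 0 = γ 0 0 + 8 * j * p * c ∧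
      γ' 0 1 = γ 0 1 + 8 * j * e - 64 * j ^ 2 * c ∧ γ' 1 0 = γ 1 0 ∧
        γ' 1 1 = γ 1 1 - 8 * j * p * c := ⟨⟨M, hM⟩, rfl, rfl, rfl, rfl⟩
  refine ⟨γ', h10, fun τ => ?_⟩
  have hden : denom γ' (sieveShift p j +ᵥ τ : ℍ) = denom γ τ := by
    rw [denom_SL_eq, denom_SL_eq, UpperHalfPlane.coe_vadd, sieveShift, h10, h11, hc]
    push_cast
    field_simp
    ring
  refine ⟨?_, hden⟩
  have h0 := denom_ne_zero γ τ
  rw [UpperHalfPlane.ext_iff, UpperHalfPlane.coe_vadd, coe_SL_smul, coe_SL_smul, ← denom_SL_eq,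
    ← denom_SL_eq, hden, div_eq_iff h0, add_mul, div_mul_cancel₀ _ h0, denom_SL_eq,
    UpperHalfPlane.coe_vadd, sieveShift, h00, h01]
  have he' : (γ 1 1 : ℂ) = γ 0 0 + p * e := by
    rw [← sub_eq_iff_eq_add']
    exact_mod_cast he
  rw [hc, he']
  push_cast
  field_simp
  ring

/-- When `p ∣ c`, the determinant gives `ad ≡ 1`, so `d² ≡ 1` implies `a ≡ d` modulo `p`. -/
theorem dvd_sub_of_sq_sub_one {p : ℕ} {γ : SL(2, ℤ)} (hc : (p : ℤ) ^ 2 ∣ γ 1 0)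
    (hd : (p : ℤ) ∣ γ 1 1 ^ 2 - 1) : (p : ℤ) ∣ γ 1 1 - γ 0 0 := by
  have hdet := SL_det_eq γ
  have hc' : (p : ℤ) ∣ γ 1 0 := (dvd_pow_self _ two_ne_zero).trans hc
  have h : γ 1 1 - γ 0 0 = γ 0 0 * (γ 1 1 ^ 2 - 1) - γ 1 1 * (γ 0 1 * γ 1 0) := by
    linear_combination (-γ 1 1) * hdet
  rw [h]
  exact dvd_sub (hd.mul_left _) ((hc'.mul_left _).mul_left _)

/-! ### The multiplier is constant along the sieve -/

/-- Uniqueness of the `q`-expansion for series in the powers `q^(n(n+1)/2)`. -/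
theorem eq_zero_of_hasSum_triangle {c : ℕ → ℂ}
    (h : ∀ τ : ℍ, HasSum (fun n : ℕ => c n * nome τ ^ (n * (n + 1) / 2)) 0) (n : ℕ) : c n = 0 := by
  have hmono : StrictMono fun n : ℕ => n * (n + 1) / 2 := strictMono_nat_of_lt_succ fun n => by
    have h1 : (n + 1) * (n + 1 + 1) = n * (n + 1) + (n + 1) * 2 := by ring
    rw [h1, Nat.add_mul_div_right _ _ two_pos]
    omega
  have hcusp : cuspFunction 1 (0 : ℍ → ℂ) = 0 := by
    simpa [cuspFunction, Function.Periodic.cuspFunction]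
      using! (tendsto_const_nhds.mono_left nhdsWithin_le_nhds).limUnder_eq
  have h1 : ∀ τ : ℍ, HasSum (fun m => Function.extend (fun n : ℕ => n * (n + 1) / 2) c 0 m •
      Function.Periodic.qParam 1 τ ^ m) ((0 : ℍ → ℂ) τ) := fun τ => by
    refine (hmono.injective.hasSum_iff fun m hm => ?_).1 ?_
    · rw [Function.extend_apply' _ _ _ (by simpa using hm)]
      simp
    · refine HasSum.of_eq (h τ) (fun n => ?_) rfl
      rw [Function.comp, hmono.injective.extend_apply, smul_eq_mul, nome, Function.Periodic.qParam]
      simp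
  have h2 := UpperHalfPlane.qExpansion_coeff_unique (0 : C(ℍ, ℂ)) one_pos
    (by rw [ContinuousMap.coe_zero, hcusp]; exact analyticAt_const) h1 (n * (n + 1) / 2)
  rw [hmono.injective.extend_apply, ContinuousMap.coe_zero, qExpansion_zero] at h2
  simpa using h2

/-- Since `n(n+1)/2 + 1/8 = (2n+1)²/8`, the translation by `8j/p` multiplies the `n`-th term of the
series for `θ'(0)` by the character of `j(2n+1)²`. -/
theorem hasSum_thetaNull_vadd {p : ℕ} (hp : p ≠ 0) (j : ℕ) (τ : ℍ) :
    HasSum (fun n : ℕ => (-1) ^ n * (2 * n + 1) * phase p (j * (2 * n + 1) ^ 2) *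
      nome τ ^ (n * (n + 1) / 2))
      ((2 * π * I * cexp (π * I * τ / 4))⁻¹ * thetaNull (sieveShift p j +ᵥ τ : ℍ)) := by
  have hp' : (p : ℂ) ≠ 0 := by exact_mod_cast hp
  have h0 := Complex.exp_ne_zero (π * I * τ / 4)
  have h1 := Complex.two_pi_I_ne_zero
  have hs := (hasSum_jacobiSeries (norm_nome_lt_one (sieveShift p j +ᵥ τ).2)).mul_left
    (cexp (2 * π * I * j / p))
  refine HasSum.of_eq hs (fun n => ?_) ?_
  · rw [mul_left_comm, mul_assoc _ (phase _ _)]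
    congr 1
    rw [phase, nome, nome, ← Complex.exp_nat_mul, ← Complex.exp_nat_mul, ← Complex.exp_add,
      ← Complex.exp_add, UpperHalfPlane.coe_vadd, sieveShift]
    congr 1
    push_cast
    field_simp
    linear_combination (4 * j : ℂ) * two_mul_triangle n
  · have h2 : cexp (π * I * (sieveShift p j +ᵥ τ : ℍ) / 4) =
        cexp (2 * π * I * j / p) * cexp (π * I * τ / 4) := by
      rw [← Complex.exp_add, UpperHalfPlane.coe_vadd, sieveShift]
      congr 1
      push_cast
      field_simp
      ring
    rw [thetaNull_eq (sieveShift p j +ᵥ τ).2, h2]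
    field_simp

/-- The cube of the `η`-multiplier is unchanged under conjugation with the translations `8j/p`:
since `η³` is a lacunary series supported on squares, sieving it with respect to a non-square gives
zero, and the transformed identity forces the Fourier transform of the multipliers to be supported
at zero. By `hsq` every nonzero residue `t` is an odd square minus a non-square `s`, so every
nonzero frequency is covered. -/
theorem etaMultiplier_pow_eq {p : ℕ} (hp : p ≠ 0)
    (hsq : ∀ t : ℤ, ¬ (p : ℤ) ∣ t → ∃ (n : ℕ) (s : ℤ), (∀ k : ℤ, ¬ (p : ℤ) ∣ k ^ 2 - s) ∧
      (p : ℤ) ∣ (2 * n + 1) ^ 2 - s - t)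
    {γ : SL(2, ℤ)} {γ' : ℕ → SL(2, ℤ)} (hγ' : ∀ j, ∀ τ : ℍ,
      γ' j • (sieveShift p j +ᵥ τ) = sieveShift p j +ᵥ γ • τ ∧
        denom (γ' j) (sieveShift p j +ᵥ τ : ℍ) = denom γ τ) {j : ℕ} (hj : j < p) :
    etaMultiplier (γ' j) ^ 3 = etaMultiplier γ ^ 3 := by
  have hp' : (p : ℂ) ≠ 0 := by exact_mod_cast hp
  have key : ∀ i < p, p * etaMultiplier (γ' i) ^ 3 =
      ∑ j ∈ Finset.range p, etaMultiplier (γ' j) ^ 3 := fun i hi => by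
    refine eq_of_forall_sum_phase_eq_zero (x := fun j => etaMultiplier (γ' j) ^ 3) hp
      (fun t ht => ?_) hi
    obtain ⟨n, s, hs, hn⟩ := hsq t ht
    -- sieving `η³` with respect to `s` gives zero
    have h1 : ∀ τ : ℍ,
        ∑ j ∈ Finset.range p, phase p (-(j * s)) * thetaNull (sieveShift p j +ᵥ τ : ℍ) = 0 := by
      intro τ
      have h2 := hasSum_sum (s := Finset.range p)
        fun j _ => (hasSum_thetaNull_vadd hp j τ).mul_left (phase p (-(j * s)))
      have h3 : ∀ n : ℕ, ∑ j ∈ Finset.range p, phase p (-(j * s)) * ((-1) ^ n * (2 * n + 1) *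
          phase p (j * (2 * n + 1) ^ 2) * nome τ ^ (n * (n + 1) / 2)) = 0 := fun n => by
        have h4 : ∀ j ∈ Finset.range p, phase p (-(j * s)) * ((-1) ^ n * (2 * n + 1) *
            phase p (j * (2 * n + 1) ^ 2) * nome τ ^ (n * (n + 1) / 2)) =
              (-1) ^ n * (2 * n + 1) * nome τ ^ (n * (n + 1) / 2) *
                phase p (j * ((2 * n + 1) ^ 2 - s)) := fun j _ => by
          rw [show (j * ((2 * n + 1) ^ 2 - s) : ℤ) = -(j * s) + j * (2 * n + 1) ^ 2 by ring,
            phase_add]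
          ring
        rw [Finset.sum_congr rfl h4, ← Finset.mul_sum, sum_phase hp, if_neg (hs _), mul_zero]
      simp only [h3] at h2
      have h5 := h2.unique hasSum_zero
      simp only [mul_left_comm (phase _ _), ← Finset.mul_sum] at h5
      exact (mul_eq_zero.1 h5).resolve_left (inv_ne_zero (mul_ne_zero Complex.two_pi_I_ne_zero
        (Complex.exp_ne_zero _)))
    -- the same identity at `γτ`, transformed back to `τ`
    have h2 : ∀ τ : ℍ, ∑ j ∈ Finset.range p, phase p (-(j * s)) * etaMultiplier (γ' j) ^ 3 *
        thetaNull (sieveShift p j +ᵥ τ : ℍ) = 0 := fun τ => by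
      have h3 := h1 (γ • τ)
      have h4 : ∀ j ∈ Finset.range p,
          phase p (-(j * s)) * thetaNull (sieveShift p j +ᵥ γ • τ : ℍ) =
            (denom γ τ ^ (1 / 2 : ℂ)) ^ 3 * (phase p (-(j * s)) * etaMultiplier (γ' j) ^ 3 *
              thetaNull (sieveShift p j +ᵥ τ : ℍ)) := fun j _ => by
        rw [← (hγ' j τ).1, thetaNull_smul, (hγ' j τ).2]
        ring
      rw [Finset.sum_congr rfl h4, ← Finset.mul_sum] at h3
      exact (mul_eq_zero.1 h3).resolve_left (pow_ne_zero _ (denom_cpow_half_ne_zero γ τ))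
    -- the coefficient with index `n` vanishes, and it is the Fourier coefficient at `t`
    have h3 := eq_zero_of_hasSum_triangle (c := fun n => ∑ j ∈ Finset.range p,
      phase p (-(j * s)) * etaMultiplier (γ' j) ^ 3 *
        ((-1) ^ n * (2 * n + 1) * phase p (j * (2 * n + 1) ^ 2))) (fun τ => by
      have h4 := hasSum_sum (s := Finset.range p) fun j _ =>
        (hasSum_thetaNull_vadd hp j τ).mul_left (phase p (-(j * s)) * etaMultiplier (γ' j) ^ 3)
      refine HasSum.of_eq h4 (fun n => ?_) ?_
      · rw [Finset.sum_mul]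
        exact Finset.sum_congr rfl fun j _ => by ring
      · rw [← mul_zero (2 * π * I * cexp (π * I * τ / 4))⁻¹, ← h2 τ, Finset.mul_sum]
        exact Finset.sum_congr rfl fun j _ => by ring) n
    have h4 : ∀ j ∈ Finset.range p, phase p (-(j * s)) * etaMultiplier (γ' j) ^ 3 *
        ((-1) ^ n * (2 * n + 1) * phase p (j * (2 * n + 1) ^ 2)) =
          ((-1) ^ n * (2 * n + 1)) * (etaMultiplier (γ' j) ^ 3 * phase p (j * t)) := fun j _ => by
      have h5 : phase p (j * t) = phase p (-(j * s)) * phase p (j * (2 * n + 1) ^ 2) := by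
        rw [← phase_add]
        refine phase_congr hp ?_
        rw [show (j * t - (-(j * s) + j * (2 * n + 1) ^ 2) : ℤ) =
          -(j * ((2 * n + 1) ^ 2 - s - t)) by ring]
        exact (hn.mul_left _).neg_right
      rw [h5]
      ring
    rw [Finset.sum_congr rfl h4, ← Finset.mul_sum] at h3
    refine (mul_eq_zero.1 h3).resolve_left (mul_ne_zero (by simp) ?_)
    exact_mod_cast (by omega : 2 * n + 1 ≠ 0)
  have h0 : etaMultiplier (γ' 0) = etaMultiplier γ := by
    have h1 : sieveShift p ((0 : ℕ) : ℤ) = 0 := by simp [sieveShift]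
    obtain ⟨h2, h3⟩ := hγ' 0 UpperHalfPlane.I
    rw [h1, zero_vadd, zero_vadd] at h2
    rw [h1, zero_vadd] at h3
    rw [etaMultiplier, etaMultiplier, etaQuotient, etaQuotient, h2, h3]
  rw [← h0]
  refine mul_left_cancel₀ hp' ?_
  rw [key j hj, key 0 (by omega)]

/-! ### The sieved functions -/

/-- The function `q^(-1/8) 𝒞(τ)`. -/
def normalizedCesaro (τ : ℍ) : ℂ := cexp (-π * I * τ / 4) * cesaro τ

theorem hasSum_normalizedCesaro (τ : ℍ) : HasSum
    (fun k : ℕ => cesaroCoeff k * cexp (2 * π * I * τ * ((8 * (k : ℂ) - 1) / 8)))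
    (normalizedCesaro τ) := by
  refine HasSum.of_eq ((hasSum_cesaro τ).mul_left (cexp (-π * I * τ / 4))) (fun k => ?_) rfl
  rw [mul_left_comm, nome, ← Complex.exp_nat_mul, ← Complex.exp_add]
  ring_nf

/-- The part of the completion obtained by sieving with respect to the residue `ρ` modulo `p`. -/
def sievedCompletion (p : ℕ) (ρ : ℤ) (τ : ℍ) : ℂ :=
  ∑ j ∈ Finset.range p, phase p (-(j * ρ)) * completion (1 / 2) (sieveShift p j +ᵥ τ)

/-- Sieving as an average over translations: the translation by `8j/p` multiplies `q^(N/8)` by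
`e^(2πijN/p)`. -/
theorem hasSum_sieve {p : ℕ} (hp : p ≠ 0) (ρ : ℤ) (τ : ℍ) : HasSum
    (fun k : ℕ => (if (p : ℤ) ∣ 8 * k - 1 - ρ then (1 : ℂ) else 0) *
      (cesaroCoeff k * cexp (2 * π * I * τ * ((8 * (k : ℂ) - 1) / 8))))
    ((p : ℂ)⁻¹ * ∑ j ∈ Finset.range p,
      phase p (-(j * ρ)) * normalizedCesaro (sieveShift p j +ᵥ τ)) := by
  have hp' : (p : ℂ) ≠ 0 := by exact_mod_cast hp
  have h1 := (hasSum_sum (s := Finset.range p) fun j _ =>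
    (hasSum_normalizedCesaro (sieveShift p j +ᵥ τ)).mul_left (phase p (-(j * ρ)))).mul_left
      (p : ℂ)⁻¹
  refine HasSum.of_eq h1 (fun k => ?_) rfl
  have h2 : ∀ j ∈ Finset.range p, phase p (-(j * ρ)) * (cesaroCoeff k *
      cexp (2 * π * I * (sieveShift p j +ᵥ τ : ℍ) * ((8 * (k : ℂ) - 1) / 8))) =
        phase p (j * (8 * k - 1 - ρ)) * (cesaroCoeff k *
          cexp (2 * π * I * τ * ((8 * (k : ℂ) - 1) / 8))) := fun j _ => by
    rw [mul_left_comm, mul_left_comm (phase p _)]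
    congr 1
    rw [phase, phase, ← Complex.exp_add, ← Complex.exp_add, UpperHalfPlane.coe_vadd, sieveShift]
    congr 1
    push_cast
    field_simp
    ring
  rw [Finset.sum_congr rfl h2, ← Finset.sum_mul, sum_phase hp, ← mul_assoc]
  congr 1
  split_ifs
  · exact inv_mul_cancel₀ hp'
  · rw [mul_zero]

/-- The non-holomorphic part disappears when `-ρ` is not a square modulo `p`: it consists of
exponents `-(2k+1)²/8`. -/
theorem sum_nonholPart_eq_zero {p : ℕ} (hp : p ≠ 0) {ρ : ℤ}
    (hρ : ∀ k : ℤ, ¬ (p : ℤ) ∣ k ^ 2 + ρ) (τ : ℍ) :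
    ∑ j ∈ Finset.range p, phase p (-(j * ρ)) * nonholPart (sieveShift p j +ᵥ τ) = 0 := by
  have h := sum_appellAvg_vadd_eq_zero (Finset.range p) (fun j => phase p (-(j * ρ)))
    (fun j => sieveShift p j) (fun k => by
      have h1 : ∀ j ∈ Finset.range p, phase p (-(j * ρ)) *
          cexp (-π * I * (k + 1 / 2) ^ 2 * sieveShift p j) =
            phase p (j * (-((2 * k + 1) ^ 2 + ρ))) := fun j _ => by
        rw [phase, phase, ← Complex.exp_add, sieveShift]
        congr 1
        push_cast
        ring
      rw [Finset.sum_congr rfl h1, sum_phase hp, if_neg fun h2 => hρ _ ((dvd_neg).1 h2)]) τ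
  have h2 : ∀ j ∈ Finset.range p, phase p (-(j * ρ)) * nonholPart (sieveShift p j +ᵥ τ) =
      phase p (-(j * ρ)) * appellAvg (sieveShift p j +ᵥ τ) * (weightAvg τ)⁻¹ := fun j _ => by
    rw [nonholPart, weightAvg_vadd, div_eq_mul_inv, mul_assoc]
  rw [Finset.sum_congr rfl h2, ← Finset.sum_mul, h, zero_mul]

theorem sum_normalizedCesaro_eq {p : ℕ} (hp : p ≠ 0) {ρ : ℤ}
    (hρ : ∀ k : ℤ, ¬ (p : ℤ) ∣ k ^ 2 + ρ) (τ : ℍ) :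
    ∑ j ∈ Finset.range p, phase p (-(j * ρ)) * normalizedCesaro (sieveShift p j +ᵥ τ) =
      4 * sievedCompletion p ρ τ := by
  have h := sum_nonholPart_eq_zero hp hρ τ
  have h1 : ∀ j ∈ Finset.range p, phase p (-(j * ρ)) * normalizedCesaro (sieveShift p j +ᵥ τ) =
      4 * (phase p (-(j * ρ)) * completion (1 / 2) (sieveShift p j +ᵥ τ)) +
        4 * (phase p (-(j * ρ)) * nonholPart (sieveShift p j +ᵥ τ)) := fun j _ => by
    rw [normalizedCesaro, exp_mul_cesaro]
    ring
  rw [Finset.sum_congr rfl h1, Finset.sum_add_distrib, ← Finset.mul_sum, ← Finset.mul_sum, h,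
    mul_zero, add_zero, sievedCompletion]

/-- The condition that the residues `R` modulo `m` correspond to the residues `R'` modulo `p` for
the exponents `8k - 1`. -/
def SieveCompatible (m : ℤ) (R : Finset ℤ) (p : ℕ) (R' : Finset ℤ) : Prop :=
  ∀ k : ℕ, (if ∃ r ∈ R, 8 * (k : ℤ) - 1 ≡ r [ZMOD m] then (1 : ℂ) else 0) =
    ∑ ρ ∈ R', if (p : ℤ) ∣ 8 * k - 1 - ρ then (1 : ℂ) else 0

theorem sievedCesaro_eq_normalizedCesaro {m : ℤ} {R : Finset ℤ} {p : ℕ} {R' : Finset ℤ}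
    (hp : p ≠ 0) (hR : SieveCompatible m R p R') (τ : ℍ) : sievedCesaro m R τ =
      ∑ ρ ∈ R', (p : ℂ)⁻¹ * ∑ j ∈ Finset.range p,
        phase p (-(j * ρ)) * normalizedCesaro (sieveShift p j +ᵥ τ) := by
  refine HasSum.tsum_eq (HasSum.of_eq (hasSum_sum fun ρ _ => hasSum_sieve hp ρ τ) (fun k => ?_) rfl)
  rw [← Finset.sum_mul, ← hR k]
  split_ifs
  · rw [one_mul]
  · rw [zero_mul]

theorem sievedCesaro_eq_sievedCompletion {m : ℤ} {R : Finset ℤ} {p : ℕ} {R' : Finset ℤ}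
    (hp : p ≠ 0) (hR : SieveCompatible m R p R')
    (hρ : ∀ ρ ∈ R', ∀ k : ℤ, ¬ (p : ℤ) ∣ k ^ 2 + ρ) (τ : ℍ) :
    sievedCesaro m R τ = ∑ ρ ∈ R', (p : ℂ)⁻¹ * (4 * sievedCompletion p ρ τ) := by
  rw [sievedCesaro_eq_normalizedCesaro hp hR]
  exact Finset.sum_congr rfl fun ρ h => by rw [sum_normalizedCesaro_eq hp (hρ ρ h)]

/-- Holomorphy is read off from the expression by translates of `𝒞`, which, unlike the completion,
is visibly holomorphic. -/
theorem mdifferentiable_sievedCesaro {m : ℤ} {R : Finset ℤ} {p : ℕ} {R' : Finset ℤ}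
    (hp : p ≠ 0) (hR : SieveCompatible m R p R') :
    MDifferentiable 𝓘(ℂ) 𝓘(ℂ) (sievedCesaro m R) := by
  have hG : ∀ (t : ℝ) (z : ℂ), 0 < z.im → DifferentiableAt ℂ
      (fun z => cexp (-π * I * (t + z) / 4) * cesaroDisc (nome (t + z))) z := fun t z hz => by
    have h1 : DifferentiableAt ℂ (fun z => cesaroDisc (nome (t + z))) z := by
      refine DifferentiableAt.comp z (f := fun z => nome (t + z))
          (differentiableOn_cesaroDisc.differentiableAt
        (Metric.isOpen_ball.mem_nhds (mem_ball_zero_iff.2 (norm_nome_lt_one ?_)))) ?_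
      · simpa using hz
      · unfold nome
        fun_prop
    exact DifferentiableAt.fun_mul (by fun_prop) h1
  rw [UpperHalfPlane.mdifferentiable_iff]
  intro z hz
  have h2 : DifferentiableAt ℂ (fun z => ∑ ρ ∈ R', (p : ℂ)⁻¹ * ∑ j ∈ Finset.range p,
      phase p (-(j * ρ)) * (cexp (-π * I * (sieveShift p j + z) / 4) *
        cesaroDisc (nome (sieveShift p j + z)))) z :=
    DifferentiableAt.fun_sum fun ρ _ => DifferentiableAt.const_mul
      (DifferentiableAt.fun_sum fun (j : ℕ) _ => (hG (sieveShift p j) z hz).const_mul _) _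
  refine (h2.congr_of_eventuallyEq ?_).differentiableWithinAt
  filter_upwards [isOpen_upperHalfPlaneSet.mem_nhds hz] with w hw
  have hw' : 0 < w.im := hw
  rw [Function.comp, ofComplex_apply_of_im_pos hw', sievedCesaro_eq_normalizedCesaro hp hR]
  simp only [normalizedCesaro, cesaro_eq, UpperHalfPlane.coe_vadd, cesaroDisc]

/-- Each translate is transformed by the conjugate of `γ`, with the same automorphy factor and the
same cube of the multiplier. -/
theorem sievedCompletion_smul {p : ℕ} (hp : p ≠ 0)
    (hsq : ∀ t : ℤ, ¬ (p : ℤ) ∣ t → ∃ (n : ℕ) (s : ℤ), (∀ k : ℤ, ¬ (p : ℤ) ∣ k ^ 2 - s) ∧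
      (p : ℤ) ∣ (2 * n + 1) ^ 2 - s - t)
    {γ : SL(2, ℤ)} (h2 : 2 ∣ γ 1 0) (hc : (p : ℤ) ^ 2 ∣ γ 1 0) (hd : (p : ℤ) ∣ γ 1 1 ^ 2 - 1)
    (ρ : ℤ) (τ : ℍ) : sievedCompletion p ρ (γ • τ) =
      etaMultiplier γ ^ (-3 : ℤ) * denom γ τ ^ (1 / 2 : ℂ) * sievedCompletion p ρ τ := by
  choose γ' h10 hγ' using fun j : ℕ => exists_translate_conj hp hc (dvd_sub_of_sq_sub_one hc hd) j
  rw [sievedCompletion, sievedCompletion, Finset.mul_sum]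
  refine Finset.sum_congr rfl fun j hj => ?_
  have h3 := etaMultiplier_pow_eq hp hsq hγ' (Finset.mem_range.1 hj)
  have h4 : ∀ z : ℂ, z ^ (-3 : ℤ) = (z ^ 3)⁻¹ := fun z => by
    rw [zpow_neg]
    norm_cast
  rw [← (hγ' j τ).1, completion_half_smul (by rw [h10]; exact h2), (hγ' j τ).2, h4, h4, h3]
  ring

/-! ### Growth at the cusps -/

theorem norm_etaMultiplier (γ : SL(2, ℤ)) : ‖etaMultiplier γ‖ = 1 :=
  norm_eq_one_of_pow_eq_one (etaQuotient_pow γ UpperHalfPlane.I) (by norm_num)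

/-- The numerator is bounded on the whole period parallelogram and the denominator is at least
`e^(-πy)`. -/
theorem exists_norm_nonholPart_le : ∃ C A : ℝ, 0 ≤ C ∧
    ∀ τ : ℍ, 1 / 2 ≤ τ.im → ‖nonholPart τ‖ ≤ C * Real.exp (A * τ.im) := by
  obtain ⟨C, A, hC, h⟩ := exists_norm_appell_mul_oddTheta_le (y₀ := 1 / 2) (by norm_num)
  refine ⟨C, A + π, hC, fun τ hτ => ?_⟩
  have h1 : ‖appellAvg τ‖ ≤ C * Real.exp (A * τ.im) := by
    have h2 : ∀ a ∈ Set.Ioo (0 : ℝ) 1, ‖∫ b in Set.Ioo (0 : ℝ) 1,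
        appell (a * τ + b) τ * thetaKernel (a * τ + b) τ‖ ≤ C * Real.exp (A * τ.im) :=
      fun a ha => by
        have h3 := MeasureTheory.norm_setIntegral_le_of_norm_le_const (μ := MeasureTheory.volume)
          (s := Set.Ioo (0 : ℝ) 1) (f := fun b : ℝ =>
            appell (a * τ + b) τ * thetaKernel (a * τ + b) τ)
          (C := C * Real.exp (A * τ.im)) (by simp) fun b _ => by
            rw [norm_mul]
            exact (mul_le_mul_of_nonneg_left (norm_thetaKernel_le _ τ.2) (norm_nonneg _)).trans
              (h τ hτ a ha b)
        simpa using h3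
    have h3 := MeasureTheory.norm_setIntegral_le_of_norm_le_const (μ := MeasureTheory.volume)
      (s := Set.Ioo (0 : ℝ) 1) (by simp) h2
    simpa [appellAvg, torusAvg] using h3
  rw [nonholPart, norm_div, div_le_iff₀ (norm_pos_iff.2 (weightAvg_ne_zero τ))]
  calc ‖appellAvg τ‖ ≤ C * Real.exp (A * τ.im) := h1
    _ = C * Real.exp ((A + π) * τ.im) * Real.exp (-(π * τ.im)) := by
      rw [mul_assoc, ← Real.exp_add]
      ring_nf
    _ ≤ _ := mul_le_mul_of_nonneg_left (exp_le_norm_weightAvg τ) (by positivity)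

/-- At `u = 1/2` the quotient `N/θ` is `q^(-1/8)𝒞/4`, and `𝒞` is bounded for `|q| ≤ e^(-π)`. -/
theorem exists_norm_completion_half_le : ∃ C A : ℝ, 0 ≤ C ∧
    ∀ τ : ℍ, 1 / 2 ≤ τ.im → ‖completion (1 / 2) τ‖ ≤ C * Real.exp (A * τ.im) := by
  obtain ⟨C, A, hC, h⟩ := exists_norm_nonholPart_le
  have hr : Real.exp (-π) < 1 := Real.exp_lt_one_iff.2 (neg_neg_iff_pos.2 Real.pi_pos)
  obtain ⟨B, hB⟩ := (isCompact_closedBall (0 : ℂ) (Real.exp (-π))).exists_bound_of_continuousOn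
    (differentiableOn_cesaroDisc.continuousOn.mono (Metric.closedBall_subset_ball hr))
  have hB0 : 0 ≤ B := (norm_nonneg _).trans
    (hB 0 (Metric.mem_closedBall_self (Real.exp_nonneg _)))
  refine ⟨B + C, max A π, by positivity, fun τ hτ => ?_⟩
  have hπ := Real.pi_pos
  have h1 := exp_mul_cesaro τ
  have h2 : ‖cexp (-π * I * τ / 4)‖ ≤ Real.exp (max A π * τ.im) := by
    rw [Complex.norm_exp, Real.exp_le_exp]
    have h3 : (-π * I * τ / 4 : ℂ).re = π / 4 * τ.im := by
      rw [show (-π * I * τ / 4 : ℂ) = ((-(π / 4) : ℝ) : ℂ) * (I * τ) by push_cast; ring,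
        Complex.re_ofReal_mul, Complex.I_mul_re, UpperHalfPlane.coe_im]
      ring
    rw [h3]
    exact mul_le_mul_of_nonneg_right ((by linarith : π / 4 ≤ π).trans (le_max_right _ _))
      τ.im_pos.le
  have h3 : ‖cesaro τ‖ ≤ B := by
    rw [cesaro_eq]
    refine hB (nome τ) (mem_closedBall_zero_iff.2 ?_)
    rw [norm_nome, Real.exp_le_exp, UpperHalfPlane.coe_im]
    nlinarith
  have h4 : completion (1 / 2) τ = cexp (-π * I * τ / 4) * cesaro τ / 4 - nonholPart τ := by
    rw [h1]
    ring
  have h5 : Real.exp (A * τ.im) ≤ Real.exp (max A π * τ.im) :=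
    Real.exp_le_exp.2 (mul_le_mul_of_nonneg_right (le_max_left _ _) τ.im_pos.le)
  have h6 := norm_sub_le (cexp (-π * I * τ / 4) * cesaro τ / 4) (nonholPart τ)
  rw [h4]
  have h7 : ‖cexp (-π * I * τ / 4) * cesaro τ / 4‖ ≤ Real.exp (max A π * τ.im) * B := by
    rw [norm_div, norm_mul]
    have h8 := mul_le_mul h2 h3 (norm_nonneg _) (Real.exp_nonneg _)
    have h9 : ‖(4 : ℂ)‖ = 4 := by norm_num
    rw [h9]
    have : 0 ≤ ‖cexp (-π * I * τ / 4)‖ * ‖cesaro τ‖ := by positivity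
    linarith
  nlinarith [h τ hτ, mul_le_mul_of_nonneg_left h5 hC]

theorem half_tau_notMem_lattice (τ : ℍ) : (τ / 2 : ℂ) ∉ (periods τ).lattice := by
  have h := notMem_lattice_of_mem_Ioo (τ := τ) (a := 1 / 2) (by norm_num) 0
  convert h using 2
  push_cast
  ring

/-- Up to an exponential factor of modulus at least one, `θ(τ/2; τ)` is `∑ (-1)^n q^(n²/2)`, which
is close to `1`. -/
theorem norm_oddTheta_half_tau_ge {τ : ℍ} (hτ : 1 / 2 ≤ τ.im) :
    1 / 5 ≤ ‖oddTheta (τ / 2) τ‖ := by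
  have hπ := Real.pi_gt_three
  have h1 : oddTheta (τ / 2) τ = cexp (π * I * τ / 4 + π * I * (τ / 2)) *
      (cexp (-π * I * (τ + 2 * (1 / 2))) * jacobiTheta (τ + 1)) := by
    rw [oddTheta, show (τ / 2 + 1 / 2 + τ / 2 : ℂ) = 1 / 2 + τ by ring, jacobiTheta₂_add_left',
      jacobiTheta, jacobiTheta₂]
    congr 2
    refine tsum_congr fun n => ?_
    rw [jacobiTheta₂_term, Complex.exp_eq_exp_iff_exists_int]
    obtain ⟨k, hk⟩ := Int.even_mul_succ_self n
    refine ⟨n - k, ?_⟩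
    have hk' : (n * (n + 1) : ℂ) = k + k := by exact_mod_cast hk
    push_cast
    linear_combination (-π * I) * hk'
  have h2 := norm_jacobiTheta_sub_one_le (τ := τ + 1) (by simpa using τ.im_pos)
  have h3 : (τ + 1 : ℂ).im = τ.im := by simp
  rw [h3] at h2
  -- `e^(3/2) ≥ 1 + 3/2 + 9/8 = 29/8 ≥ 18/5`
  have h4 : Real.exp (-π * τ.im) ≤ 5 / 18 := by
    have h5 : -π * τ.im ≤ -(3 / 2) := by nlinarith
    have h6 := Real.quadratic_le_exp_of_nonneg (x := 3 / 2) (by norm_num)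
    refine (Real.exp_le_exp.2 h5).trans ?_
    rw [Real.exp_neg]
    refine inv_le_of_inv_le₀ (by norm_num) ?_
    norm_num at h6 ⊢
    linarith
  have h5 : 2 / (1 - Real.exp (-π * τ.im)) * Real.exp (-π * τ.im) ≤ 10 / 13 := by
    rw [div_mul_eq_mul_div, div_le_iff₀ (by linarith)]
    linarith
  have h6 : 3 / 13 ≤ ‖jacobiTheta (τ + 1)‖ := by
    have h7 := norm_sub_norm_le (1 : ℂ) (1 - jacobiTheta (τ + 1))
    rw [sub_sub_cancel, norm_one, norm_sub_rev] at h7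
    linarith
  rw [h1, ← mul_assoc, ← Complex.exp_add, norm_mul, Complex.norm_exp]
  have h7 : (π * I * τ / 4 + π * I * (τ / 2) + -π * I * (τ + 2 * (1 / 2)) : ℂ).re =
      π / 4 * τ.im := by
    rw [show (π * I * τ / 4 + π * I * (τ / 2) + -π * I * (τ + 2 * (1 / 2)) : ℂ) =
      ((-(π / 4) : ℝ) : ℂ) * (I * τ) + ((-π : ℝ) : ℂ) * I by push_cast; ring, Complex.add_re,
      Complex.re_ofReal_mul, Complex.re_ofReal_mul, Complex.I_mul_re, Complex.I_re,
      UpperHalfPlane.coe_im]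
    ring
  rw [h7]
  have h8 : 1 ≤ Real.exp (π / 4 * τ.im) := Real.one_le_exp (by nlinarith [τ.im_pos])
  nlinarith

theorem appellBound_le {y : ℝ} (hy : 1 / 2 ≤ y) (m : ℤ) :
    appellBound y y m ≤ Real.exp (π * y) * appellBound (1 / 2) (1 / 2) m := by
  have hπ := Real.pi_pos
  rw [appellBound, appellBound, ← Real.exp_add, Real.exp_le_exp]
  have h1 : (m : ℝ) ^ 2 = |(m : ℝ)| ^ 2 := (sq_abs _).symm
  have h2 : 0 ≤ π * ((y - 1 / 2) * (|(m : ℝ)| - 1) ^ 2) :=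
    mul_nonneg hπ.le (mul_nonneg (by linarith) (sq_nonneg _))
  rw [Int.cast_abs, h1]
  nlinarith

theorem norm_appell_half_tau_le {τ : ℍ} (hτ : 1 / 2 ≤ τ.im) : ‖appell (τ / 2) τ‖ ≤
    Real.exp (π * τ.im) *
      ((∑' m, appellBound (1 / 2) (1 / 2) m) / (1 - Real.exp (-2 * π * (1 / 4)))) := by
  have hπ := Real.pi_pos
  have hy := τ.im_pos
  have hδ : 0 < 1 - Real.exp (-2 * π * (1 / 4)) := by
    rw [sub_pos, Real.exp_lt_one_iff]
    linarith
  have h1 : ∀ m : ℤ, ‖appellTerm (τ / 2) τ m‖ ≤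
      Real.exp (π * τ.im) *
        (appellBound (1 / 2) (1 / 2) m / (1 - Real.exp (-2 * π * (1 / 4)))) := by
    intro m
    have h2 := norm_appellTerm_le (u := τ / 2) (τ := τ) (S := τ.im) (T := τ.im) (δ := 1 / 4)
      (m := m)
      hy (by
        rw [show (τ / 2 + 1 / 2 + τ / 2 : ℂ) = τ + 1 / 2 by ring]
        simp [abs_of_pos hy]) le_rfl (by norm_num) (by
        have h3 : (τ / 2 + m * τ : ℂ).im = (1 / 2 + m) * τ.im := by
          rw [show (τ / 2 + m * τ : ℂ) = ((1 / 2 + m : ℝ) : ℂ) * τ by push_cast; ring,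
            Complex.im_ofReal_mul, UpperHalfPlane.coe_im]
        rw [h3, abs_mul, abs_of_pos hy]
        have h4 : 1 / 2 ≤ |(1 / 2 + m : ℝ)| := by
          rcases le_or_gt 0 m with h | h
          · have : (0 : ℝ) ≤ m := by exact_mod_cast h
            exact (by linarith : (1 / 2 : ℝ) ≤ 1 / 2 + m).trans (le_abs_self _)
          · have : (m : ℝ) ≤ -1 := by exact_mod_cast Int.le_sub_one_of_lt h
            exact (by linarith : (1 / 2 : ℝ) ≤ -(1 / 2 + m)).trans (neg_le_abs _)
        nlinarith)
    refine h2.trans ?_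
    rw [← mul_div_assoc (Real.exp _)]
    exact div_le_div_of_nonneg_right (appellBound_le hτ m) hδ.le
  have hs := ((summable_appellBound (1 / 2) (T := 1 / 2) (by norm_num)).div_const
    (1 - Real.exp (-2 * π * (1 / 4)))).mul_left (Real.exp (π * τ.im))
  have h2 := tsum_of_norm_bounded hs.hasSum h1
  rw [tsum_mul_left, tsum_div_const] at h2
  have h3 : ‖cexp (π * I * (τ / 2))‖ ≤ 1 := by
    rw [Complex.norm_exp, Real.exp_le_one_iff,
      show (π * I * (τ / 2) : ℂ) = ((π / 2 : ℝ) : ℂ) * (I * τ) by push_cast; ring,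
      Complex.re_ofReal_mul, Complex.I_mul_re, UpperHalfPlane.coe_im]
    nlinarith
  rw [appell, norm_mul]
  exact (mul_le_of_le_one_left (norm_nonneg _) h3).trans h2

theorem exists_norm_completion_half_tau_le : ∃ C A : ℝ, 0 ≤ C ∧
    ∀ τ : ℍ, 1 / 2 ≤ τ.im → ‖completion (τ / 2) τ‖ ≤ C * Real.exp (A * τ.im) := by
  obtain ⟨C, A, hC, h⟩ := exists_norm_nonholPart_le
  set B := (∑' m, appellBound (1 / 2) (1 / 2) m) / (1 - Real.exp (-2 * π * (1 / 4))) with hB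
  have hB0 : 0 ≤ B := by
    refine div_nonneg (tsum_nonneg fun m => Real.exp_nonneg _) ?_
    rw [sub_nonneg, Real.exp_le_one_iff]
    linarith [Real.pi_pos]
  refine ⟨5 * B + C, max A π, by positivity, fun τ hτ => ?_⟩
  have h1 := appell_eq_mul_oddTheta (half_tau_notMem_lattice τ)
  have h2 := norm_oddTheta_half_tau_ge hτ
  have h3 : oddTheta (τ / 2) τ ≠ 0 := norm_pos_iff.1 (by linarith)
  have h4 : completion (τ / 2) τ = appell (τ / 2) τ / oddTheta (τ / 2) τ - nonholPart τ := by
    rw [h1, mul_div_cancel_right₀ _ h3]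
    ring
  have hexp : ∀ a ≤ max A π, Real.exp (a * τ.im) ≤ Real.exp (max A π * τ.im) := fun a ha =>
    Real.exp_le_exp.2 (mul_le_mul_of_nonneg_right ha τ.im_pos.le)
  have h5 : ‖appell (τ / 2) τ / oddTheta (τ / 2) τ‖ ≤ 5 * B * Real.exp (max A π * τ.im) := by
    rw [norm_div, div_le_iff₀ (by linarith)]
    have h6 := (norm_appell_half_tau_le hτ).trans
      (mul_le_mul_of_nonneg_right (hexp π (le_max_right _ _)) hB0)
    have h7 : 0 ≤ Real.exp (max A π * τ.im) * B := by positivity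
    nlinarith
  have h6 := norm_sub_le (appell (τ / 2) τ / oddTheta (τ / 2) τ) (nonholPart τ)
  have h7 := (h τ hτ).trans (mul_le_mul_of_nonneg_left (hexp A (le_max_left _ _)) hC)
  rw [h4]
  linarith

theorem norm_completion_T (u : ℂ) (τ : ℍ) :
    ‖completion u (ModularGroup.T • τ)‖ = ‖completion u τ‖ := by
  have h := completion_smul ModularGroup.T τ u
  rw [denom_T, inv_one, one_mul, one_cpow, mul_one] at h
  rw [h, norm_mul, norm_zpow, norm_etaMultiplier, one_zpow, one_mul]

/-- The completion has at most exponential growth at each of the three half periods. The half period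
`(τ + 1)/2` is reduced to `τ/2` by a translation of `τ`. -/
theorem exists_norm_completion_le : ∃ C A : ℝ, 0 ≤ C ∧ 0 ≤ A ∧
    ∀ τ : ℍ, 1 / 2 ≤ τ.im → ∀ c d : ℤ, ¬ (2 ∣ c ∧ 2 ∣ d) →
      ‖completion ((c * (τ : ℂ) + d) / 2) τ‖ ≤ C * Real.exp (A * τ.im) := by
  obtain ⟨C₁, A₁, hC₁, h₁⟩ := exists_norm_completion_half_le
  obtain ⟨C₂, A₂, hC₂, h₂⟩ := exists_norm_completion_half_tau_le
  refine ⟨C₁ + C₂, |A₁| + |A₂|, by positivity, by positivity, fun τ hτ c d hcd => ?_⟩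
  have hy := τ.im_pos
  have b₁ : ∀ x : ℝ, x ≤ C₁ * Real.exp (A₁ * τ.im) →
      x ≤ (C₁ + C₂) * Real.exp ((|A₁| + |A₂|) * τ.im) := fun x hx => hx.trans
    (mul_le_mul (by linarith) (Real.exp_le_exp.2 (mul_le_mul_of_nonneg_right
      (by linarith [le_abs_self A₁, abs_nonneg A₂]) hy.le)) (Real.exp_nonneg _) (by positivity))
  have b₂ : ∀ x : ℝ, x ≤ C₂ * Real.exp (A₂ * τ.im) →
      x ≤ (C₁ + C₂) * Real.exp ((|A₁| + |A₂|) * τ.im) := fun x hx => hx.trans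
    (mul_le_mul (by linarith) (Real.exp_le_exp.2 (mul_le_mul_of_nonneg_right
      (by linarith [le_abs_self A₂, abs_nonneg A₁]) hy.le)) (Real.exp_nonneg _) (by positivity))
  have hred : ∀ m n : ℤ, ∀ w : ℂ, ((c : ℂ) * τ + d) / 2 = w + (m + n * τ) →
      completion ((c * (τ : ℂ) + d) / 2) τ = completion w τ := fun m n w hw => by
    rw [hw]
    exact completion_add_coe τ w ⟨_, mem_periods_lattice.2 ⟨m, n, rfl⟩⟩
  obtain ⟨c', hc | hc⟩ := Int.even_or_odd' c <;> obtain ⟨d', hd | hd⟩ := Int.even_or_odd' d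
  · exact absurd ⟨⟨c', hc⟩, ⟨d', hd⟩⟩ hcd
  · rw [hred d' c' (1 / 2) (by rw [hc, hd]; push_cast; ring)]
    exact b₁ _ (h₁ τ hτ)
  · rw [hred d' c' (τ / 2) (by rw [hc, hd]; push_cast; ring)]
    exact b₂ _ (h₂ τ hτ)
  · set σ : ℍ := ModularGroup.T⁻¹ • τ with hσ
    have h3 : τ = ModularGroup.T • σ := (smul_inv_smul _ _).symm
    have h4 : (τ : ℂ) = σ + 1 := by
      rw [h3]
      exact coe_T_smul σ
    have h5 : σ.im = τ.im := by
      rw [← UpperHalfPlane.coe_im τ, h4]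
      simp
    have h6 : completion (σ / 2) τ = completion (σ / 2) (ModularGroup.T • σ) := by rw [← h3]
    rw [hred (d' + 1) c' (σ / 2) (by rw [hc, hd, h4]; push_cast; ring), h6,
      norm_completion_T]
    rw [← h5] at b₂ ⊢
    exact b₂ _ (h₂ σ (h5 ▸ hτ))

theorem norm_cpow_half (z : ℂ) : ‖z ^ (1 / 2 : ℂ)‖ ^ 2 = ‖z‖ := by
  rw [← norm_pow, ← cpow_nat_mul]
  norm_num

/-- The lower bound for the automorphy factors that occur in reducing `8j/p + γτ` to the fundamental
domain. -/
theorem one_le_mul_norm_denom {p : ℕ} (hp : p ≠ 0) (g γ : SL(2, ℤ)) (j : ℤ) {τ : ℍ}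
    (hτ : 1 ≤ τ.im) : 1 ≤ p * (‖denom g (sieveShift p j +ᵥ γ • τ : ℍ)‖ * ‖denom γ τ‖) := by
  have hp' : (p : ℂ) ≠ 0 := by exact_mod_cast hp
  have hD := denom_ne_zero γ τ
  have hg := denom_ne_zero g (sieveShift p j +ᵥ γ • τ)
  obtain ⟨U, V, hUV⟩ : ∃ U V : ℤ, p * (denom g (sieveShift p j +ᵥ γ • τ : ℍ) * denom γ τ) =
      U * τ + V := by
    refine ⟨g 1 0 * (8 * j * γ 1 0 + p * γ 0 0) + p * g 1 1 * γ 1 0,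
      g 1 0 * (8 * j * γ 1 1 + p * γ 0 1) + p * g 1 1 * γ 1 1, ?_⟩
    rw [denom_SL_eq g, UpperHalfPlane.coe_vadd, coe_SL_smul, ← denom_SL_eq, sieveShift]
    have h1 : (γ 0 0 * τ + γ 0 1 : ℂ) / denom γ τ * denom γ τ = γ 0 0 * τ + γ 0 1 :=
      div_mul_cancel₀ _ hD
    have h2 := denom_SL_eq γ τ
    have h3 : (p : ℂ) * (8 * j / p) = 8 * j := by field_simp
    push_cast
    linear_combination (p * g 1 0 : ℂ) * h1 + (g 1 0 * denom γ τ : ℂ) * h3 +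
      (g 1 0 * 8 * j + p * g 1 1 : ℂ) * h2
  have h0 : (U * τ + V : ℂ) ≠ 0 := hUV ▸ mul_ne_zero hp' (mul_ne_zero hg hD)
  have h1 : (p : ℝ) * (‖denom g (sieveShift p j +ᵥ γ • τ : ℍ)‖ * ‖denom γ τ‖) =
      ‖(U * τ + V : ℂ)‖ := by
    rw [← hUV, norm_mul, norm_mul, Complex.norm_natCast]
  rw [h1]
  rcases eq_or_ne U 0 with hU | hU
  · subst hU
    have hV : V ≠ 0 := fun h => h0 (by simp [h])
    simp only [Int.cast_zero, zero_mul, zero_add, Complex.norm_intCast]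
    exact_mod_cast Int.one_le_abs hV
  · refine le_trans ?_ (Complex.abs_im_le_norm _)
    have h2 : (U * τ + V : ℂ).im = U * τ.im := by simp
    rw [h2, abs_mul, abs_of_pos τ.im_pos]
    have h3 : (1 : ℝ) ≤ |(U : ℝ)| := by exact_mod_cast Int.one_le_abs hU
    nlinarith

/-- The point `8j/p + γτ` is moved to the fundamental domain by some `g`. This turns `1/2` into
another half period, at which the growth of the completion is known, and the lower bound for the
automorphy factors controls both the weight factor and the height of the reduced point. -/
theorem exists_norm_completion_vadd_smul_le {p : ℕ} (hp : p ≠ 0) : ∃ C A : ℝ,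
    ∀ (γ : SL(2, ℤ)) (j : ℤ) (τ : ℍ), 1 ≤ τ.im →
      ‖denom γ τ ^ (-(1 / 2) : ℂ) * completion (1 / 2) (sieveShift p j +ᵥ γ • τ)‖ ≤
        C * Real.exp (A * τ.im) := by
  obtain ⟨C, A, hC, hA, h⟩ := exists_norm_completion_le
  refine ⟨p * C, A * p ^ 2, fun γ j τ hτ => ?_⟩
  set σ : ℍ := sieveShift p j +ᵥ γ • τ with hσ
  obtain ⟨g, hg⟩ := ModularGroup.exists_smul_mem_fd σ
  have hy := τ.im_pos
  have him : 1 / 2 ≤ (g • σ).im := by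
    have h1 := ModularGroup.three_le_four_mul_im_sq_of_mem_fd hg
    nlinarith [(g • σ).im_pos]
  have hpb := one_le_mul_norm_denom hp g γ j hτ
  rw [← hσ] at hpb
  set D := denom γ τ with hD
  set E := denom g σ with hE
  have hD0 : 0 < ‖D‖ := norm_pos_iff.2 (denom_ne_zero γ τ)
  have hE0 : 0 < ‖E‖ := norm_pos_iff.2 (denom_ne_zero g σ)
  -- the imaginary part of the reduced point
  have him2 : (g • σ).im ≤ p ^ 2 * τ.im := by
    have h1 : ∀ (g : SL(2, ℤ)) (σ : ℍ), (g • σ).im = σ.im / ‖denom g σ‖ ^ 2 := fun g σ => by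
      rw [ModularGroup.im_smul_eq_div_normSq, Complex.normSq_eq_norm_sq]
    rw [h1, ← hE, hσ, UpperHalfPlane.vadd_im, h1, ← hD, div_div, div_le_iff₀ (by positivity)]
    have h2 : 1 ≤ (p * (‖E‖ * ‖D‖)) ^ 2 := one_le_pow₀ hpb
    nlinarith
  -- the half period at the reduced point
  have hw : E⁻¹ * (1 / 2) = ((-g 1 0 : ℤ) * ((g • σ : ℍ) : ℂ) + (g 0 0 : ℤ)) / 2 := by
    have hE' : E ≠ 0 := denom_ne_zero g σ
    have hdet : ((g 0 0 : ℂ) * g 1 1 - g 0 1 * g 1 0) = 1 := by exact_mod_cast SL_det_eq g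
    have h1 := denom_SL_eq g σ
    rw [coe_SL_smul, ← denom_SL_eq, ← hE]
    rw [← hE] at h1
    push_cast
    field_simp
    rw [h1]
    linear_combination -hdet
  have hpar : ¬ (2 ∣ -g 1 0 ∧ 2 ∣ g 0 0) := by
    rintro ⟨⟨a, ha⟩, ⟨b, hb⟩⟩
    have h1 := SL_det_eq g
    have : 2 * (b * g 1 1 + g 0 1 * a) = 1 := by
      linear_combination h1 - g 1 1 * hb - g 0 1 * ha
    omega
  have h1 := completion_smul g σ (1 / 2)
  rw [← hE, hw] at h1
  have h2 := h (g • σ) him _ _ hpar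
  rw [h1, norm_mul, norm_mul, norm_zpow, norm_etaMultiplier, one_zpow, one_mul] at h2
  have h3 : C * Real.exp (A * (g • σ).im) ≤ C * Real.exp (A * p ^ 2 * τ.im) :=
    mul_le_mul_of_nonneg_left (Real.exp_le_exp.2 (by
      rw [mul_assoc]
      exact mul_le_mul_of_nonneg_left him2 hA)) hC
  have hα := norm_cpow_half D
  have hβ := norm_cpow_half E
  rw [cpow_neg, norm_mul, norm_inv]
  set α := ‖D ^ (1 / 2 : ℂ)‖
  set β := ‖E ^ (1 / 2 : ℂ)‖
  have hα0 : 0 < α := norm_pos_iff.2 (denom_cpow_half_ne_zero γ τ)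
  have hβ0 : 0 < β := norm_pos_iff.2 (denom_cpow_half_ne_zero g σ)
  have hp1 : (1 : ℝ) ≤ p := by exact_mod_cast Nat.one_le_iff_ne_zero.2 hp
  have hαβ : 1 ≤ p * (α * β) := by
    rw [← hα, ← hβ] at hpb
    by_contra! hlt
    have : (p * (α * β)) ^ 2 < 1 := by
      have := mul_pos hα0 hβ0
      exact pow_lt_one₀ (by positivity) hlt two_ne_zero
    nlinarith [mul_nonneg (sub_nonneg.2 hp1) (sq_nonneg (α * β))]
  rw [inv_mul_le_iff₀ hα0]
  have h4 := h2.trans h3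
  set X := ‖completion (1 / 2) σ‖
  have hX : 0 ≤ X := norm_nonneg _
  calc X ≤ p * (α * β) * X := le_mul_of_one_le_left hX hαβ
    _ = p * α * (β * X) := by ring
    _ ≤ p * α * (C * Real.exp (A * p ^ 2 * τ.im)) :=
      mul_le_mul_of_nonneg_left h4 (by positivity)
    _ = _ := by ring

theorem isBigO_sievedCompletion_smul {p : ℕ} (hp : p ≠ 0) (s : Finset ℤ) (c : ℂ) (γ : SL(2, ℤ)) :
    ∃ A : ℝ, (fun τ : ℍ => denom γ τ ^ (-(1 / 2) : ℂ) *
      ∑ ρ ∈ s, c * (4 * sievedCompletion p ρ (γ • τ))) =O[atImInfty]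
        fun τ : ℍ => Real.exp (A * τ.im) := by
  obtain ⟨C, A, h⟩ := exists_norm_completion_vadd_smul_le hp
  refine ⟨A, ?_⟩
  have h1 : ∀ j : ℤ, (fun τ : ℍ => denom γ τ ^ (-(1 / 2) : ℂ) *
      completion (1 / 2) (sieveShift p j +ᵥ γ • τ)) =O[atImInfty]
        fun τ : ℍ => Real.exp (A * τ.im) := fun j => by
    refine IsBigO.of_bound C ?_
    filter_upwards [(atImInfty_mem _).2 ⟨1, fun τ hτ => hτ⟩] with τ hτ
    rw [Real.norm_of_nonneg (Real.exp_nonneg _)]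
    exact h γ j τ hτ
  have h2 : (fun τ : ℍ => ∑ ρ ∈ s, ∑ j ∈ Finset.range p, c * 4 * phase p (-(j * ρ)) *
      (denom γ τ ^ (-(1 / 2) : ℂ) * completion (1 / 2) (sieveShift p j +ᵥ γ • τ))) =O[atImInfty]
        fun τ : ℍ => Real.exp (A * τ.im) :=
    IsBigO.fun_sum fun ρ _ => IsBigO.fun_sum fun j _ => (h1 j).const_mul_left _
  refine h2.congr_left fun τ => ?_
  rw [Finset.mul_sum]
  refine Finset.sum_congr rfl fun ρ _ => ?_
  rw [sievedCompletion, Finset.mul_sum, Finset.mul_sum, Finset.mul_sum]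
  exact Finset.sum_congr rfl fun j _ => by ring

/-! ### Indices of congruence subgroups -/

/-- If the fibres of `φ` on `K` are the right cosets of `H ∩ K`, the relative index is the number of
values of `φ` on `K`. -/
theorem relIndex_eq_ncard_image {G X : Type*} [Group G] {H K : Subgroup G} (φ : G → X)
    (h : ∀ g ∈ K, ∀ g' ∈ K, φ g = φ g' ↔ g * g'⁻¹ ∈ H) :
    H.relIndex K = (φ '' (K : Set G)).ncard := by
  rw [Subgroup.relIndex, Subgroup.index, ← Nat.card_coe_set_eq]
  have hrel : ∀ a b : K, QuotientGroup.leftRel (H.subgroupOf K) a b ↔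
      φ ((a : G)⁻¹) = φ ((b : G)⁻¹) := fun a b => by
    rw [QuotientGroup.leftRel_apply, Subgroup.mem_subgroupOf,
      h _ (K.inv_mem a.2) _ (K.inv_mem b.2), inv_inv]
    rfl
  refine Nat.card_congr (Equiv.ofBijective
    (Quotient.lift (fun a : K => (⟨φ ((a : G)⁻¹), _, K.inv_mem a.2, rfl⟩ : φ '' (K : Set G)))
      fun a b hab => Subtype.ext ((hrel a b).1 hab)) ⟨?_, ?_⟩)
  · intro a b
    refine Quotient.inductionOn₂ a b fun a b hab => ?_
    exact Quotient.sound ((hrel a b).2 (congrArg Subtype.val hab))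
  · rintro ⟨_, g, hg, rfl⟩
    exact ⟨Quotient.mk _ ⟨g⁻¹, K.inv_mem hg⟩, Subtype.ext (by simp)⟩

theorem relIndex_eq_card {G X : Type*} [Group G] {H K : Subgroup G} (φ : G → X)
    (hφ : ∀ x : X, ∃ g ∈ K, φ g = x)
    (h : ∀ g ∈ K, ∀ g' ∈ K, φ g = φ g' ↔ g * g'⁻¹ ∈ H) : H.relIndex K = Nat.card X := by
  rw [relIndex_eq_ncard_image φ h, ← Set.ncard_univ]
  exact congrArg Set.ncard (Set.eq_univ_of_forall hφ)

theorem mul_inv_apply_one_zero (g g' : SL(2, ℤ)) :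
    (g * g'⁻¹) 1 0 = g 1 0 * g' 1 1 - g 1 1 * g' 1 0 := by
  rw [Matrix.SpecialLinearGroup.coe_mul, Matrix.SpecialLinearGroup.SL2_inv_expl, Matrix.mul_apply,
    Fin.sum_univ_two]
  simp
  ring

theorem mul_inv_apply_one_one (g g' : SL(2, ℤ)) :
    (g * g'⁻¹) 1 1 = g 1 1 * g' 0 0 - g 1 0 * g' 0 1 := by
  rw [Matrix.SpecialLinearGroup.coe_mul, Matrix.SpecialLinearGroup.SL2_inv_expl, Matrix.mul_apply,
    Fin.sum_univ_two]
  simp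
  ring

theorem mem_Gamma0_iff {N : ℕ} {γ : SL(2, ℤ)} :
    γ ∈ CongruenceSubgroup.Gamma0 N ↔ (N : ℤ) ∣ γ 1 0 := by
  rw [CongruenceSubgroup.Gamma0_mem, ZMod.intCast_zmod_eq_zero_iff_dvd]

theorem isCoprime_SL (γ : SL(2, ℤ)) : IsCoprime (γ 1 0) (γ 1 1) :=
  ⟨-γ 0 1, γ 0 0, by linear_combination SL_det_eq γ⟩

theorem isUnit_intCast_of_isCoprime {K : ℕ} {d : ℤ} (h : IsCoprime (K : ℤ) d) :
    IsUnit (d : ZMod K) := by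
  obtain ⟨u, v, huv⟩ := h
  have h1 := congrArg (Int.cast : ℤ → ZMod K) huv
  push_cast at h1
  rw [ZMod.natCast_self, mul_zero, zero_add] at h1
  exact IsUnit.of_mul_eq_one _ (by rw [mul_comm]; exact h1)

/-- When every prime divisor of `K` divides `M`, the cosets of `Γ₀(MK)` in `Γ₀(M)` are classified by
the residue of `(c / M) / d` modulo `K`. -/
theorem relIndex_Gamma0_mul {M K n : ℕ} (hM : M ≠ 0) (hK : K ∣ M ^ n) :
    (CongruenceSubgroup.Gamma0 (M * K)).relIndex (CongruenceSubgroup.Gamma0 M) = K := by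
  have hM' : (M : ℤ) ≠ 0 := by exact_mod_cast hM
  have hunit : ∀ g ∈ CongruenceSubgroup.Gamma0 M, IsUnit (g 1 1 : ZMod K) := fun g hg => by
    have h1 : IsCoprime (M : ℤ) (g 1 1) :=
      (isCoprime_SL g).of_isCoprime_of_dvd_left (mem_Gamma0_iff.1 hg)
    refine isUnit_intCast_of_isCoprime ((h1.pow_left (m := n)).of_isCoprime_of_dvd_left ?_)
    exact_mod_cast hK
  rw [relIndex_eq_card (X := ZMod K)
    fun g => ((g 1 0 / M : ℤ) : ZMod K) * (g 1 1 : ZMod K)⁻¹, Nat.card_zmod]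
  · intro x
    obtain ⟨y, rfl⟩ := ZMod.intCast_surjective x
    obtain ⟨g, h10, h11⟩ := (isCoprime_one_right (x := (M * y : ℤ))).exists_SL2_row 1
    refine ⟨g, mem_Gamma0_iff.2 (h10 ▸ dvd_mul_right _ _), ?_⟩
    rw [h10, h11, Int.mul_ediv_cancel_left _ hM']
    simp
  · intro g hg g' hg'
    obtain ⟨c, hc⟩ := mem_Gamma0_iff.1 hg
    obtain ⟨c', hc'⟩ := mem_Gamma0_iff.1 hg'
    have h1 := ZMod.mul_inv_of_unit _ (hunit g hg)
    have h2 := ZMod.mul_inv_of_unit _ (hunit g' hg')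
    rw [mem_Gamma0_iff, mul_inv_apply_one_zero, hc, hc', Int.mul_ediv_cancel_left _ hM',
      Int.mul_ediv_cancel_left _ hM', show (M * c * g' 1 1 - g 1 1 * (M * c') : ℤ) =
        M * (c * g' 1 1 - c' * g 1 1) by ring, Nat.cast_mul, mul_dvd_mul_iff_left hM',
      ← ZMod.intCast_zmod_eq_zero_iff_dvd]
    push_cast
    constructor
    · intro h
      linear_combination (g 1 1 * g' 1 1 : ZMod K) * h - (c * g' 1 1 : ZMod K) * h1 +
        (c' * g 1 1 : ZMod K) * h2
    · intro h
      linear_combination ((g 1 1 : ZMod K)⁻¹ * (g' 1 1 : ZMod K)⁻¹) * h -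
        (c * (g 1 1 : ZMod K)⁻¹ : ZMod K) * h2 + (c' * (g' 1 1 : ZMod K)⁻¹) * h1

/-- For a prime `p` not dividing `M`, the cosets of `Γ₀(Mp)` in `Γ₀(M)` are classified by the point
`c / d` of the projective line over `𝔽_p`. -/
theorem relIndex_Gamma0_mul_prime {M p : ℕ} [Fact p.Prime] (hM : IsCoprime (M : ℤ) p) :
    (CongruenceSubgroup.Gamma0 (M * p)).relIndex (CongruenceSubgroup.Gamma0 M) = p + 1 := by
  classical
  rw [relIndex_eq_card (X := Option (ZMod p)) fun g =>
    if (g 1 1 : ZMod p) = 0 then none else some ((g 1 0 : ZMod p) / (g 1 1 : ZMod p))]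
  · rw [Nat.card_eq_fintype_card, Fintype.card_option, ZMod.card]
  · rintro (_ | x)
    · obtain ⟨g, h10, h11⟩ := hM.exists_SL2_row 1
      refine ⟨g, mem_Gamma0_iff.2 (h10 ▸ dvd_rfl), ?_⟩
      simp [h11]
    · obtain ⟨y, hy⟩ := ZMod.intCast_surjective (x / (M : ZMod p))
      obtain ⟨g, h10, h11⟩ := (isCoprime_one_right (x := (M * y : ℤ))).exists_SL2_row 1
      refine ⟨g, mem_Gamma0_iff.2 (h10 ▸ dvd_mul_right _ _), ?_⟩
      have h0 : (M : ZMod p) ≠ 0 := by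
        have := (isUnit_intCast_of_isCoprime hM.symm).ne_zero
        exact_mod_cast this
      rw [h10, h11]
      push_cast
      rw [hy, mul_div_cancel₀ _ h0]
      simp
  · intro g hg g' hg'
    have hne : ∀ g : SL(2, ℤ), (g 1 1 : ZMod p) = 0 → (g 1 0 : ZMod p) ≠ 0 := fun g h h' => by
      have h1 := congrArg (Int.cast : ℤ → ZMod p) (SL_det_eq g)
      push_cast at h1
      rw [h, h'] at h1
      simp at h1
    have hdvd : (M : ℤ) ∣ g 1 0 * g' 1 1 - g 1 1 * g' 1 0 :=
      dvd_sub ((mem_Gamma0_iff.1 hg).mul_right _) ((mem_Gamma0_iff.1 hg').mul_left _)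
    have h1 : g * g'⁻¹ ∈ CongruenceSubgroup.Gamma0 (M * p) ↔
        (g 1 0 * g' 1 1 - g 1 1 * g' 1 0 : ZMod p) = 0 := by
      rw [mem_Gamma0_iff, mul_inv_apply_one_zero, Nat.cast_mul]
      have h2 : (M * p : ℤ) ∣ g 1 0 * g' 1 1 - g 1 1 * g' 1 0 ↔
          (p : ℤ) ∣ g 1 0 * g' 1 1 - g 1 1 * g' 1 0 :=
        ⟨fun h => (dvd_mul_left _ _).trans h, fun h => hM.mul_dvd hdvd h⟩
      rw [h2, ← ZMod.intCast_zmod_eq_zero_iff_dvd]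
      push_cast
      rfl
    rw [h1]
    by_cases h : (g 1 1 : ZMod p) = 0 <;> by_cases h' : (g' 1 1 : ZMod p) = 0
    · simp [h, h']
    · simp [h, h', hne g h]
    · simp [h, h', hne g' h']
    · simp only [h, h', if_false, Option.some.injEq]
      rw [div_eq_div_iff h h', sub_eq_zero, mul_comm (g' 1 0 : ZMod p)]

theorem mem_Gamma0_inf_Gamma1_eight {N : ℕ} (hN : 8 ∣ N) {γ : SL(2, ℤ)} :
    γ ∈ CongruenceSubgroup.Gamma0 N ⊓ CongruenceSubgroup.Gamma1 8 ↔
      (N : ℤ) ∣ γ 1 0 ∧ (γ 1 1 : ZMod 8) = 1 := by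
  rw [Subgroup.mem_inf, mem_Gamma0_iff, CongruenceSubgroup.Gamma1_mem]
  constructor
  · rintro ⟨h1, -, h2, -⟩
    exact ⟨h1, h2⟩
  · rintro ⟨h1, h2⟩
    have h3 : (γ 1 0 : ZMod 8) = 0 := (ZMod.intCast_zmod_eq_zero_iff_dvd _ 8).2
      ((Int.natCast_dvd_natCast.2 hN).trans h1)
    have h4 := congrArg (Int.cast : ℤ → ZMod 8) (SL_det_eq γ)
    push_cast at h4
    rw [h2, h3, mul_one, mul_zero, sub_zero] at h4
    exact ⟨h1, h4, h2, h3⟩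

/-- If `8 ∣ N`, the cosets of `Γ₀(N) ∩ Γ₁(8)` in `Γ₀(N)` are classified by `d` modulo `8`. -/
theorem relIndex_Gamma0_inf_Gamma1_eight {N : ℕ} [NeZero N] (hN : 8 ∣ N) :
    (CongruenceSubgroup.Gamma0 N ⊓ CongruenceSubgroup.Gamma1 8).relIndex
      (CongruenceSubgroup.Gamma0 N) = 4 := by
  have hzero : ∀ g ∈ CongruenceSubgroup.Gamma0 N, (g 1 0 : ZMod 8) = 0 := fun g hg =>
    (ZMod.intCast_zmod_eq_zero_iff_dvd _ 8).2
      ((Int.natCast_dvd_natCast.2 hN).trans (mem_Gamma0_iff.1 hg))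
  have hdet : ∀ g ∈ CongruenceSubgroup.Gamma0 N, (g 0 0 * g 1 1 : ZMod 8) = 1 := fun g hg => by
    have h4 := congrArg (Int.cast : ℤ → ZMod 8) (SL_det_eq g)
    push_cast at h4
    rwa [hzero g hg, mul_zero, sub_zero] at h4
  rw [relIndex_eq_ncard_image fun g => (g 1 1 : ZMod 8)]
  · have himage : (fun g : SL(2, ℤ) => (g 1 1 : ZMod 8)) '' (CongruenceSubgroup.Gamma0 N) =
        (({1, 3, 5, 7} : Finset (ZMod 8)) : Set (ZMod 8)) := by
      ext x
      constructor
      · rintro ⟨g, hg, rfl⟩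
        have h1 : ∀ a d : ZMod 8, a * d = 1 → d ∈ ({1, 3, 5, 7} : Finset (ZMod 8)) := by decide
        exact h1 _ _ (hdet g hg)
      · intro hx
        have hx' : IsUnit x := by
          have h1 : ∀ d ∈ ({1, 3, 5, 7} : Finset (ZMod 8)), d * d = 1 := by decide
          exact IsUnit.of_mul_eq_one _ (h1 x hx)
        obtain ⟨v, hv⟩ := ZMod.unitsMap_surjective hN hx'.unit
        have hco : IsCoprime (N : ℤ) ((v : ZMod N).val : ℤ) :=
          Nat.isCoprime_iff_coprime.2 (ZMod.val_coe_unit_coprime v).symm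
        obtain ⟨g, h10, h11⟩ := hco.exists_SL2_row 1
        refine ⟨g, mem_Gamma0_iff.2 (h10 ▸ dvd_rfl), ?_⟩
        simp only [h11]
        have h1 := congrArg Units.val hv
        rw [ZMod.unitsMap_val, IsUnit.unit_spec] at h1
        rw [← h1, ZMod.cast_eq_val]
        push_cast
        rfl
    rw [himage, Set.ncard_coe_finset]
    decide
  · intro g hg g' hg'
    rw [mem_Gamma0_inf_Gamma1_eight hN, mul_inv_apply_one_one, ← mem_Gamma0_iff]
    have h1 : g * g'⁻¹ ∈ CongruenceSubgroup.Gamma0 N := mul_mem hg (inv_mem hg')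
    have h2 := hdet g' hg'
    simp only [h1, true_and]
    push_cast
    rw [hzero g hg, zero_mul, sub_zero]
    constructor
    · intro h
      linear_combination (g' 0 0 : ZMod 8) * h + h2
    · intro h
      linear_combination (g' 1 1 : ZMod 8) * h - (g 1 1 : ZMod 8) * h2

/-- The subgroup of `Γ₀(N)` of the matrices with `d² ≡ 1` modulo `N`. -/
def gammaSq (N : ℕ) : Subgroup SL(2, ℤ) :=
  ((powMonoidHom 2).comp (CongruenceSubgroup.Gamma0Map N)).ker.map
    (CongruenceSubgroup.Gamma0 N).subtype

theorem mem_gammaSq_iff {N : ℕ} {γ : SL(2, ℤ)} :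
    γ ∈ gammaSq N ↔ γ ∈ CongruenceSubgroup.Gamma0 N ∧ (γ 1 1 : ZMod N) ^ 2 = 1 := by
  constructor
  · rintro ⟨g, hg, rfl⟩
    exact ⟨g.2, hg⟩
  · rintro ⟨h1, h2⟩
    exact ⟨⟨γ, h1⟩, h2, rfl⟩

/-- The cosets are classified by `d²`, which is a nonzero square modulo `7`. -/
theorem relIndex_inf_gammaSq_seven :
    (CongruenceSubgroup.Gamma0 6272 ⊓ CongruenceSubgroup.Gamma1 8 ⊓ gammaSq 7).relIndex
      (CongruenceSubgroup.Gamma0 6272 ⊓ CongruenceSubgroup.Gamma1 8) = 3 := by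
  set K := CongruenceSubgroup.Gamma0 6272 ⊓ CongruenceSubgroup.Gamma1 8 with hK
  have hmem : ∀ g : SL(2, ℤ), g ∈ K ↔ ((6272 : ℕ) : ℤ) ∣ g 1 0 ∧ (g 1 1 : ZMod 8) = 1 := fun g =>
    mem_Gamma0_inf_Gamma1_eight (by norm_num)
  have hzero : ∀ g ∈ K, (g 1 0 : ZMod 7) = 0 := fun g hg =>
    (ZMod.intCast_zmod_eq_zero_iff_dvd _ 7).2
      ((by norm_num : ((7 : ℕ) : ℤ) ∣ (6272 : ℕ)).trans ((hmem g).1 hg).1)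
  have hdet : ∀ g ∈ K, (g 0 0 * g 1 1 : ZMod 7) = 1 := fun g hg => by
    have h4 := congrArg (Int.cast : ℤ → ZMod 7) (SL_det_eq g)
    push_cast at h4
    rwa [hzero g hg, mul_zero, sub_zero] at h4
  rw [relIndex_eq_ncard_image fun g => (g 1 1 : ZMod 7) ^ 2]
  · have himage : (fun g : SL(2, ℤ) => (g 1 1 : ZMod 7) ^ 2) '' (K : Set SL(2, ℤ)) =
        (({1, 2, 4} : Finset (ZMod 7)) : Set (ZMod 7)) := by
      ext x
      constructor
      · rintro ⟨g, hg, rfl⟩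
        have h1 : ∀ a d : ZMod 7, a * d = 1 → d ^ 2 ∈ ({1, 2, 4} : Finset (ZMod 7)) := by decide
        exact h1 _ _ (hdet g hg)
      · intro hx
        -- `1`, `9` and `17` are `1` modulo `8`, with squares `1`, `4` and `2` modulo `7`
        obtain ⟨d, hd8, hd7, hco⟩ : ∃ d : ℤ, (d : ZMod 8) = 1 ∧ (d : ZMod 7) ^ 2 = x ∧
            IsCoprime (6272 : ℤ) d := by
          rw [Finset.mem_coe, Finset.mem_insert, Finset.mem_insert, Finset.mem_singleton] at hx
          rcases hx with rfl | rfl | rfl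
          · exact ⟨1, by decide, by decide, isCoprime_one_right⟩
          · exact ⟨17, by decide, by decide, by norm_num⟩
          · exact ⟨9, by decide, by decide, by norm_num⟩
        obtain ⟨g, h10, h11⟩ := hco.exists_SL2_row 1
        refine ⟨g, (hmem g).2 ⟨h10 ▸ dvd_rfl, by rw [h11]; exact hd8⟩, ?_⟩
        simp only [h11]
        exact hd7
    rw [himage, Set.ncard_coe_finset]
    decide
  · intro g hg g' hg'
    have h1 : g * g'⁻¹ ∈ K := mul_mem hg (inv_mem hg')
    have h2 := hdet g' hg'
    have h3 : g * g'⁻¹ ∈ CongruenceSubgroup.Gamma0 7 := hzero _ h1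
    rw [Subgroup.mem_inf, mem_gammaSq_iff, mul_inv_apply_one_one]
    simp only [h1, h3, true_and]
    push_cast
    rw [hzero g hg, zero_mul, sub_zero]
    constructor
    · intro h
      linear_combination (g' 0 0 : ZMod 7) ^ 2 * h + (g' 0 0 * g' 1 1 + 1 : ZMod 7) * h2
    · intro h
      linear_combination (g' 1 1 : ZMod 7) ^ 2 * h -
        (g 1 1 : ZMod 7) ^ 2 * (g' 0 0 * g' 1 1 + 1 : ZMod 7) * h2

theorem Gamma0_mul_le (M K : ℕ) :
    CongruenceSubgroup.Gamma0 (M * K) ≤ CongruenceSubgroup.Gamma0 M := fun g hg => by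
  rw [mem_Gamma0_iff] at hg ⊢
  exact (Int.natCast_dvd_natCast.2 (dvd_mul_right M K)).trans hg

theorem index_Gamma0_two : (CongruenceSubgroup.Gamma0 2).index = 3 := by
  have h1 : CongruenceSubgroup.Gamma0 1 = ⊤ :=
    eq_top_iff.2 fun g _ => mem_Gamma0_iff.2 (by simp)
  have h2 : (CongruenceSubgroup.Gamma0 (1 * 2)).relIndex (CongruenceSubgroup.Gamma0 1) = 2 + 1 :=
    relIndex_Gamma0_mul_prime (by simp)
  rwa [h1, Subgroup.relIndex_top_right] at h2

/-- The index of `Γ₀(2pK)` for an odd prime `p` when every prime divisor of `K` divides `2p`. -/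
theorem index_Gamma0_two_mul_prime_mul {p K n : ℕ} [hp : Fact p.Prime]
    (h2 : IsCoprime (2 : ℤ) p) (hK : K ∣ (2 * p) ^ n) :
    (CongruenceSubgroup.Gamma0 (2 * p * K)).index = K * ((p + 1) * 3) := by
  have h1 : 2 * p ≠ 0 := mul_ne_zero two_ne_zero hp.out.ne_zero
  rw [← Subgroup.relIndex_mul_index (Gamma0_mul_le (2 * p) K), relIndex_Gamma0_mul h1 hK,
    ← Subgroup.relIndex_mul_index (Gamma0_mul_le 2 p),
    relIndex_Gamma0_mul_prime (M := 2) (by exact_mod_cast h2), index_Gamma0_two]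

theorem index_Gamma0_1152_inf :
    (CongruenceSubgroup.Gamma0 1152 ⊓ CongruenceSubgroup.Gamma1 8).index = 9216 := by
  have h0 : Fact (Nat.Prime 3) := ⟨by norm_num⟩
  have h1 := index_Gamma0_two_mul_prime_mul (p := 3) (K := 192) (n := 6) (by norm_num) (by norm_num)
  norm_num at h1
  rw [← Subgroup.relIndex_mul_index (inf_le_left), relIndex_Gamma0_inf_Gamma1_eight (by norm_num),
    h1]

theorem index_Gamma0_6272_inf : (CongruenceSubgroup.Gamma0 6272 ⊓ CongruenceSubgroup.Gamma1 8 ⊓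
    gammaSq 7).index = 129024 := by
  have h0 : Fact (Nat.Prime 7) := ⟨by norm_num⟩
  have h1 := index_Gamma0_two_mul_prime_mul (p := 7) (K := 448) (n := 6) (by norm_num) (by norm_num)
  norm_num at h1
  rw [← Subgroup.relIndex_mul_index (inf_le_left), relIndex_inf_gammaSq_seven,
    ← Subgroup.relIndex_mul_index (inf_le_left), relIndex_Gamma0_inf_Gamma1_eight (by norm_num),
    h1]

theorem intCast_eq_of_dvd {M N : ℕ} (h : M ∣ N) {a b : ℤ} (hab : (a : ZMod N) = b) :
    (a : ZMod M) = b := by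
  rw [← sub_eq_zero, ← Int.cast_sub, ZMod.intCast_zmod_eq_zero_iff_dvd] at hab ⊢
  exact (Int.natCast_dvd_natCast.2 h).trans hab

theorem Gamma1_le_Gamma1 {M N : ℕ} (h : M ∣ N) :
    CongruenceSubgroup.Gamma1 N ≤ CongruenceSubgroup.Gamma1 M := fun g hg => by
  rw [CongruenceSubgroup.Gamma1_mem] at hg ⊢
  refine ⟨?_, ?_, ?_⟩
  · have := intCast_eq_of_dvd (b := 1) h (by exact_mod_cast hg.1)
    exact_mod_cast this
  · have := intCast_eq_of_dvd (b := 1) h (by exact_mod_cast hg.2.1)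
    exact_mod_cast this
  · have := intCast_eq_of_dvd (b := 0) h (by exact_mod_cast hg.2.2)
    exact_mod_cast this

theorem Gamma1_1152_le : CongruenceSubgroup.Gamma1 1152 ≤
    CongruenceSubgroup.Gamma0 1152 ⊓ CongruenceSubgroup.Gamma1 8 :=
  le_inf (CongruenceSubgroup.Gamma1_in_Gamma0 _) (Gamma1_le_Gamma1 (by norm_num))

theorem Gamma1_6272_le : CongruenceSubgroup.Gamma1 6272 ≤
    CongruenceSubgroup.Gamma0 6272 ⊓ CongruenceSubgroup.Gamma1 8 ⊓ gammaSq 7 := by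
  refine le_inf (le_inf (CongruenceSubgroup.Gamma1_in_Gamma0 _) (Gamma1_le_Gamma1 (by norm_num)))
    fun g hg => ?_
  have h := Gamma1_le_Gamma1 (M := 7) (by norm_num) hg
  rw [CongruenceSubgroup.Gamma1_mem] at h
  exact mem_gammaSq_iff.2 ⟨h.2.2, by rw [h.2.1, one_pow]⟩

/-! ### The sieved functions are modular forms -/

/-- The conditions on the residues: by `hρ` the sieve removes the non-holomorphic part, and `hsq`
serves to show that the multiplier does not change along the sieve. The conditions on `Γ` are those
under which conjugation by the translations `8j/p` preserves integrality and the half period `1/2`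
is fixed modulo periods. -/
theorem isWeaklyHolomorphicModularForm_sievedCesaro {m : ℤ} {R : Finset ℤ} {p : ℕ} {R' : Finset ℤ}
    {Γ : Subgroup SL(2, ℤ)} (hp : p ≠ 0) (hR : SieveCompatible m R p R')
    (hρ : ∀ ρ ∈ R', ∀ k : ℤ, ¬ (p : ℤ) ∣ k ^ 2 + ρ)
    (hsq : ∀ t : ℤ, ¬ (p : ℤ) ∣ t → ∃ (n : ℕ) (s : ℤ), (∀ k : ℤ, ¬ (p : ℤ) ∣ k ^ 2 - s) ∧
      (p : ℤ) ∣ (2 * n + 1) ^ 2 - s - t)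
    (hΓ : CongruenceSubgroup.IsCongruenceSubgroup Γ)
    (h : ∀ γ ∈ Γ, 2 ∣ γ 1 0 ∧ (p : ℤ) ^ 2 ∣ γ 1 0 ∧ (p : ℤ) ∣ γ 1 1 ^ 2 - 1) :
    IsWeaklyHolomorphicModularForm 1 Γ (fun γ => etaMultiplier γ ^ (-3 : ℤ))
      (sievedCesaro m R) where
  congruence := hΓ
  transform γ hγ τ := by
    obtain ⟨h2, hc, hd⟩ := h γ hγ
    rw [sievedCesaro_eq_sievedCompletion hp hR hρ, sievedCesaro_eq_sievedCompletion hp hR hρ,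
      Finset.mul_sum]
    refine Finset.sum_congr rfl fun ρ _ => ?_
    rw [sievedCompletion_smul hp hsq h2 hc hd]
    push_cast
    ring
  holomorphic := mdifferentiable_sievedCesaro hp hR
  growth γ := by
    obtain ⟨A, hA⟩ := isBigO_sievedCompletion_smul hp R' (p : ℂ)⁻¹ γ
    refine ⟨A, hA.congr_left fun τ => ?_⟩
    rw [sievedCesaro_eq_sievedCompletion hp hR hρ]
    push_cast
    rfl

/-- Divisibility by `p` of an integral polynomial expression can be tested on residues. -/
theorem not_dvd_sq_add {p : ℕ} {c : ℤ} (h : ∀ x : ZMod p, x ^ 2 + c ≠ 0) (k : ℤ) :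
    ¬ (p : ℤ) ∣ k ^ 2 + c := fun hk => h k (by
  have := (ZMod.intCast_zmod_eq_zero_iff_dvd _ p).2 hk
  exact_mod_cast this)

/-- Both conditions on `N = 8k - 1` say `N ≡ 1` modulo `3`, because `N ≡ 7` modulo `8` always. -/
theorem sieveCompatible_three : SieveCompatible 24 {7} 3 {1} := fun k => by
  have h : (∃ r ∈ ({7} : Finset ℤ), 8 * (k : ℤ) - 1 ≡ r [ZMOD 24]) ↔
      ((3 : ℕ) : ℤ) ∣ 8 * k - 1 - 1 := by
    simp only [Finset.mem_singleton, exists_eq_left, Int.ModEq]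
    omega
  simp only [h, Finset.sum_singleton]

/-- Modulo `7` the residues `15`, `23`, `39` are `1`, `2`, `4`, and they are all `7` modulo `8`. -/
theorem sieveCompatible_seven : SieveCompatible 56 {15, 23, 39} 7 {1, 2, 4} := fun k => by
  have h : (∃ r ∈ ({15, 23, 39} : Finset ℤ), 8 * (k : ℤ) - 1 ≡ r [ZMOD 56]) ↔
      k % 7 = 2 ∨ k % 7 = 3 ∨ k % 7 = 5 := by
    simp only [Finset.mem_insert, Finset.mem_singleton, exists_eq_or_imp, exists_eq_left,
      Int.ModEq]
    omega
  have h1 : ((7 : ℕ) : ℤ) ∣ 8 * k - 1 - 1 ↔ k % 7 = 2 := by omega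
  have h2 : ((7 : ℕ) : ℤ) ∣ 8 * k - 1 - 2 ↔ k % 7 = 3 := by omega
  have h4 : ((7 : ℕ) : ℤ) ∣ 8 * k - 1 - 4 ↔ k % 7 = 5 := by omega
  rw [Finset.sum_insert (by decide), Finset.sum_insert (by decide), Finset.sum_singleton]
  simp only [h, h1, h2, h4]
  by_cases c1 : k % 7 = 2
  · simp [c1]
  by_cases c2 : k % 7 = 3
  · simp [c2]
  by_cases c3 : k % 7 = 5
  · simp [c3]
  simp [c1, c2, c3]

/-- A residue is represented as an odd square minus a non-square as soon as this holds in `ZMod p`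
with explicit representatives. -/
theorem exists_odd_sq_sub {p : ℕ} (S : Finset ℤ) (B : ℕ)
    (hS : ∀ s ∈ S, ∀ x : ZMod p, x ^ 2 + (-s : ℤ) ≠ 0)
    (h : ∀ t : ZMod p, t ≠ 0 → ∃ n < B, ∃ s ∈ S, ((2 * n + 1) ^ 2 - s : ZMod p) = t) (t : ℤ)
    (ht : ¬ (p : ℤ) ∣ t) : ∃ (n : ℕ) (s : ℤ), (∀ k : ℤ, ¬ (p : ℤ) ∣ k ^ 2 - s) ∧
      (p : ℤ) ∣ (2 * n + 1) ^ 2 - s - t := by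
  obtain ⟨n, -, s, hs, hn⟩ := h t fun h0 => ht ((ZMod.intCast_zmod_eq_zero_iff_dvd _ p).1 h0)
  refine ⟨n, s, fun k => ?_, ?_⟩
  · rw [sub_eq_add_neg]
    exact not_dvd_sq_add (hS s hs) k
  · rw [← ZMod.intCast_zmod_eq_zero_iff_dvd]
    push_cast
    rw [hn, sub_self]

theorem dvd_of_mem_Gamma0_1152_inf {γ : SL(2, ℤ)}
    (hγ : γ ∈ CongruenceSubgroup.Gamma0 1152 ⊓ CongruenceSubgroup.Gamma1 8) :
    2 ∣ γ 1 0 ∧ ((3 : ℕ) : ℤ) ^ 2 ∣ γ 1 0 ∧ ((3 : ℕ) : ℤ) ∣ γ 1 1 ^ 2 - 1 := by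
  have hc := mem_Gamma0_iff.1 hγ.1
  have hc3 : (3 : ℤ) ∣ γ 1 0 := (by norm_num : (3 : ℤ) ∣ (1152 : ℕ)).trans hc
  refine ⟨(by norm_num : (2 : ℤ) ∣ (1152 : ℕ)).trans hc,
    (by norm_num : ((3 : ℕ) : ℤ) ^ 2 ∣ (1152 : ℕ)).trans hc, ?_⟩
  -- `ad ≡ 1` and every unit modulo `3` has square `1`
  have h1 : ∀ a d : ZMod 3, a * d = 1 → d ^ 2 - 1 = 0 := by decide
  have h4 := congrArg (Int.cast : ℤ → ZMod 3) (SL_det_eq γ)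
  push_cast at h4
  rw [(ZMod.intCast_zmod_eq_zero_iff_dvd _ 3).2 hc3, mul_zero, sub_zero] at h4
  rw [← ZMod.intCast_zmod_eq_zero_iff_dvd]
  push_cast
  exact h1 _ _ h4

theorem dvd_of_mem_Gamma0_6272_inf {γ : SL(2, ℤ)}
    (hγ : γ ∈ CongruenceSubgroup.Gamma0 6272 ⊓ CongruenceSubgroup.Gamma1 8 ⊓ gammaSq 7) :
    2 ∣ γ 1 0 ∧ ((7 : ℕ) : ℤ) ^ 2 ∣ γ 1 0 ∧ ((7 : ℕ) : ℤ) ∣ γ 1 1 ^ 2 - 1 := by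
  have hc := mem_Gamma0_iff.1 hγ.1.1
  refine ⟨(by norm_num : (2 : ℤ) ∣ (6272 : ℕ)).trans hc,
    (by norm_num : ((7 : ℕ) : ℤ) ^ 2 ∣ (6272 : ℕ)).trans hc, ?_⟩
  rw [← ZMod.intCast_zmod_eq_zero_iff_dvd]
  push_cast
  rw [(mem_gammaSq_iff.1 hγ.2).2, sub_self]

end

theorem mainTheorem5 :
    (∀ τ : UpperHalfPlane, HasSum
      (fun n : ℕ => cesaroCoeff n * Complex.exp (2 * Real.pi * Complex.I * τ) ^ n) (cesaro τ)) ∧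
    (∃ Γ : Subgroup SL(2, ℤ), CongruenceSubgroup.Gamma1 1152 ≤ Γ ∧ Γ.index = 9216 ∧
      IsWeaklyHolomorphicModularForm 1 Γ (fun γ => etaMultiplier γ ^ (-3 : ℤ))
        (sievedCesaro 24 {7})) ∧
    (∃ Γ' : Subgroup SL(2, ℤ), CongruenceSubgroup.Gamma1 6272 ≤ Γ' ∧ Γ'.index = 129024 ∧
      IsWeaklyHolomorphicModularForm 1 Γ' (fun γ => etaMultiplier γ ^ (-3 : ℤ))
        (sievedCesaro 56 {15, 23, 39})) := by
  refine ⟨hasSum_cesaro, ⟨_, Gamma1_1152_le, index_Gamma0_1152_inf, ?_⟩,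
    ⟨_, Gamma1_6272_le, index_Gamma0_6272_inf, ?_⟩⟩
  -- `-1` is not a square modulo `3`, and `2` is the only non-square
  · refine isWeaklyHolomorphicModularForm_sievedCesaro three_ne_zero sieveCompatible_three
      (fun ρ hρ => not_dvd_sq_add ?_) (exists_odd_sq_sub {2} 3 (by decide) (by decide))
      (CongruenceSubgroup.isCongruenceSubgroup_trans _ _ Gamma1_1152_le
        (CongruenceSubgroup.Gamma1_is_congruence _)) fun γ => dvd_of_mem_Gamma0_1152_inf
    revert ρ
    decide
  -- `-1`, `-2`, `-4` are the non-squares `6`, `5`, `3` modulo `7`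
  · refine isWeaklyHolomorphicModularForm_sievedCesaro (by norm_num) sieveCompatible_seven
      (fun ρ hρ => not_dvd_sq_add ?_) (exists_odd_sq_sub {3, 5, 6} 7 (by decide) (by decide))
      (CongruenceSubgroup.isCongruenceSubgroup_trans _ _ Gamma1_6272_le
        (CongruenceSubgroup.Gamma1_is_congruence _)) fun γ => dvd_of_mem_Gamma0_6272_inf
    revert ρ
    decide
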